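/- **Setting.** All locally compact groups are Hausdorff. Let $G$ be a locally compact group with left Haar measure $dg$, let $\lambda$ be its left regular representation on $L^2(G)$, $(\lambda(g)\xi)(h)=\xi(g^{-1}h)$, and let $L(G)=\lambda(G)''$ be its group von Neumann algebra. A function $\varphi\colon G\to\mathbb{C}$ is a *completely bounded Fourier multiplier* if there is a (necessarily unique) completely bounded normal (i.e. $\sigma$-weakly continuous) linear map $M_\varphi\colon L(G)\to L(G)$ with $M_\varphi(\lambda(g))=\varphi(g)\lambda(g)$ for all $g\in G$. The space of these functions is denoted by $M_0A(G)$ and has the norm $\|\varphi\|_{M_0A(G)}=\|M_\varphi\|_{\mathrm{cb}}$. It is the dual of the Banach space $M_0A(G)_*$, the completion of $L^1(G)$ with respect to the norm $$\|f\|=\sup\Big\{\Big|\int_G f(g)\varphi(g)\,dg\Big| : \varphi\in M_0A(G),\ \|\varphi\|_{M_0A(G)}\le 1\Big\},$$ and the weak$^*$ topology of $M_0A(G)$ refers to this predual. A *left invariant mean* on $M_0A(G)$ is a positive linear functional $m\colon M_0A(G)\to\mathbb{C}$ with $\|m\|=m(1)=1$ (norm with respect to $\|\cdot\|_\infty$)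 such that $m(L_g\varphi)=m(\varphi)$ for all $g\in G$ and $\varphi\in M_0A(G)$, where $(L_g\varphi)(h)=\varphi(g^{-1}h)$. There is exactly one such mean for every locally compact group $G$. The group $G$ has *property (T$^*$)* if the unique left invariant mean on $M_0A(G)$ is weak$^*$ continuous. **Proposition.** Let $G$ be a locally compact group with a compact normal subgroup $K$. Then $G$ has property (T$^*$) if and only if $G/K$ has property (T$^*$). -/

import Mathlib

open MeasureTheory

noncomputable section

namespace TStar

section CompletelyBounded

variable {H : Type*} [NormedAddCommGroup H] [InnerProductSpace ℂ H] [CompleteSpace H]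

/-- The weak operator topology on a von Neumann algebra of operators on `H`. -/
@[reducible] def wot (A : VonNeumannAlgebra H) : TopologicalSpace A.toStarSubalgebra :=
  TopologicalSpace.induced
    (fun T => (ContinuousLinearMapWOT.ofCLM (T : H →L[ℂ] H) : H →WOT[ℂ] H)) inferInstance

/-- Normality (σ-weak continuity) of a bounded linear map `M : A → A` on a von Neumann algebra:
`M` is continuous for the weak operator topology on the closed unit ball of `A`. On bounded sets
the weak operator topology is the σ-weak topology, and a bounded linear map is σ-weakly continuous
if and only if it is so on the unit ball. -/
def IsNormalMap (A : VonNeumannAlgebra H)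
    (M : A.toStarSubalgebra →ₗ[ℂ] A.toStarSubalgebra) : Prop :=
  @ContinuousOn _ _ (wot A) (wot A) M {T | ‖(T : H →L[ℂ] H)‖ ≤ 1}

/-- The filter of neighbourhoods of `T` in the closed unit ball of `A`, for the weak operator
topology. -/
def ballNhds (A : VonNeumannAlgebra H) (T : A.toStarSubalgebra) : Filter A.toStarSubalgebra :=
  @nhdsWithin _ (wot A) T {T | ‖(T : H →L[ℂ] H)‖ ≤ 1}

theorem tendsto_nhds_wot {A : VonNeumannAlgebra H} {α : Type*} {l : Filter α}
    {f : α → A.toStarSubalgebra} {T : A.toStarSubalgebra} :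
    Filter.Tendsto f l (@nhds _ (wot A) T) ↔ ∀ ξ η : H, Filter.Tendsto
      (fun a => inner ℂ η ((f a : H →L[ℂ] H) ξ)) l (nhds (inner ℂ η ((T : H →L[ℂ] H) ξ))) := by
  have h : @nhds _ (wot A) T = Filter.comap (fun T : A.toStarSubalgebra =>
      (ContinuousLinearMapWOT.ofCLM (T : H →L[ℂ] H) : H →WOT[ℂ] H)) (nhds _) :=
    nhds_induced _ _
  rw [h, Filter.tendsto_comap_iff,
    ContinuousLinearMapWOT.tendsto_iff_forall_inner_apply_tendsto]
  rfl

theorem isNormalMap_iff (A : VonNeumannAlgebra H)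
    (M : A.toStarSubalgebra →ₗ[ℂ] A.toStarSubalgebra) :
    IsNormalMap A M ↔ ∀ T : A.toStarSubalgebra, ‖(T : H →L[ℂ] H)‖ ≤ 1 → ∀ ξ η : H,
      Filter.Tendsto (fun S => inner ℂ η ((M S : H →L[ℂ] H) ξ)) (ballNhds A T)
        (nhds (inner ℂ η ((M T : H →L[ℂ] H) ξ))) :=
  forall₂_congr fun _ _ => tendsto_nhds_wot

theorem tendsto_ballNhds (A : VonNeumannAlgebra H) (T : A.toStarSubalgebra) (ξ η : H) :
    Filter.Tendsto (fun S : A.toStarSubalgebra => inner ℂ η ((S : H →L[ℂ] H) ξ)) (ballNhds A T)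
      (nhds (inner ℂ η ((T : H →L[ℂ] H) ξ))) :=
  tendsto_nhds_wot.1 (Filter.tendsto_id.mono_left (@nhdsWithin_le_nhds _ (wot A) _ _)) ξ η

/-- `CBBound A M C` says that the completely bounded norm of `M : A → A` is at most `C`: for every
`n`, the map that applies `M` to every entry of an `n × n` matrix over `A` has norm at most `C`.
The norm on `n × n` matrices over `B(H)` is the C⋆-norm, i.e. the operator norm on `Hⁿ`. -/
def CBBound (A : VonNeumannAlgebra H)
    (M : A.toStarSubalgebra →ₗ[ℂ] A.toStarSubalgebra) (C : ℝ) : Prop :=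
  ∀ (n : ℕ) (X : CStarMatrix (Fin n) (Fin n) A.toStarSubalgebra),
    ‖X.map (fun T => ((M T : A.toStarSubalgebra) : H →L[ℂ] H))‖ ≤
      C * ‖X.map (fun T => (T : H →L[ℂ] H))‖

end CompletelyBounded

section Group

variable (G : Type*) [Group G] [TopologicalSpace G] [IsTopologicalGroup G]
  [LocallyCompactSpace G] [MeasurableSpace G] [BorelSpace G]

/-- The Hilbert space `L²(G)` with respect to left Haar measure. -/
abbrev L2 : Type _ := Lp ℂ 2 (Measure.haar : Measure G)

variable {G}

/-- The left regular representation `(λ(g) ξ)(h) = ξ(g⁻¹ h)`. -/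
def leftReg (g : G) : L2 G →L[ℂ] L2 G :=
  (Lp.compMeasurePreservingₗᵢ (E := ℂ) (p := 2) ℂ (fun h : G => g⁻¹ * h)
    (measurePreserving_mul_left (Measure.haar : Measure G) g⁻¹)).toContinuousLinearMap

theorem leftReg_mul (g h : G) : leftReg g * leftReg h = leftReg (g * h) := by
  ext1 ξ
  change Lp.compMeasurePreserving _ _ (Lp.compMeasurePreserving _ _ ξ) =
    Lp.compMeasurePreserving _ _ ξ
  rw [← Lp.compMeasurePreserving_comp_apply]
  congr 1
  simp only [Function.comp_def, mul_inv_rev, mul_assoc]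

theorem leftReg_one : leftReg (1 : G) = 1 := by
  ext1 ξ
  change Lp.compMeasurePreserving _ _ ξ = ξ
  simp only [inv_one, one_mul]
  exact Lp.compMeasurePreserving_id_apply ξ

theorem norm_leftReg_apply (g : G) (ξ : L2 G) : ‖leftReg g ξ‖ = ‖ξ‖ := by
  exact LinearIsometry.norm_map _ ξ

theorem star_leftReg (g : G) : star (leftReg g) = leftReg g⁻¹ := by
  have h1 : star (leftReg g) * leftReg g = 1 :=
    (ContinuousLinearMap.norm_map_iff_adjoint_comp_self (leftReg g)).1 (norm_leftReg_apply g)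
  calc star (leftReg g) = star (leftReg g) * (leftReg g * leftReg g⁻¹) := by
        rw [leftReg_mul, mul_inv_cancel, leftReg_one, mul_one]
    _ = leftReg g⁻¹ := by rw [← mul_assoc, h1, one_mul]

variable (G)

/-- The group von Neumann algebra `L(G)`, the double commutant of `λ(G)`. -/
def groupVN : VonNeumannAlgebra (L2 G) where
  toStarSubalgebra := StarSubalgebra.centralizer ℂ
    (StarSubalgebra.centralizer ℂ (Set.range (leftReg : G → L2 G →L[ℂ] L2 G)) :
      Set (L2 G →L[ℂ] L2 G))
  centralizer_centralizer' := by
    change Set.centralizer (Set.centralizer (SetLike.coe (StarSubalgebra.centralizer ℂ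
      (SetLike.coe (StarSubalgebra.centralizer ℂ
        (Set.range (leftReg : G → L2 G →L[ℂ] L2 G))))))) = _
    rw [StarSubalgebra.coe_centralizer_centralizer, Set.centralizer_centralizer_centralizer]
    exact (StarSubalgebra.coe_centralizer_centralizer ℂ _).symm

variable {G}

theorem leftReg_mem (g : G) : leftReg g ∈ (groupVN G).toStarSubalgebra := by
  have h := StarSubalgebra.coe_centralizer_centralizer ℂ
    (Set.range (leftReg : G → L2 G →L[ℂ] L2 G))
  have h2 : leftReg g ∈ SetLike.coe (StarSubalgebra.centralizer ℂ (SetLike.coe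
      (StarSubalgebra.centralizer ℂ (Set.range (leftReg : G → L2 G →L[ℂ] L2 G))))) := by
    rw [h]
    exact Set.subset_centralizer_centralizer (Or.inl ⟨g, rfl⟩)
  exact h2

/-- `λ(g)` as an element of `L(G)`. -/
def lam (g : G) : (groupVN G).toStarSubalgebra := ⟨leftReg g, leftReg_mem g⟩

/-- `φ` is a completely bounded Fourier multiplier of norm at most `C`: the assignment
`λ(g) ↦ φ(g) λ(g)` is given by a normal linear map `M_φ : L(G) → L(G)` with completely bounded norm
at most `C`. (Such a map is unique, as the span of `λ(G)` is σ-weakly dense in `L(G)`.) -/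
def IsCBMultiplierWith (φ : G → ℂ) (C : ℝ) : Prop :=
  ∃ M : (groupVN G).toStarSubalgebra →ₗ[ℂ] (groupVN G).toStarSubalgebra,
    IsNormalMap (groupVN G) M ∧ (∀ g, M (lam g) = φ g • lam g) ∧ CBBound (groupVN G) M C

variable (G)

/-- The space `M₀A(G)` of completely bounded Fourier multipliers of `G`. -/
def M0A : Submodule ℂ (G → ℂ) where
  carrier := {φ | ∃ C : ℝ, IsCBMultiplierWith φ C}
  add_mem' := by
    rintro φ ψ ⟨C, M, hM, hφ, hC⟩ ⟨D, N, hN, hψ, hD⟩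
    refine ⟨C + D, M + N, ?_, ?_, ?_⟩
    · rw [isNormalMap_iff] at hM hN ⊢
      intro T hT ξ η
      simpa [inner_add_right] using (hM T hT ξ η).add (hN T hT ξ η)
    · intro g
      simp [hφ, hψ, add_smul]
    · intro n X
      rw [add_mul]
      refine le_trans ?_ (add_le_add (hC n X) (hD n X))
      refine le_trans (le_of_eq ?_) (norm_add_le _ _)
      congr 1
  zero_mem' := by
    refine ⟨0, 0, ?_, ?_, ?_⟩
    · rw [isNormalMap_iff]
      intro T hT ξ η
      simpa using tendsto_const_nhds
    · intro g
      simp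
    · intro n X
      rw [zero_mul]
      refine le_of_eq ?_
      rw [norm_eq_zero]
      rfl
  smul_mem' := by
    rintro c φ ⟨C, M, hM, hφ, hC⟩
    refine ⟨‖c‖ * C, c • M, ?_, ?_, ?_⟩
    · rw [isNormalMap_iff] at hM ⊢
      intro T hT ξ η
      simpa [inner_smul_right] using (hM T hT ξ η).const_mul c
    · intro g
      simp [hφ, smul_smul]
    · intro n X
      rw [mul_assoc]
      refine le_trans ?_ (mul_le_mul_of_nonneg_left (hC n X) (norm_nonneg c))
      rw [← norm_smul]
      exact le_of_eq rfl

variable {G}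

theorem one_mem_M0A : (1 : G → ℂ) ∈ M0A G := by
  refine ⟨1, LinearMap.id, ?_, ?_, ?_⟩
  · rw [isNormalMap_iff]
    exact fun T _ ξ η => tendsto_ballNhds _ T ξ η
  · intro g
    simp
  · intro n X
    rw [one_mul]
    exact le_rfl

theorem translate_mem_M0A (g : G) {φ : G → ℂ} (hφ : φ ∈ M0A G) :
    (fun h => φ (g⁻¹ * h)) ∈ M0A G := by
  obtain ⟨C, M, hM, hφ, hC⟩ := hφ
  refine ⟨C, LinearMap.mulLeft ℂ (lam g) ∘ₗ M ∘ₗ LinearMap.mulLeft ℂ (lam g⁻¹), ?_, ?_, ?_⟩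
  · rw [isNormalMap_iff] at hM ⊢
    intro T hT ξ η
    have hle : ∀ S : (groupVN G).toStarSubalgebra, ‖(S : L2 G →L[ℂ] L2 G)‖ ≤ 1 →
        ‖((lam g⁻¹ * S : (groupVN G).toStarSubalgebra) : L2 G →L[ℂ] L2 G)‖ ≤ 1 := fun S hS =>
      ContinuousLinearMap.opNorm_le_bound _ zero_le_one fun ζ =>
        (norm_leftReg_apply g⁻¹ ((S : L2 G →L[ℂ] L2 G) ζ)).le.trans
          (ContinuousLinearMap.le_of_opNorm_le _ hS ζ)
    have hin : ∀ (a : G) (S : (groupVN G).toStarSubalgebra) (ζ θ : L2 G),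
        inner ℂ θ (((lam a * S : (groupVN G).toStarSubalgebra) : L2 G →L[ℂ] L2 G) ζ) =
          inner ℂ (leftReg a⁻¹ θ) ((S : L2 G →L[ℂ] L2 G) ζ) := by
      intro a S ζ θ
      rw [← star_leftReg, ContinuousLinearMap.star_eq_adjoint,
        ContinuousLinearMap.adjoint_inner_left]
      rfl
    have ht : Filter.Tendsto (fun S => lam g⁻¹ * S) (ballNhds (groupVN G) T)
        (ballNhds (groupVN G) (lam g⁻¹ * T)) := by
      refine Filter.tendsto_inf.2 ⟨tendsto_nhds_wot.2 fun ζ θ => ?_, ?_⟩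
      · simp only [hin]
        exact tendsto_ballNhds _ T _ _
      · refine Filter.tendsto_principal.2 ?_
        filter_upwards [@self_mem_nhdsWithin _ (wot (groupVN G)) T _] with S hS
        exact hle S hS
    simp only [LinearMap.comp_apply, LinearMap.mulLeft_apply, hin]
    exact (hM _ (hle T hT) _ _).comp ht
  · intro h
    have h1 : ∀ a b : G, lam a * lam b = lam (a * b) := fun a b => Subtype.ext (leftReg_mul a b)
    simp [h1, hφ]
  · intro n X
    have key : ∀ (a : G) (Y : CStarMatrix (Fin n) (Fin n) (L2 G →L[ℂ] L2 G)),
        ‖Y.map (fun T => leftReg a * T)‖ = ‖Y‖ := by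
      intro a Y
      have hs : star (leftReg a) * leftReg a = 1 := by
        rw [star_leftReg, leftReg_mul, inv_mul_cancel, leftReg_one]
      have h : star (Y.map (fun T => leftReg a * T)) * Y.map (fun T => leftReg a * T) =
          star Y * Y := by
        ext1 i j
        simp only [CStarMatrix.mul_apply, CStarMatrix.star_apply, CStarMatrix.map_apply, star_mul]
        refine Finset.sum_congr rfl fun k _ => ?_
        rw [mul_assoc, ← mul_assoc (star (leftReg a)), hs, one_mul]
      have h' := congrArg norm h
      have e : ∀ Z : CStarMatrix (Fin n) (Fin n) (L2 G →L[ℂ] L2 G),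
          ‖star Z * Z‖ = ‖Z‖ * ‖Z‖ := fun Z => CStarRing.norm_star_mul_self
      rw [e, e] at h'
      exact (mul_self_inj (norm_nonneg _) (norm_nonneg _)).1 h'
    have h1 := hC n (X.map (fun T => lam g⁻¹ * T))
    have h2 := key g ((X.map (fun T => lam g⁻¹ * T)).map
      (fun T => ((M T : (groupVN G).toStarSubalgebra) : L2 G →L[ℂ] L2 G)))
    have h3 := key g⁻¹ (X.map (fun T => (T : L2 G →L[ℂ] L2 G)))
    exact (h2.le.trans h1).trans (le_of_eq (congrArg (C * ·) h3))

/-- The left translation operator `(L_g φ)(h) = φ(g⁻¹ h)` on `M₀A(G)`. -/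
def leftTranslate (g : G) (φ : M0A G) : M0A G :=
  ⟨fun h => (φ : G → ℂ) (g⁻¹ * h), translate_mem_M0A g φ.2⟩

/-- The norm `‖φ‖ = ‖M_φ‖_cb` of `M₀A(G)`. -/
def m0aNorm (φ : M0A G) : ℝ := sInf {C : ℝ | 0 ≤ C ∧ IsCBMultiplierWith (φ : G → ℂ) C}

/-- A left invariant mean on `M₀A(G)`: a positive linear functional `m` with `‖m‖ = m(1) = 1`
(the norm of `m` being taken with respect to the supremum norm) that is invariant under left
translations. -/
structure IsLeftInvariantMean (m : M0A G →ₗ[ℂ] ℂ) : Prop where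
  nonneg : ∀ φ : M0A G, (∀ g, ∃ r : ℝ, 0 ≤ r ∧ (φ : G → ℂ) g = r) → ∃ r : ℝ, 0 ≤ r ∧ m φ = r
  map_one : m ⟨1, one_mem_M0A⟩ = 1
  norm_le : ∀ (φ : M0A G) (c : ℝ), (∀ g, ‖(φ : G → ℂ) g‖ ≤ c) → ‖m φ‖ ≤ c
  left_invariant : ∀ (g : G) (φ : M0A G), m (leftTranslate g φ) = m φ

variable (G)

/-- The predual `M₀A(G)_*`, the completion of `L¹(G)` for the norm
`‖f‖ = sup {|∫ f φ| : ‖φ‖_{M₀A(G)} ≤ 1}`, realised as the norm closure of (the image of) `L¹(G)` in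
the dual of `M₀A(G)`. -/
def predual : Set (M0A G →ₗ[ℂ] ℂ) :=
  {x | ∀ ε : ℝ, 0 < ε → ∃ f : G → ℂ, Integrable f (Measure.haar : Measure G) ∧
    ∀ φ : M0A G, ‖x φ - ∫ g, f g * (φ : G → ℂ) g ∂(Measure.haar : Measure G)‖ ≤ ε * m0aNorm φ}

/-- The weak* topology of `M₀A(G)` as the dual of `M₀A(G)_*`: the coarsest topology for which all
elements of `M₀A(G)_*` are continuous. -/
@[reducible] def weakStar : TopologicalSpace (M0A G) :=
  ⨅ x ∈ predual G, TopologicalSpace.induced x inferInstance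

end Group

end TStar

/-- Property (T*) of a locally compact group `G`: there is a unique left invariant mean on `M₀A(G)`
(this holds for all locally compact groups), and it is continuous for the weak* topology. The group
carries its Borel σ-algebra. -/
def PropertyTStar (G : Type*) [Group G] [TopologicalSpace G] [IsTopologicalGroup G]
    [LocallyCompactSpace G] : Prop :=
  letI : MeasurableSpace G := borel G
  haveI : BorelSpace G := ⟨rfl⟩
  ∃ m : TStar.M0A G →ₗ[ℂ] ℂ, TStar.IsLeftInvariantMean m ∧
    (∀ m' : TStar.M0A G →ₗ[ℂ] ℂ, TStar.IsLeftInvariantMean m' → m' = m) ∧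
    @Continuous _ _ (TStar.weakStar G) inferInstance m

end

/-! Let `q : G → Q` be the quotient map by a compact normal subgroup `K`. Two maps link the
multiplier spaces: composition with `q` (`pullM0A`) from `M₀A(Q)` to `M₀A(G)`, and averaging over
`K` (`pushM0A`) in the other direction. Both do not increase the norm, both are compatible with
translations, and `pushM0A ∘ pullM0A` is the identity. By Fubini each of them is the transpose of a
map of `L¹` densities, hence weak* continuous. So composing with them turns left invariant means
into left invariant means and keeps weak* continuity.

Uniqueness of the mean is part of `PropertyTStar` and has to be transported too. For `Q` it follows
from `pushM0A ∘ pullM0A = id`. For `G` one needs that every left invariant mean takes the same value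
on `φ` and on its average over `K` (`isLeftInvariantMean_apply_eq`). The average is only a pointwise
limit of convex combinations of left translates, and a mean need not respect such limits. What helps
is a double limit principle in the style of Grothendieck (`IsCBMultiplierWith.eq_of_triangular`): if
the two values differed, averages of the kernel `(s, t) ↦ φ(s t)` would come close to a triangular
array. This kernel is a Schur multiplier, whereas triangular truncation is unbounded: pairing with
the Hilbert matrix, of norm at most `π`, produces sums of order `N log N` against a bound of order
`N`.

That averaging keeps the multiplier bound (`isCBMultiplierWith_quotAvg`) is seen on von Neumann
algebras. With the isometry `J : L²(Q) → L²(G)` onto the `K`-fixed vectors, `y ↦ J y J⋆` embeds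
`L(Q)` in `L(G)` and sends `λ(q g)` to the average of `λ(k g)` over `k ∈ K`. The compression `J⋆
M_φ(J · J⋆) J` is then the multiplier map of the averaged function, where normality of `M_φ` moves
the average out.

That composition with `q` keeps the bound (`IsCBMultiplierWith.comp_hom`) uses the coaction `Δ :
L(G) → L(G) ⊗ L(Q)`, `λ(g) ↦ λ(g) ⊗ λ(q g)`. If `N` is the multiplier map of `ψ`, then `V⋆ (id ⊗
N)(Δ x) V` is the multiplier map of `ψ ∘ q`, where `(V a)(s) = a(s) λ(q s) c₀` for a unit vector
`c₀`. The tensor product is handled through vector valued functions, slices of `Δ` and finite sums,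
with a limit at the end. Identities between normal functionals are checked on `λ(G)` only; this is
legitimate by Kaplansky's density theorem (`eq_zero_of_ballNormal`). -/

noncomputable section

set_option linter.unusedSectionVars false

namespace TStar

open Filter Topology

/-! ### Matrices of operators and their norms as norms of scalar forms -/

section OperatorMatrices

variable {H : Type*} [NormedAddCommGroup H] [InnerProductSpace ℂ H] [CompleteSpace H]

/-- The sesquilinear form on tuples of vectors given by a matrix of operators. -/
def matrixForm {ι κ : Type*} [Fintype ι] [Fintype κ] (X : ι → κ → H →L[ℂ] H)
    (η : ι → H) (ξ : κ → H) : ℂ := ∑ i, ∑ j, inner ℂ (η i) (X i j (ξ j))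

/-- The `ℓ²` norm of a tuple of vectors. -/
def tupleNorm {F : Type*} [NormedAddCommGroup F] {ι : Type*} [Fintype ι] (ξ : ι → F) : ℝ :=
  √(∑ i, ‖ξ i‖ ^ 2)

theorem tupleNorm_nonneg {F : Type*} [NormedAddCommGroup F] {ι : Type*} [Fintype ι] (ξ : ι → F) :
    0 ≤ tupleNorm ξ := Real.sqrt_nonneg _

theorem tupleNorm_sq {F : Type*} [NormedAddCommGroup F] {ι : Type*} [Fintype ι] (ξ : ι → F) :
    tupleNorm ξ ^ 2 = ∑ i, ‖ξ i‖ ^ 2 := Real.sq_sqrt (by positivity)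

/-- The operator on `Hⁿ` given by a matrix of operators. -/
def matrixOp {n : ℕ} (X : CStarMatrix (Fin n) (Fin n) (H →L[ℂ] H)) :
    PiLp 2 (fun _ : Fin n => H) →L[ℂ] PiLp 2 (fun _ : Fin n => H) :=
  (PiLp.continuousLinearEquiv 2 ℂ (fun _ : Fin n => H)).symm.toContinuousLinearMap ∘L
    ContinuousLinearMap.pi (fun i => ∑ j, (X i j) ∘L ContinuousLinearMap.proj j) ∘L
    (PiLp.continuousLinearEquiv 2 ℂ (fun _ : Fin n => H)).toContinuousLinearMap

theorem matrixOp_apply {n : ℕ} (X : CStarMatrix (Fin n) (Fin n) (H →L[ℂ] H))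
    (ξ : PiLp 2 (fun _ : Fin n => H)) (i : Fin n) : matrixOp X ξ i = ∑ j, X i j (ξ j) := by
  simp [matrixOp]

theorem inner_matrixOp {n : ℕ} (X : CStarMatrix (Fin n) (Fin n) (H →L[ℂ] H))
    (ξ η : PiLp 2 (fun _ : Fin n => H)) : inner ℂ η (matrixOp X ξ) = matrixForm X η ξ := by
  simp [PiLp.inner_apply, matrixOp_apply, matrixForm, inner_sum]

/-- The representation of matrices over `B(H)` on `Hⁿ`. -/
def matrixRep (n : ℕ) : CStarMatrix (Fin n) (Fin n) (H →L[ℂ] H) →⋆ₙₐ[ℂ]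
    (PiLp 2 (fun _ : Fin n => H) →L[ℂ] PiLp 2 (fun _ : Fin n => H)) where
  toFun := matrixOp
  map_smul' c X := by
    ext ξ i
    simp [matrixOp_apply, Finset.smul_sum]
  map_zero' := by
    ext ξ i
    simp [matrixOp_apply]
  map_add' X Y := by
    ext ξ i
    simp [matrixOp_apply, Finset.sum_add_distrib]
  map_mul' X Y := by
    ext ξ i
    simp only [matrixOp_apply, CStarMatrix.mul_apply, mul_apply_eq_comp, sum_apply, map_sum]
    exact Finset.sum_comm
  map_star' X := by
    rw [ContinuousLinearMap.star_eq_adjoint, ContinuousLinearMap.eq_adjoint_iff]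
    intro ξ η
    rw [← inner_conj_symm, inner_matrixOp, inner_matrixOp]
    simp only [matrixForm, map_sum, CStarMatrix.star_apply, ContinuousLinearMap.star_eq_adjoint,
      ContinuousLinearMap.adjoint_inner_right, inner_conj_symm]
    exact Finset.sum_comm

/-- An injective star homomorphism of C⋆-algebras is isometric. Injectivity is read off on vectors
with a single nonzero coordinate. -/
theorem norm_matrixOp {n : ℕ} (X : CStarMatrix (Fin n) (Fin n) (H →L[ℂ] H)) :
    ‖matrixOp X‖ = ‖X‖ := by
  refine NonUnitalStarAlgHom.norm_map (matrixRep (H := H) n) ?_ X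
  refine (injective_iff_map_eq_zero _).2 fun Y hY => ?_
  ext i j ξ
  have h := congrArg (fun T => T (WithLp.toLp 2 (Pi.single j ξ)) i) hY
  simp only [matrixRep, NonUnitalStarAlgHom.coe_mk] at h
  change matrixOp Y _ _ = 0 at h
  rw [matrixOp_apply, Finset.sum_eq_single j] at h
  · simpa using h
  · intro k _ hk
    simp [Pi.single_eq_of_ne hk]
  · simp

theorem tupleNorm_eq {n : ℕ} (ξ : PiLp 2 (fun _ : Fin n => H)) : tupleNorm ξ = ‖ξ‖ :=
  (PiLp.norm_eq_of_L2 ξ).symm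

/-- All matrix norm estimates below are carried out on scalar forms, which behave well under limits,
compressions and changes of the index set. -/
theorem norm_le_iff_matrixForm {n : ℕ} (X : CStarMatrix (Fin n) (Fin n) (H →L[ℂ] H)) {K : ℝ}
    (hK : 0 ≤ K) : ‖X‖ ≤ K ↔ ∀ η ξ : Fin n → H,
      ‖matrixForm X η ξ‖ ≤ K * tupleNorm η * tupleNorm ξ := by
  rw [← norm_matrixOp]
  constructor
  · intro h η ξ
    have h1 := inner_matrixOp X (WithLp.toLp 2 ξ) (WithLp.toLp 2 η)
    have h2 := tupleNorm_eq (WithLp.toLp 2 ξ)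
    have h3 := tupleNorm_eq (WithLp.toLp 2 η)
    change _ = matrixForm X η ξ at h1
    change tupleNorm ξ = _ at h2
    change tupleNorm η = _ at h3
    rw [← h1, h2, h3, mul_comm K, mul_assoc]
    refine (norm_inner_le_norm _ _).trans (mul_le_mul_of_nonneg_left ?_ (norm_nonneg _))
    exact ContinuousLinearMap.le_of_opNorm_le _ h _
  · intro h
    refine ContinuousLinearMap.opNorm_le_bound _ hK fun ξ => ?_
    -- Testing against the image vector bounds its squared norm; one factor cancels unless it is
    -- zero.
    have h1 := h (matrixOp X ξ) ξ
    rw [← inner_matrixOp, tupleNorm_eq, tupleNorm_eq, inner_self_eq_norm_sq_to_K] at h1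
    norm_cast at h1
    rw [abs_of_nonneg (by positivity)] at h1
    rcases (norm_nonneg (matrixOp X ξ)).eq_or_lt with h0 | h0
    · rw [← h0]; positivity
    · nlinarith

/-- The form of a complete bound for matrices indexed by arbitrary finite types. -/
theorem CBBound.matrixForm_le {A : VonNeumannAlgebra H}
    {M : A.toStarSubalgebra →ₗ[ℂ] A.toStarSubalgebra} {C : ℝ} (hM : CBBound A M C) (hC : 0 ≤ C)
    {ι : Type*} [Fintype ι] (X : ι → ι → A.toStarSubalgebra) {K : ℝ} (hK : 0 ≤ K)
    (hX : ∀ η ξ : ι → H, ‖matrixForm (fun i j => (X i j : H →L[ℂ] H)) η ξ‖ ≤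
      K * tupleNorm η * tupleNorm ξ) (η ξ : ι → H) :
    ‖matrixForm (fun i j => (M (X i j) : H →L[ℂ] H)) η ξ‖ ≤
      C * K * tupleNorm η * tupleNorm ξ := by
  classical
  have e := (Fintype.equivFin ι).symm
  have hform : ∀ (Y : ι → ι → H →L[ℂ] H) (η ξ : ι → H),
      matrixForm (fun i j => Y (e i) (e j)) (η ∘ e) (ξ ∘ e) = matrixForm Y η ξ := by
    intro Y η ξ
    simp only [matrixForm, Function.comp_apply]
    rw [← e.sum_comp (fun i => ∑ j, inner ℂ (η i) (Y i j (ξ j)))]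
    refine Finset.sum_congr rfl fun i _ => ?_
    exact e.sum_comp (fun j => inner ℂ (η (e i)) (Y (e i) j (ξ j)))
  have hnorm : ∀ η : ι → H, tupleNorm (η ∘ e) = tupleNorm η := by
    intro η
    simp only [tupleNorm, Function.comp_apply]
    rw [e.sum_comp (fun i => ‖η i‖ ^ 2)]
  let Z : CStarMatrix (Fin (Fintype.card ι)) (Fin (Fintype.card ι)) A.toStarSubalgebra :=
    fun i j => X (e i) (e j)
  have h1 := hM _ Z
  have h2 : ‖Z.map (fun T => (T : H →L[ℂ] H))‖ ≤ K := by
    rw [norm_le_iff_matrixForm _ hK]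
    intro η' ξ'
    have h := hX (η' ∘ e.symm) (ξ' ∘ e.symm)
    rw [← hform, ← hnorm, ← hnorm (ξ' ∘ e.symm)] at h
    simp only [Function.comp_assoc, Equiv.symm_comp_self, Function.comp_id] at h
    exact h
  have h3 := (norm_le_iff_matrixForm _ (mul_nonneg hC hK)).1
    (h1.trans (mul_le_mul_of_nonneg_left h2 hC)) (η ∘ e) (ξ ∘ e)
  rw [hnorm, hnorm] at h3
  rw [← hform]
  exact h3

theorem cbBound_of_matrixForm_le {A : VonNeumannAlgebra H}
    {M : A.toStarSubalgebra →ₗ[ℂ] A.toStarSubalgebra} {C : ℝ} (hC : 0 ≤ C)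
    (h : ∀ (n : ℕ) (X : Fin n → Fin n → A.toStarSubalgebra) (K : ℝ), 0 ≤ K →
      (∀ η ξ : Fin n → H, ‖matrixForm (fun i j => (X i j : H →L[ℂ] H)) η ξ‖ ≤
        K * tupleNorm η * tupleNorm ξ) → ∀ η ξ : Fin n → H,
      ‖matrixForm (fun i j => (M (X i j) : H →L[ℂ] H)) η ξ‖ ≤
        C * K * tupleNorm η * tupleNorm ξ) : CBBound A M C := by
  intro n X
  rw [norm_le_iff_matrixForm _ (by positivity)]
  exact h n X _ (norm_nonneg _)
    ((norm_le_iff_matrixForm (X.map (fun T => (T : H →L[ℂ] H))) (norm_nonneg _)).1 le_rfl)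

theorem CBBound.mono {A : VonNeumannAlgebra H}
    {M : A.toStarSubalgebra →ₗ[ℂ] A.toStarSubalgebra} {C D : ℝ} (hM : CBBound A M C)
    (h : C ≤ D) : CBBound A M D := fun n X =>
  (hM n X).trans (mul_le_mul_of_nonneg_right h (norm_nonneg _))

theorem CBBound.norm_le {A : VonNeumannAlgebra H}
    {M : A.toStarSubalgebra →ₗ[ℂ] A.toStarSubalgebra} {C : ℝ} (hM : CBBound A M C) (hC : 0 ≤ C)
    (T : A.toStarSubalgebra) : ‖(M T : H →L[ℂ] H)‖ ≤ C * ‖(T : H →L[ℂ] H)‖ := by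
  have h := hM.matrixForm_le hC (ι := Unit) (fun _ _ => T) (norm_nonneg (T : H →L[ℂ] H)) ?_
  · refine ContinuousLinearMap.opNorm_le_bound _ (by positivity) fun ξ => ?_
    have h1 := h (fun _ => (M T : H →L[ℂ] H) ξ) (fun _ => ξ)
    simp only [matrixForm, tupleNorm, Finset.univ_unique, Finset.sum_singleton,
      Real.sqrt_sq (norm_nonneg _), inner_self_eq_norm_sq_to_K] at h1
    norm_cast at h1
    rw [abs_of_nonneg (by positivity)] at h1
    rcases (norm_nonneg ((M T : H →L[ℂ] H) ξ)).eq_or_lt with h0 | h0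
    · rw [← h0]; positivity
    · nlinarith
  · intro η ξ
    simp only [matrixForm, tupleNorm, Finset.univ_unique, Finset.sum_singleton,
      Real.sqrt_sq (norm_nonneg _)]
    refine (norm_inner_le_norm _ _).trans ?_
    rw [mul_comm _ ‖η _‖, mul_assoc]
    exact mul_le_mul_of_nonneg_left (ContinuousLinearMap.le_opNorm _ _) (norm_nonneg _)

end OperatorMatrices

/-! ### Double commutants and strong-star approximation -/

section Kaplansky

variable {H : Type*} [NormedAddCommGroup H] [InnerProductSpace ℂ H] [CompleteSpace H]

/-- `y` lies in the double commutant of `S`. -/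
def InBicommutant (S : StarSubalgebra ℂ (H →L[ℂ] H)) (y : H →L[ℂ] H) : Prop :=
  ∀ T : H →L[ℂ] H, (∀ a ∈ S, Commute a T) → Commute y T

/-- The diagonal amplification of an operator. -/
def diagOp {ι : Type*} [Fintype ι] (a : H →L[ℂ] H) :
    PiLp 2 (fun _ : ι => H) →L[ℂ] PiLp 2 (fun _ : ι => H) :=
  (PiLp.continuousLinearEquiv 2 ℂ (fun _ : ι => H)).symm.toContinuousLinearMap ∘L
    ContinuousLinearMap.pi (fun i => a ∘L ContinuousLinearMap.proj i) ∘L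
    (PiLp.continuousLinearEquiv 2 ℂ (fun _ : ι => H)).toContinuousLinearMap

theorem diagOp_apply {ι : Type*} [Fintype ι] (a : H →L[ℂ] H)
    (ξ : PiLp 2 (fun _ : ι => H)) (i : ι) : diagOp a ξ i = a (ξ i) := by
  simp [diagOp]

theorem diagOp_mul {ι : Type*} [Fintype ι] (a b : H →L[ℂ] H) (ξ : PiLp 2 (fun _ : ι => H)) :
    diagOp (a * b) ξ = diagOp a (diagOp b ξ) := by
  ext i
  simp [diagOp_apply]

theorem diagOp_one {ι : Type*} [Fintype ι] (ξ : PiLp 2 (fun _ : ι => H)) :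
    diagOp (1 : H →L[ℂ] H) ξ = ξ := by
  ext i
  simp [diagOp_apply]

theorem inner_diagOp_star {ι : Type*} [Fintype ι] (a : H →L[ℂ] H)
    (ξ η : PiLp 2 (fun _ : ι => H)) : inner ℂ (diagOp (star a) η) ξ = inner ℂ η (diagOp a ξ) := by
  simp [PiLp.inner_apply, diagOp_apply, ContinuousLinearMap.star_eq_adjoint,
    ContinuousLinearMap.adjoint_inner_left]

/-- A vector functional on finitely many copies of `H` that vanishes on a star algebra vanishes on
its double commutant. -/
theorem InBicommutant.sum_inner_eq_zero {S : StarSubalgebra ℂ (H →L[ℂ] H)} {y : H →L[ℂ] H}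
    (hy : InBicommutant S y) {ι : Type*} [Fintype ι] (η ξ : ι → H)
    (h : ∀ a ∈ S, ∑ i, inner ℂ (η i) (a (ξ i)) = 0) : ∑ i, inner ℂ (η i) (y (ξ i)) = 0 := by
  classical
  let ξ' : PiLp 2 (fun _ : ι => H) := WithLp.toLp 2 ξ
  let η' : PiLp 2 (fun _ : ι => H) := WithLp.toLp 2 η
  -- `V`, the closure of the orbit `W` of `ξ'`, is invariant under the amplified star algebra, so
  -- the projection onto it commutes with this algebra.
  let W : Submodule ℂ (PiLp 2 (fun _ : ι => H)) :=
    { carrier := {v | ∃ a ∈ S, v = diagOp a ξ'}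
      add_mem' := by
        rintro _ _ ⟨a, ha, rfl⟩ ⟨b, hb, rfl⟩
        refine ⟨a + b, add_mem ha hb, ?_⟩
        ext i
        simp [diagOp_apply]
      zero_mem' := by
        refine ⟨0, zero_mem S, ?_⟩
        ext i
        simp [diagOp_apply]
      smul_mem' := by
        rintro c _ ⟨a, ha, rfl⟩
        refine ⟨c • a, S.smul_mem ha c, ?_⟩
        ext i
        simp [diagOp_apply] }
  let V : Submodule ℂ (PiLp 2 (fun _ : ι => H)) := W.topologicalClosure
  have : CompleteSpace V := W.isClosed_topologicalClosure.completeSpace_coe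
  have hWV : W ≤ V := W.le_topologicalClosure
  have hinv : ∀ a ∈ S, ∀ v ∈ V, diagOp a v ∈ V := by
    intro a ha v hv
    refine map_mem_closure (f := fun v => diagOp a v) (diagOp a).continuous hv ?_
    rintro _ ⟨b, hb, rfl⟩
    exact ⟨a * b, mul_mem ha hb, (diagOp_mul a b ξ').symm⟩
  have hcomm : ∀ a ∈ S, ∀ v : PiLp 2 (fun _ : ι => H), diagOp a (V.starProjection v) = V.starProjection (diagOp a v) := by
    intro a ha v
    refine (Submodule.eq_starProjection_of_mem_of_inner_eq_zero
      (hinv a ha _ (Submodule.starProjection_apply_mem V v)) fun w hw => ?_).symm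
    rw [← map_sub, ← star_star a, inner_diagOp_star]
    exact Submodule.starProjection_inner_eq_zero v _ (hinv _ (star_mem ha) w hw)
  -- The matrix entries of the projection lie in the commutant of `S`, hence commute with `y`; so
  -- the amplification of `y` leaves `V` invariant as well.
  let Pij : ι → ι → H →L[ℂ] H := fun i j => PiLp.proj 2 (fun _ : ι => H) i ∘L V.starProjection ∘L
    (PiLp.continuousLinearEquiv 2 ℂ (fun _ : ι => H)).symm.toContinuousLinearMap ∘L
      ContinuousLinearMap.single ℂ (fun _ : ι => H) j
  have hPij : ∀ i j (w : H), Pij i j w = V.starProjection (PiLp.single 2 j w) i := fun _ _ _ => rfl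
  have hyP : ∀ i j, Commute y (Pij i j) := by
    intro i j
    refine hy _ fun a ha => ?_
    ext w
    rw [mul_apply_eq_comp, mul_apply_eq_comp, hPij, hPij]
    have h1 := congrArg (fun v : PiLp 2 (fun _ : ι => H) => v i) (hcomm a ha (PiLp.single 2 j w))
    simp only [diagOp_apply] at h1
    rw [h1]
    have h2 : diagOp a (PiLp.single 2 j w) = PiLp.single 2 j (a w) := by
      ext k
      rw [diagOp_apply]
      by_cases hk : k = j
      · subst hk; simp
      · simp [hk]
    rw [h2]
  have hsum : ∀ v : PiLp 2 (fun _ : ι => H), v = ∑ j, PiLp.single 2 j (v j) := by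
    intro v
    ext k
    rw [WithLp.ofLp_sum, Finset.sum_apply, Finset.sum_eq_single k]
    · simp
    · intro j _ hj
      simp [Ne.symm hj]
    · simp
  have hyP' : ∀ v : PiLp 2 (fun _ : ι => H), diagOp y (V.starProjection v) = V.starProjection (diagOp y v) := by
    intro v
    ext i
    rw [diagOp_apply]
    conv_lhs => rw [hsum v]
    conv_rhs => rw [hsum (diagOp y v)]
    simp only [map_sum, WithLp.ofLp_sum, Finset.sum_apply]
    refine Finset.sum_congr rfl fun j _ => ?_
    have h1 := congrArg (fun T => T (v j)) (hyP i j).eq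
    simp only [mul_apply_eq_comp] at h1
    rw [hPij, hPij] at h1
    rw [h1, diagOp_apply]
  have hξ : ξ' ∈ V := hWV ⟨1, one_mem S, (diagOp_one ξ').symm⟩
  have hyξ : diagOp y ξ' ∈ V := by
    rw [← Submodule.starProjection_eq_self_iff.2 hξ, hyP']
    exact Submodule.starProjection_apply_mem V _
  have hη : V ≤ (ℂ ∙ η')ᗮ := by
    refine Submodule.topologicalClosure_minimal _ ?_ (Submodule.isClosed_orthogonal _)
    rintro _ ⟨a, ha, rfl⟩
    rw [Submodule.mem_orthogonal_singleton_iff_inner_right, PiLp.inner_apply]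
    simpa [diagOp_apply] using h a ha
  have h2 := hη hyξ
  rw [Submodule.mem_orthogonal_singleton_iff_inner_right, PiLp.inner_apply] at h2
  simpa [diagOp_apply] using h2

/-- Since `a ↦ (a ξ, a⋆ ξ)` is only real linear, its values on `S` form a real subspace. A vector
orthogonal to it for the real inner product gives a functional of the kind treated in
`InBicommutant.sum_inner_eq_zero`, because `a⋆` can be moved to the other side. -/
theorem InBicommutant.exists_strong_star_approx {S : StarSubalgebra ℂ (H →L[ℂ] H)}
    {y : H →L[ℂ] H} (hy : InBicommutant S y) (F : Finset H) {ε : ℝ} (hε : 0 < ε) :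
    ∃ a ∈ S, ∀ ξ ∈ F, ‖(a - y) ξ‖ < ε ∧ ‖(star a - star y) ξ‖ < ε := by
  classical
  let vec : (H →L[ℂ] H) → PiLp 2 (fun _ : F ⊕ F => H) := fun a =>
    WithLp.toLp 2 (Sum.elim (fun i : F => a (i : H)) (fun i : F => star a (i : H)))
  let W : Submodule ℝ (PiLp 2 (fun _ : F ⊕ F => H)) :=
    { carrier := {v | ∃ a ∈ S, v = vec a}
      add_mem' := by
        rintro _ _ ⟨a, ha, rfl⟩ ⟨b, hb, rfl⟩
        refine ⟨a + b, add_mem ha hb, ?_⟩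
        ext i
        rcases i with i | i <;> simp [vec]
      zero_mem' := by
        refine ⟨0, zero_mem S, ?_⟩
        ext i
        rcases i with i | i <;> simp [vec]
      smul_mem' := by
        rintro c _ ⟨a, ha, rfl⟩
        refine ⟨(c : ℂ) • a, S.smul_mem ha _, ?_⟩
        ext i
        rcases i with i | i <;> simp [vec] }
  have key : vec y ∈ W.topologicalClosure := by
    let _ : InnerProductSpace ℝ H := InnerProductSpace.complexToReal
    have hcl := @Submodule.orthogonal_orthogonal_eq_closure ℝ (PiLp 2 (fun _ : F ⊕ F => H)) _ _
      (PiLp.innerProductSpace fun _ : F ⊕ F => H) W _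
    rw [← hcl, Submodule.mem_orthogonal]
    intro θ hθ
    rw [Submodule.mem_orthogonal] at hθ
    have hform : ∀ a : H →L[ℂ] H, inner ℝ (vec a) θ = Complex.re (∑ i : F ⊕ F,
        inner ℂ (Sum.elim (fun i : F => θ (Sum.inl i)) (fun i : F => (i : H)) i)
          (a (Sum.elim (fun i : F => (i : H)) (fun i : F => θ (Sum.inr i)) i))) := by
      intro a
      rw [PiLp.inner_apply]
      simp only [Fintype.sum_sum_type, Complex.add_re, Complex.re_sum, Sum.elim_inl, Sum.elim_inr,
        vec, ContinuousLinearMap.star_eq_adjoint, real_inner_eq_re_inner ℂ]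
      congr 1
      · refine Finset.sum_congr rfl fun i _ => ?_
        rw [← inner_conj_symm]
        exact Complex.conj_re _
      · refine Finset.sum_congr rfl fun i _ => ?_
        rw [ContinuousLinearMap.adjoint_inner_left]
        rfl
    have h0 : ∀ a ∈ S, ∑ i : F ⊕ F,
        inner ℂ (Sum.elim (fun i : F => θ (Sum.inl i)) (fun i : F => (i : H)) i)
          (a (Sum.elim (fun i : F => (i : H)) (fun i : F => θ (Sum.inr i)) i)) = 0 := by
      intro a ha
      apply Complex.ext
      · rw [← hform]
        exact hθ _ ⟨a, ha, rfl⟩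
      -- Replacing `a` by `I • a` in the vanishing of real parts gives the vanishing of imaginary
      -- parts.
      · have h1 := hform (Complex.I • a)
        rw [hθ _ ⟨Complex.I • a, S.smul_mem ha _, rfl⟩] at h1
        simp only [smul_apply, inner_smul_right, ← Finset.mul_sum] at h1
        simp only [Complex.mul_re, Complex.I_re, Complex.I_im] at h1
        simp only [Complex.zero_im]
        linarith
    rw [real_inner_comm, hform, hy.sum_inner_eq_zero _ _ h0, Complex.zero_re]
  obtain ⟨_, ⟨a, ha, rfl⟩, hd⟩ := Metric.mem_closure_iff.1 key ε hε
  refine ⟨a, ha, fun ξ hξ => ?_⟩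
  rw [dist_comm, dist_eq_norm] at hd
  constructor
  · refine lt_of_le_of_lt (le_of_eq ?_)
      ((PiLp.norm_apply_le (vec a - vec y) (Sum.inl ⟨ξ, hξ⟩)).trans_lt hd)
    simp [vec]
  · refine lt_of_le_of_lt (le_of_eq ?_)
      ((PiLp.norm_apply_le (vec a - vec y) (Sum.inr ⟨ξ, hξ⟩)).trans_lt hd)
    simp [vec]

theorem norm_one_add_star_mul_self_apply_ge (a : H →L[ℂ] H) (ζ : H) :
    ‖ζ‖ ^ 2 + 2 * ‖a ζ‖ ^ 2 ≤ ‖(1 + star a * a) ζ‖ ^ 2 := by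
  have h1 : (1 + star a * a) ζ = ζ + star a (a ζ) := rfl
  have h2 : inner ℂ ζ (star a (a ζ)) = (‖a ζ‖ ^ 2 : ℝ) := by
    rw [ContinuousLinearMap.star_eq_adjoint, ContinuousLinearMap.adjoint_inner_right,
      inner_self_eq_norm_sq_to_K]
    norm_cast
  rw [h1, @norm_add_sq ℂ, h2]
  have h3 : RCLike.re ((‖a ζ‖ ^ 2 : ℝ) : ℂ) = ‖a ζ‖ ^ 2 := Complex.ofReal_re _
  rw [h3]
  nlinarith [sq_nonneg ‖star a (a ζ)‖]

theorem isUnit_one_add_star_mul_self (a : H →L[ℂ] H) : IsUnit (1 + star a * a) := by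
  refine ContinuousLinearMap.isUnit_of_forall_le_norm_inner_map _ (c := 1) one_pos fun ζ => ?_
  have h2 : inner ℂ ((1 + star a * a) ζ) ζ = ((‖ζ‖ ^ 2 + ‖a ζ‖ ^ 2 : ℝ) : ℂ) := by
    change inner ℂ (ζ + star a (a ζ)) ζ = _
    rw [inner_add_left, ContinuousLinearMap.star_eq_adjoint, ContinuousLinearMap.adjoint_inner_left,
      inner_self_eq_norm_sq_to_K, inner_self_eq_norm_sq_to_K]
    norm_cast
  rw [h2, Complex.norm_real, Real.norm_of_nonneg (by positivity)]
  simp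

end Kaplansky

/-! ### Kaplansky's density theorem via `2 a (1 + a⋆ a)⁻¹` -/

section KaplanskyDensity

variable {H : Type*} [NormedAddCommGroup H] [InnerProductSpace ℂ H] [CompleteSpace H]

/-- `(1 + a⋆ a)⁻¹` -/
def resolventSq (a : H →L[ℂ] H) : H →L[ℂ] H := Ring.inverse (1 + star a * a)

theorem mul_resolventSq (a : H →L[ℂ] H) : (1 + star a * a) * resolventSq a = 1 :=
  Ring.mul_inverse_cancel _ (isUnit_one_add_star_mul_self a)

theorem resolventSq_mul (a : H →L[ℂ] H) : resolventSq a * (1 + star a * a) = 1 :=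
  Ring.inverse_mul_cancel _ (isUnit_one_add_star_mul_self a)

theorem resolventSq_apply_bound (a : H →L[ℂ] H) (ξ : H) :
    ‖resolventSq a ξ‖ ^ 2 + 2 * ‖a (resolventSq a ξ)‖ ^ 2 ≤ ‖ξ‖ ^ 2 := by
  have h := norm_one_add_star_mul_self_apply_ge a (resolventSq a ξ)
  have h1 : (1 + star a * a) (resolventSq a ξ) = ξ := by
    rw [← mul_apply_eq_comp, mul_resolventSq]
    rfl
  rwa [h1] at h

theorem norm_resolventSq_apply_le (a : H →L[ℂ] H) (ξ : H) : ‖resolventSq a ξ‖ ≤ ‖ξ‖ := by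
  have h := resolventSq_apply_bound a ξ
  refine abs_le_of_sq_le_sq' ?_ (norm_nonneg ξ) |>.2
  nlinarith [sq_nonneg ‖a (resolventSq a ξ)‖]

/-- The factor 2 comes from `‖ζ‖² + ‖a⋆ a ζ‖² ≥ 2 ‖ζ‖ ‖a⋆ a ζ‖ ≥ 2 ‖a ζ‖²`. It makes `2 a (1 + a⋆
a)⁻¹` a contraction for every `a`. -/
theorem norm_one_add_star_mul_self_apply_ge' (a : H →L[ℂ] H) (ζ : H) :
    2 * ‖a ζ‖ ≤ ‖(1 + star a * a) ζ‖ := by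
  rcases (norm_nonneg (a ζ)).eq_or_lt with h0 | h0
  · rw [← h0]; simp
  have h2 : inner ℂ ζ (star a (a ζ)) = (‖a ζ‖ ^ 2 : ℝ) := by
    rw [ContinuousLinearMap.star_eq_adjoint, ContinuousLinearMap.adjoint_inner_right,
      inner_self_eq_norm_sq_to_K]
    norm_cast
  have h3 : ‖a ζ‖ ^ 2 ≤ ‖ζ‖ * ‖star a (a ζ)‖ := by
    have := norm_inner_le_norm (𝕜 := ℂ) ζ (star a (a ζ))
    rwa [h2, Complex.norm_real, Real.norm_of_nonneg (by positivity)] at this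
  refine abs_le_of_sq_le_sq' ?_ (norm_nonneg _) |>.2
  have h1 : (1 + star a * a) ζ = ζ + star a (a ζ) := rfl
  rw [h1, @norm_add_sq ℂ, h2]
  have h4 : RCLike.re ((‖a ζ‖ ^ 2 : ℝ) : ℂ) = ‖a ζ‖ ^ 2 := Complex.ofReal_re _
  rw [h4]
  nlinarith [sq_nonneg (‖ζ‖ - ‖star a (a ζ)‖)]

theorem norm_mul_resolventSq_apply_le (a : H →L[ℂ] H) (ξ : H) :
    2 * ‖a (resolventSq a ξ)‖ ≤ ‖ξ‖ := by
  have h := norm_one_add_star_mul_self_apply_ge' a (resolventSq a ξ)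
  rwa [← mul_apply_eq_comp, ← mul_apply_eq_comp, mul_resolventSq] at h

theorem mul_resolventSq_comm (a : H →L[ℂ] H) :
    a * resolventSq a = resolventSq (star a) * a := by
  have h1 : (1 + star (star a) * star a) * a = a * (1 + star a * a) := by
    rw [star_star]
    noncomm_ring
  calc a * resolventSq a
      = resolventSq (star a) * ((1 + star (star a) * star a) * a) * resolventSq a := by
        rw [← mul_assoc, resolventSq_mul, one_mul]
    _ = resolventSq (star a) * a := by
        rw [h1, mul_assoc, mul_assoc, mul_resolventSq, mul_one]

/-- On the right, `a - y` and `a⋆ - y⋆` act on vectors that do not depend on `a`, and the factors to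
their left are contractions. Hence `a ↦ a (1 + a⋆ a)⁻¹` is continuous from the strong-star to the
strong topology. -/
theorem mul_resolventSq_sub (a y : H →L[ℂ] H) :
    a * resolventSq a - y * resolventSq y =
      resolventSq (star a) * (a - y) * resolventSq y -
        a * resolventSq a * (star a - star y) * (y * resolventSq y) := by
  have h1 : a * resolventSq a =
      resolventSq (star a) * a * ((1 + star y * y) * resolventSq y) := by
    rw [mul_resolventSq, mul_one, mul_resolventSq_comm]
  have h2 : y * resolventSq y =
      resolventSq (star a) * (1 + a * star a) * (y * resolventSq y) := by
    have := resolventSq_mul (star a)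
    rw [star_star] at this
    rw [this, one_mul]
  conv_lhs => rw [h1, h2]
  rw [mul_resolventSq_comm a]
  noncomm_ring

theorem resolventSq_mem {S : StarSubalgebra ℂ (H →L[ℂ] H)} (hS : IsClosed (S : Set (H →L[ℂ] H)))
    {a : H →L[ℂ] H} (ha : a ∈ S) : resolventSq a ∈ S := by
  have hm : 1 + star a * a ∈ S := add_mem (one_mem S) (mul_mem (star_mem ha) ha)
  have : IsClosed (S : Set (H →L[ℂ] H)) := hS
  have hu : IsUnit (⟨1 + star a * a, hm⟩ : S) :=
    (StarSubalgebra.coe_isUnit (S := S)).1 (isUnit_one_add_star_mul_self a)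
  obtain ⟨b, hb⟩ := hu.exists_right_inv
  have hb' : (1 + star a * a) * (b : H →L[ℂ] H) = 1 := congrArg Subtype.val hb
  have : resolventSq a = b := by
    calc resolventSq a = resolventSq a * ((1 + star a * a) * b) := by rw [hb', mul_one]
      _ = b := by rw [← mul_assoc, resolventSq_mul, one_mul]
  rw [this]
  exact b.2

/-- A contraction in the double commutant is of the form `2 y (1 + y⋆ y)⁻¹`. -/
theorem InBicommutant.exists_eq_two_mul_resolventSq {S : StarSubalgebra ℂ (H →L[ℂ] H)}
    {x : H →L[ℂ] H} (hx : InBicommutant S x) (hx1 : ‖x‖ ≤ 1) :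
    ∃ y, InBicommutant S y ∧ x = (2 : ℂ) • (y * resolventSq y) := by
  have hpos : 0 ≤ 1 - star x * x := by
    rw [sub_nonneg]
    refine CStarAlgebra.star_mul_le_algebraMap_norm_sq.trans ?_
    rw [← map_one (algebraMap ℝ (H →L[ℂ] H))]
    exact algebraMap_mono _ (pow_le_one₀ (norm_nonneg x) hx1)
  -- The scalar equation `2 y / (1 + y²) = x` has the solution `y = x / (1 + √(1 - x²))`; below, `r`
  -- is the inverse of `1 + s` and `y = x r`.
  set s := CFC.sqrt (1 - star x * x) with hs
  have hss : s * s = 1 - star x * x := CFC.sqrt_mul_sqrt_self _ hpos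
  have hs0 : 0 ≤ s := CFC.sqrt_nonneg _
  have hsa : star s = s := (IsSelfAdjoint.of_nonneg hs0).star_eq
  have hu : IsUnit (1 + s) := by
    refine ContinuousLinearMap.isUnit_of_forall_le_norm_inner_map _ (c := 1) one_pos fun ζ => ?_
    have h1 := (ContinuousLinearMap.nonneg_iff_isPositive s).1 hs0
    have h2 : 0 ≤ RCLike.re (inner ℂ (s ζ) ζ) := h1.re_inner_nonneg_left ζ
    have h3 : RCLike.re (inner ℂ ((1 + s) ζ) ζ) = ‖ζ‖ ^ 2 + RCLike.re (inner ℂ (s ζ) ζ) := by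
      change RCLike.re (inner ℂ (ζ + s ζ) ζ) = _
      rw [inner_add_left, map_add, inner_self_eq_norm_sq]
    refine le_trans ?_ (RCLike.re_le_norm _)
    rw [h3]
    simpa using h2
  obtain ⟨u, hu⟩ := hu
  set r : H →L[ℂ] H := ↑u⁻¹ with hr
  have hr1 : r * (1 + s) = 1 := by rw [← hu]; exact u.inv_mul
  have hr2 : (1 + s) * r = 1 := by rw [← hu]; exact u.mul_inv
  have hrs : star r = r := by
    have h1 : star r * (1 + s) = 1 := by
      calc star r * (1 + s) = star ((1 + s) * r) := by rw [star_mul, star_add, star_one, hsa]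
        _ = 1 := by rw [hr2, star_one]
    calc star r = star r * ((1 + s) * r) := by rw [hr2, mul_one]
      _ = r := by rw [← mul_assoc, h1, one_mul]
  have hyy : star (x * r) * (x * r) = r * (1 - s) := by
    rw [star_mul, hrs]
    calc r * star x * (x * r) = r * (star x * x) * r := by noncomm_ring
      _ = r * (1 - s * s) * r := by rw [hss]; noncomm_ring
      _ = r * (1 - s) * ((1 + s) * r) := by noncomm_ring
      _ = r * (1 - s) := by rw [hr2, mul_one]
  have hsum : 1 + star (x * r) * (x * r) = (2 : ℂ) • r := by
    rw [hyy]
    calc 1 + r * (1 - s) = r * (1 + s) + r * (1 - s) := by rw [hr1]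
      _ = r + r := by noncomm_ring
      _ = (2 : ℂ) • r := (two_smul ℂ r).symm
  refine ⟨x * r, fun T hT => ?_, ?_⟩
  · have hxT := hx T hT
    have hxT' : Commute (star x) T := by
      have h1 : Commute x (star T) := hx _ fun a ha => by
        have := (hT _ (star_mem ha)).star_star
        rwa [star_star] at this
      have := h1.star_star
      rwa [star_star] at this
    have hsT : Commute s T :=
      ((Commute.one_left T).sub_left (hxT'.mul_left hxT)).cfcₙ_nnreal NNReal.sqrt
    have hrT : Commute r T := by
      have h1 : Commute (u : H →L[ℂ] H) T := by
        rw [hu]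
        exact (Commute.one_left T).add_left hsT
      exact h1.units_inv_left
    exact hxT.mul_left hrT
  · have h1 : resolventSq (x * r) = (2⁻¹ : ℂ) • (1 + s) := by
      have h2 : (1 + star (x * r) * (x * r)) * ((2⁻¹ : ℂ) • (1 + s)) = 1 := by
        rw [hsum, smul_mul_smul_comm, hr1]
        norm_num
      calc resolventSq (x * r) = resolventSq (x * r) * ((1 + star (x * r) * (x * r)) *
            ((2⁻¹ : ℂ) • (1 + s))) := by rw [h2, mul_one]
        _ = _ := by rw [← mul_assoc, resolventSq_mul, one_mul]
    rw [h1, mul_smul_comm, mul_assoc, hr1, smul_smul]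
    norm_num

/-- **Kaplansky's density theorem**. -/
theorem InBicommutant.exists_norm_le_one_approx {S : StarSubalgebra ℂ (H →L[ℂ] H)}
    {x : H →L[ℂ] H} (hx : InBicommutant S x) (hx1 : ‖x‖ ≤ 1) (F : Finset H) {ε : ℝ} (hε : 0 < ε) :
    ∃ a ∈ S.topologicalClosure, ‖a‖ ≤ 1 ∧ ∀ ξ ∈ F, ‖(a - x) ξ‖ < ε := by
  classical
  obtain ⟨y, hy, rfl⟩ := hx.exists_eq_two_mul_resolventSq hx1
  -- The finite set consists of the vectors on which the two differences in `mul_resolventSq_sub`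
  -- act.
  obtain ⟨a, ha, hF⟩ := hy.exists_strong_star_approx
    (F.image (resolventSq y) ∪ F.image (y * resolventSq y)) (ε := ε / 4) (by positivity)
  have haS : a ∈ S.topologicalClosure := S.le_topologicalClosure ha
  have hcl : IsClosed (S.topologicalClosure : Set (H →L[ℂ] H)) := S.isClosed_topologicalClosure
  refine ⟨(2 : ℂ) • (a * resolventSq a), ?_, ?_, fun ξ hξ => ?_⟩
  · exact S.topologicalClosure.smul_mem (mul_mem haS (resolventSq_mem hcl haS)) _
  · refine ContinuousLinearMap.opNorm_le_bound _ zero_le_one fun ξ => ?_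
    rw [one_mul]
    refine le_trans (le_of_eq ?_) (norm_mul_resolventSq_apply_le a ξ)
    change ‖(2 : ℂ) • a (resolventSq a ξ)‖ = _
    rw [norm_smul]
    norm_num
  · rw [← smul_sub, mul_resolventSq_sub]
    have h1 := (hF (resolventSq y ξ) (Finset.mem_union_left _ (Finset.mem_image_of_mem _ hξ))).1
    have h2 := (hF ((y * resolventSq y) ξ)
      (Finset.mem_union_right _ (Finset.mem_image_of_mem _ hξ))).2
    have h3 := norm_resolventSq_apply_le (star a) ((a - y) (resolventSq y ξ))
    have h4 := norm_mul_resolventSq_apply_le a ((star a - star y) ((y * resolventSq y) ξ))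
    change ‖(2 : ℂ) • (resolventSq (star a) ((a - y) (resolventSq y ξ)) -
      a (resolventSq a ((star a - star y) ((y * resolventSq y) ξ))))‖ < ε
    rw [norm_smul]
    have h5 := norm_sub_le (resolventSq (star a) ((a - y) (resolventSq y ξ)))
      (a (resolventSq a ((star a - star y) ((y * resolventSq y) ξ))))
    have h6 : ‖(2 : ℂ)‖ = 2 := by norm_num
    rw [h6]
    linarith

end KaplanskyDensity

/-! ### Scalar functions that are normal on the unit ball -/

section BallNormal

variable {H : Type*} [NormedAddCommGroup H] [InnerProductSpace ℂ H] [CompleteSpace H]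

/-- A scalar function on a von Neumann algebra that is continuous on the closed unit ball for the
weak operator topology. -/
def BallNormal (A : VonNeumannAlgebra H) (f : A.toStarSubalgebra → ℂ) : Prop :=
  ∀ T : A.toStarSubalgebra, ‖(T : H →L[ℂ] H)‖ ≤ 1 → Tendsto f (ballNhds A T) (𝓝 (f T))

variable {A : VonNeumannAlgebra H}

theorem eventually_ballNhds (T : A.toStarSubalgebra) :
    ∀ᶠ S : A.toStarSubalgebra in ballNhds A T, ‖(S : H →L[ℂ] H)‖ ≤ 1 :=
  @self_mem_nhdsWithin _ (wot A) T _

theorem tendsto_ballNhds_iff {α : Type*} {l : Filter α} {f : α → A.toStarSubalgebra}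
    {T : A.toStarSubalgebra} : Tendsto f l (ballNhds A T) ↔
      (∀ ξ η : H, Tendsto (fun a => inner ℂ η ((f a : H →L[ℂ] H) ξ)) l
        (𝓝 (inner ℂ η ((T : H →L[ℂ] H) ξ)))) ∧ ∀ᶠ a in l, ‖(f a : H →L[ℂ] H)‖ ≤ 1 := by
  rw [← tendsto_nhds_wot]
  exact tendsto_inf.trans (and_congr_right fun _ => tendsto_principal)

theorem ballNormal_inner (ξ η : H) :
    BallNormal A (fun T => inner ℂ η ((T : H →L[ℂ] H) ξ)) :=
  fun T _ => tendsto_ballNhds A T ξ η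

theorem BallNormal.sum {ι : Type*} (s : Finset ι) {f : ι → A.toStarSubalgebra → ℂ}
    (h : ∀ i ∈ s, BallNormal A (f i)) : BallNormal A (fun T => ∑ i ∈ s, f i T) :=
  fun T hT => tendsto_finsetSum s fun i hi => h i hi T hT

theorem BallNormal.const_mul {f : A.toStarSubalgebra → ℂ} (h : BallNormal A f) (c : ℂ) :
    BallNormal A (fun T => c * f T) := fun T hT => (h T hT).const_mul c

/-- Uniform limits on the unit ball preserve normality. -/
theorem BallNormal.of_approx {f : A.toStarSubalgebra → ℂ}
    (h : ∀ ε : ℝ, 0 < ε → ∃ g, BallNormal A g ∧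
      ∀ T : A.toStarSubalgebra, ‖(T : H →L[ℂ] H)‖ ≤ 1 → ‖f T - g T‖ ≤ ε) : BallNormal A f := by
  intro T hT
  rw [Metric.tendsto_nhds]
  intro ε hε
  obtain ⟨g, hg, hfg⟩ := h (ε / 4) (by positivity)
  filter_upwards [Metric.tendsto_nhds.1 (hg T hT) (ε / 4) (by positivity), eventually_ballNhds T]
    with S hS hS1
  have h1 := hfg T hT
  have h2 := hfg S hS1
  rw [← dist_eq_norm] at h1 h2
  have h3 := dist_triangle4 (f S) (g S) (g T) (f T)
  rw [dist_comm (g T)] at h3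
  linarith

theorem IsNormalMap.ballNormal {M : A.toStarSubalgebra →ₗ[ℂ] A.toStarSubalgebra}
    (hM : IsNormalMap A M) (ξ η : H) :
    BallNormal A (fun T => inner ℂ η ((M T : H →L[ℂ] H) ξ)) :=
  fun T hT => (isNormalMap_iff A M).1 hM T hT ξ η

theorem isNormalMap_of_ballNormal {M : A.toStarSubalgebra →ₗ[ℂ] A.toStarSubalgebra}
    (hM : ∀ ξ η : H, BallNormal A (fun T => inner ℂ η ((M T : H →L[ℂ] H) ξ))) :
    IsNormalMap A M :=
  (isNormalMap_iff A M).2 fun T hT ξ η => hM ξ η T hT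

theorem BallNormal.comp {H' : Type*} [NormedAddCommGroup H'] [InnerProductSpace ℂ H']
    [CompleteSpace H'] {B : VonNeumannAlgebra H'} {f : B.toStarSubalgebra → ℂ}
    (hf : BallNormal B f) {Φ : A.toStarSubalgebra → B.toStarSubalgebra}
    (hΦ : ∀ ξ η : H', BallNormal A (fun T => inner ℂ η ((Φ T : H' →L[ℂ] H') ξ)))
    (hΦ1 : ∀ T : A.toStarSubalgebra, ‖(T : H →L[ℂ] H)‖ ≤ 1 → ‖(Φ T : H' →L[ℂ] H')‖ ≤ 1) :
    BallNormal A (fun T => f (Φ T)) := by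
  intro T hT
  refine (hf (Φ T) (hΦ1 T hT)).comp (tendsto_ballNhds_iff.2 ⟨fun ξ η => hΦ ξ η T hT, ?_⟩)
  filter_upwards [eventually_ballNhds T] with S hS using hΦ1 S hS

end BallNormal

/-! ### The group von Neumann algebra and the density of the span of translations -/

section GroupVN

variable {G : Type*} [Group G] [TopologicalSpace G] [IsTopologicalGroup G]
  [LocallyCompactSpace G] [MeasurableSpace G] [BorelSpace G]

theorem continuous_leftReg (ξ : L2 G) : Continuous (fun g : G => leftReg g ξ) := by
  have hg : Continuous (fun g : G => (⟨fun h => g⁻¹ * h, by fun_prop⟩ : C(G, G))) := by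
    refine ContinuousMap.continuous_of_continuous_uncurry _ ?_
    change Continuous fun p : G × G => p.1⁻¹ * p.2
    fun_prop
  exact Continuous.compMeasurePreservingLp (f := fun _ : G => ξ) continuous_const hg
    (fun g => measurePreserving_mul_left (Measure.haar : Measure G) g⁻¹) (by simp)

theorem norm_leftReg_le (g : G) : ‖leftReg g‖ ≤ 1 :=
  ContinuousLinearMap.opNorm_le_bound _ zero_le_one fun ξ => by rw [norm_leftReg_apply, one_mul]

theorem norm_lam_le (g : G) : ‖(lam g : L2 G →L[ℂ] L2 G)‖ ≤ 1 := norm_leftReg_le g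

theorem inner_leftReg_left (g : G) (ξ η : L2 G) :
    inner ℂ (leftReg g η) ξ = inner ℂ η (leftReg g⁻¹ ξ) := by
  rw [← star_leftReg, ContinuousLinearMap.star_eq_adjoint, ContinuousLinearMap.adjoint_inner_right]

theorem leftReg_mul_apply (g h : G) (ξ : L2 G) : leftReg (g * h) ξ = leftReg g (leftReg h ξ) := by
  rw [← leftReg_mul]
  rfl

theorem leftReg_inv_apply_self (g : G) (ξ : L2 G) : leftReg g⁻¹ (leftReg g ξ) = ξ := by
  rw [← leftReg_mul_apply, inv_mul_cancel, leftReg_one]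
  rfl

variable (G) in
/-- The linear span of `λ(G)` as a star algebra. -/
def lamSpan : StarSubalgebra ℂ (L2 G →L[ℂ] L2 G) where
  carrier := Submodule.span ℂ (Set.range (leftReg : G → L2 G →L[ℂ] L2 G))
  mul_mem' := by
    intro a b ha hb
    refine Submodule.span_induction₂ (p := fun a b _ _ => a * b ∈ Submodule.span ℂ
      (Set.range (leftReg : G → L2 G →L[ℂ] L2 G))) ?_ ?_ ?_ ?_ ?_ ?_ ?_ ha hb
    · rintro _ _ ⟨g, rfl⟩ ⟨h, rfl⟩
      exact Submodule.subset_span ⟨g * h, (leftReg_mul g h).symm⟩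
    · intro b _
      rw [zero_mul]
      exact zero_mem _
    · intro b _
      rw [mul_zero]
      exact zero_mem _
    · intro x y z _ _ _ hx hy
      rw [add_mul]
      exact add_mem hx hy
    · intro x y z _ _ _ hx hy
      rw [mul_add]
      exact add_mem hx hy
    · intro r x y _ _ h
      rw [smul_mul_assoc]
      exact Submodule.smul_mem _ r h
    · intro r x y _ _ h
      rw [mul_smul_comm]
      exact Submodule.smul_mem _ r h
  add_mem' := fun ha hb => add_mem (S := Submodule ℂ (L2 G →L[ℂ] L2 G)) ha hb
  algebraMap_mem' := by
    intro c
    rw [Algebra.algebraMap_eq_smul_one, ← leftReg_one]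
    exact Submodule.smul_mem _ c (Submodule.subset_span ⟨1, rfl⟩)
  star_mem' := by
    intro a ha
    refine Submodule.span_induction (p := fun a _ => star a ∈ Submodule.span ℂ
      (Set.range (leftReg : G → L2 G →L[ℂ] L2 G))) ?_ ?_ ?_ ?_ ha
    · rintro _ ⟨g, rfl⟩
      rw [star_leftReg]
      exact Submodule.subset_span ⟨g⁻¹, rfl⟩
    · rw [star_zero]
      exact zero_mem _
    · intro x y _ _ hx hy
      rw [star_add]
      exact add_mem hx hy
    · intro c x _ hx
      rw [star_smul]
      exact Submodule.smul_mem _ _ hx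

theorem leftReg_mem_lamSpan (g : G) : leftReg g ∈ lamSpan G :=
  Submodule.subset_span ⟨g, rfl⟩

theorem lamSpan_le : lamSpan G ≤ (groupVN G).toStarSubalgebra := by
  intro a ha
  refine Submodule.span_induction (p := fun a _ => a ∈ (groupVN G).toStarSubalgebra)
    ?_ (zero_mem _) (fun x y _ _ hx hy => add_mem hx hy)
    (fun c x _ hx => (groupVN G).toStarSubalgebra.smul_mem hx c) ha
  rintro _ ⟨g, rfl⟩
  exact leftReg_mem g

/-- Membership in `L(G)` as the double commutant condition. -/
theorem mem_groupVN_iff {x : L2 G →L[ℂ] L2 G} : x ∈ (groupVN G).toStarSubalgebra ↔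
    ∀ T : L2 G →L[ℂ] L2 G, (∀ g, Commute (leftReg g) T) → Commute x T := by
  have h1 : ∀ T : L2 G →L[ℂ] L2 G,
      T ∈ StarSubalgebra.centralizer ℂ (Set.range (leftReg : G → L2 G →L[ℂ] L2 G)) ↔
        ∀ g, Commute (leftReg g) T := by
    intro T
    rw [StarSubalgebra.mem_centralizer_iff]
    constructor
    · intro h g
      exact (h _ ⟨g, rfl⟩).1
    · rintro h _ ⟨g, rfl⟩
      refine ⟨h g, ?_⟩
      rw [star_leftReg]
      exact h g⁻¹
  have h2 : x ∈ (groupVN G).toStarSubalgebra ↔ x ∈ StarSubalgebra.centralizer ℂ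
    (StarSubalgebra.centralizer ℂ (Set.range (leftReg : G → L2 G →L[ℂ] L2 G)) :
      Set (L2 G →L[ℂ] L2 G)) := Iff.rfl
  rw [h2, StarSubalgebra.mem_centralizer_iff]
  constructor
  · intro h T hT
    exact ((h T ((h1 T).2 hT)).1 : T * x = x * T).symm
  · intro h T hT
    exact ⟨(h T ((h1 T).1 hT)).eq.symm, (h _ ((h1 _).1 (star_mem hT))).eq.symm⟩

theorem inBicommutant_lamSpan {x : L2 G →L[ℂ] L2 G} (hx : x ∈ (groupVN G).toStarSubalgebra) :
    InBicommutant (lamSpan G) x :=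
  fun T hT => mem_groupVN_iff.1 hx T fun g => hT _ (leftReg_mem_lamSpan g)

theorem isClosed_groupVN : IsClosed ((groupVN G).toStarSubalgebra : Set (L2 G →L[ℂ] L2 G)) := by
  have h : ((groupVN G).toStarSubalgebra : Set (L2 G →L[ℂ] L2 G)) =
      Set.centralizer {T | ∀ g, Commute (leftReg g) T} := by
    ext x
    rw [SetLike.mem_coe, mem_groupVN_iff, Set.mem_centralizer_iff]
    exact forall₂_congr fun T _ => eq_comm
  rw [h]
  exact Set.isClosed_centralizer _

/-- A bounded normal functional on `L(G)` is determined by its values on `λ(G)`. -/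
theorem eq_zero_of_ballNormal {f : (groupVN G).toStarSubalgebra →ₗ[ℂ] ℂ}
    (hf : BallNormal (groupVN G) f) {C : ℝ}
    (hC : ∀ T : (groupVN G).toStarSubalgebra, ‖f T‖ ≤ C * ‖(T : L2 G →L[ℂ] L2 G)‖)
    (h0 : ∀ g, f (lam g) = 0) : f = 0 := by
  classical
  have hC' : ∀ T : (groupVN G).toStarSubalgebra, ‖f T‖ ≤ max C 1 * ‖(T : L2 G →L[ℂ] L2 G)‖ :=
    fun T => (hC T).trans (mul_le_mul_of_nonneg_right (le_max_left _ _) (norm_nonneg _))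
  have hC0 : 0 < max C 1 := lt_max_of_lt_right one_pos
  have hspan : ∀ a (ha : a ∈ lamSpan G), f ⟨a, lamSpan_le ha⟩ = 0 := by
    intro a ha
    refine Submodule.span_induction (p := fun a ha => f ⟨a, lamSpan_le ha⟩ = 0)
      ?_ (map_zero f) ?_ ?_ ha
    · rintro _ ⟨g, rfl⟩
      exact h0 g
    · intro x y hx hy h1 h2
      have h3 := map_add f ⟨x, lamSpan_le hx⟩ ⟨y, lamSpan_le hy⟩
      rw [h1, h2, add_zero] at h3
      exact h3
    · intro c x hx h1
      have h3 := map_smul f c ⟨x, lamSpan_le hx⟩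
      rw [h1, smul_zero] at h3
      exact h3
  have hle : (lamSpan G).topologicalClosure ≤ (groupVN G).toStarSubalgebra :=
    StarSubalgebra.topologicalClosure_minimal lamSpan_le isClosed_groupVN
  have hcl : ∀ a (ha : a ∈ (lamSpan G).topologicalClosure), f ⟨a, hle ha⟩ = 0 := by
    intro a ha
    by_contra hne
    have hpos : 0 < ‖f ⟨a, hle ha⟩‖ := norm_pos_iff.2 hne
    obtain ⟨b, hb, hab⟩ := Metric.mem_closure_iff.1 ha (‖f ⟨a, hle ha⟩‖ / max C 1) (by positivity)
    have h1 : f ⟨a, hle ha⟩ = f (⟨a, hle ha⟩ - ⟨b, lamSpan_le hb⟩) := by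
      rw [map_sub, hspan b hb, sub_zero]
    have h2 := hC' (⟨a, hle ha⟩ - ⟨b, lamSpan_le hb⟩)
    rw [← h1] at h2
    rw [dist_eq_norm, lt_div_iff₀ hC0] at hab
    change _ ≤ max C 1 * ‖a - b‖ at h2
    linarith
  -- As `f` is continuous on the unit ball only, the approximants must stay in the ball, which is
  -- what Kaplansky's theorem provides. The net is indexed by a finite set of vectors and a
  -- precision.
  have hball : ∀ T : (groupVN G).toStarSubalgebra, ‖(T : L2 G →L[ℂ] L2 G)‖ ≤ 1 → f T = 0 := by
    intro T hT
    have hK : ∀ p : Finset (L2 G) × ℕ, ∃ a ∈ (lamSpan G).topologicalClosure, ‖a‖ ≤ 1 ∧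
        ∀ ξ ∈ p.1, ‖(a - (T : L2 G →L[ℂ] L2 G)) ξ‖ < 1 / ((p.2 : ℝ) + 1) := fun p =>
      (inBicommutant_lamSpan T.2).exists_norm_le_one_approx hT p.1 (by positivity)
    choose a ha ha1 haT using hK
    have ht : Tendsto (fun p => (⟨a p, hle (ha p)⟩ : (groupVN G).toStarSubalgebra)) atTop
        (ballNhds (groupVN G) T) := by
      refine tendsto_ballNhds_iff.2 ⟨fun ξ η => ?_, Eventually.of_forall ha1⟩
      have hz : Tendsto (fun p => a p ξ) atTop (𝓝 ((T : L2 G →L[ℂ] L2 G) ξ)) := by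
        rw [tendsto_iff_norm_sub_tendsto_zero]
        have hn : Tendsto (fun p : Finset (L2 G) × ℕ => 1 / ((p.2 : ℝ) + 1)) atTop (𝓝 0) :=
          tendsto_one_div_add_atTop_nhds_zero_nat.comp
            (by rw [← prod_atTop_atTop_eq]; exact tendsto_snd)
        refine squeeze_zero' (Eventually.of_forall fun _ => norm_nonneg _) ?_ hn
        filter_upwards [eventually_ge_atTop (({ξ} : Finset (L2 G)), 0)] with p hp
        exact (haT p ξ (hp.1 (Finset.mem_singleton_self ξ))).le
      exact tendsto_const_nhds.inner hz
    refine tendsto_nhds_unique ((hf T hT).comp ht) ?_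
    refine tendsto_const_nhds.congr fun p => ?_
    exact (hcl _ (ha p)).symm
  ext T
  rcases eq_or_ne T 0 with rfl | hT
  · simp
  have hT' : ‖(T : L2 G →L[ℂ] L2 G)‖ ≠ 0 := by
    rw [norm_ne_zero_iff]
    exact fun h => hT (Subtype.ext h)
  have h1 := hball (((‖(T : L2 G →L[ℂ] L2 G)‖⁻¹ : ℝ) : ℂ) • T) (by
    change ‖((‖(T : L2 G →L[ℂ] L2 G)‖⁻¹ : ℝ) : ℂ) • (T : L2 G →L[ℂ] L2 G)‖ ≤ 1
    rw [norm_smul, Complex.norm_real, norm_inv, norm_norm, inv_mul_cancel₀ hT'])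
  rw [map_smul, smul_eq_mul, mul_eq_zero] at h1
  rcases h1 with h1 | h1
  · exfalso
    rw [Complex.ofReal_eq_zero, inv_eq_zero] at h1
    exact hT' h1
  · exact h1

end GroupVN

/-! ### Hilbert's inequality from the Fourier series of `t - 1/2` -/

section HilbertMatrix

variable {H : Type*} [NormedAddCommGroup H] [InnerProductSpace ℂ H] [CompleteSpace H]

/-- The character `t ↦ exp (2 π i n t)`. -/
def circleChar (n : ℤ) (t : ℝ) : ℂ := Complex.exp (2 * Real.pi * Complex.I * n * t)

theorem continuous_circleChar (n : ℤ) : Continuous (circleChar n) := by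
  unfold circleChar
  fun_prop

theorem conj_circleChar_mul (m n : ℤ) (t : ℝ) :
    (starRingEnd ℂ) (circleChar m t) * circleChar n t = circleChar (n - m) t := by
  unfold circleChar
  rw [← Complex.exp_conj, ← Complex.exp_add]
  congr 1
  simp only [map_mul, Complex.conj_ofReal, Complex.conj_I, map_ofNat, map_intCast]
  push_cast
  ring

theorem integral_circleChar (n : ℤ) : ∫ t in (0 : ℝ)..1, circleChar n t = if n = 0 then 1 else 0 := by
  split_ifs with h
  · subst h
    simp [circleChar]
  · have h1 := bernoulli_zero_fourier_coeff (neg_ne_zero.2 h)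
    rw [bernoulliFourierCoeff, fourierCoeffOn_eq_integral] at h1
    simpa [fourier_coe_apply, circleChar, bernoulliFun] using h1

/-- For `n = 0` both sides vanish, the right one because `1 / 0 = 0`; accordingly the Hilbert matrix
below has zero diagonal. -/
theorem integral_sub_half_mul_circleChar (n : ℤ) :
    ∫ t in (0 : ℝ)..1, ((t - 1 / 2 : ℝ) : ℂ) * circleChar n t = 1 / (2 * Real.pi * Complex.I * n) := by
  have h1 := bernoulliFourierCoeff_eq one_ne_zero (-n)
  rw [bernoulliFourierCoeff, fourierCoeffOn_eq_integral, neg_neg] at h1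
  simp only [sub_zero, div_one, one_smul, bernoulliFun_one, Nat.factorial_one, Nat.cast_one, pow_one,
    fourier_coe_apply, Complex.ofReal_one, smul_eq_mul] at h1
  simp only [circleChar]
  rw [← neg_neg (1 : ℂ), neg_div, ← div_neg]
  refine Eq.trans (intervalIntegral.integral_congr fun t _ => ?_) (h1.trans ?_)
  · exact mul_comm _ _
  · push_cast
    ring_nf

/-- **Hilbert's inequality** for vectors in a Hilbert space. -/
theorem norm_hilbertMatrix_form_le {N : ℕ} (η ξ : Fin N → H) :
    ‖∑ i : Fin N, ∑ j : Fin N, (1 / (((i : ℕ) : ℂ) - ((j : ℕ) : ℂ))) * inner ℂ (η i) (ξ j)‖ ≤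
      Real.pi * tupleNorm η * tupleNorm ξ := by
  -- With these trigonometric polynomials the form becomes `2πi` times the integral of `(t - 1/2) ⟪X
  -- η t, X ξ t⟫`; the constant `π` is `2π` times the bound `1/2` of `|t - 1/2|`.
  let X : (Fin N → H) → ℝ → H := fun ζ t => ∑ i : Fin N, circleChar (-((i : ℕ) : ℤ)) t • ζ i
  have hX : ∀ ζ, Continuous (X ζ) := fun ζ =>
    continuous_finsetSum _ fun i _ => (continuous_circleChar _).smul continuous_const
  have hinner : ∀ (ζ θ : Fin N → H) (t : ℝ), inner ℂ (X ζ t) (X θ t) =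
      ∑ i : Fin N, ∑ j : Fin N, circleChar (((i : ℕ) : ℤ) - ((j : ℕ) : ℤ)) t * inner ℂ (ζ i) (θ j) := by
    intro ζ θ t
    simp only [X, sum_inner, inner_sum, inner_smul_left, inner_smul_right]
    simp only [Finset.mul_sum]
    rw [Finset.sum_comm]
    refine Finset.sum_congr rfl fun i _ => Finset.sum_congr rfl fun j _ => ?_
    rw [← mul_assoc, mul_comm (circleChar _ _), conj_circleChar_mul]
    congr 2
    ring
  have hswap : ∀ (ζ θ : Fin N → H) (g : ℝ → ℂ), Continuous g →
      ∫ t in (0 : ℝ)..1, g t * inner ℂ (X ζ t) (X θ t) = ∑ i : Fin N, ∑ j : Fin N,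
        (∫ t in (0 : ℝ)..1, g t * circleChar (((i : ℕ) : ℤ) - ((j : ℕ) : ℤ)) t) * inner ℂ (ζ i) (θ j) := by
    intro ζ θ g hg
    have hc : ∀ i j : Fin N, Continuous fun t =>
        g t * circleChar (((i : ℕ) : ℤ) - ((j : ℕ) : ℤ)) t * inner ℂ (ζ i) (θ j) := fun i j =>
      (hg.mul (continuous_circleChar _)).mul continuous_const
    simp only [hinner, Finset.mul_sum, ← mul_assoc]
    rw [intervalIntegral.integral_finsetSum fun i _ =>
      (continuous_finsetSum _ fun j _ => hc i j).intervalIntegrable _ _]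
    refine Finset.sum_congr rfl fun i _ => ?_
    rw [intervalIntegral.integral_finsetSum fun j _ => (hc i j).intervalIntegrable _ _]
    refine Finset.sum_congr rfl fun j _ => ?_
    exact intervalIntegral.integral_mul_const _ _
  have hsq : ∀ ζ : Fin N → H, ∫ t in (0 : ℝ)..1, ‖X ζ t‖ ^ 2 = tupleNorm ζ ^ 2 := by
    intro ζ
    have h1 := hswap ζ ζ (fun _ => 1) continuous_const
    simp only [one_mul, integral_circleChar, sub_eq_zero, Nat.cast_inj, ← Fin.ext_iff,
      ite_mul, zero_mul, Finset.sum_ite_eq, Finset.mem_univ, if_true,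
      inner_self_eq_norm_sq_to_K] at h1
    rw [tupleNorm_sq]
    apply Complex.ofReal_injective
    rw [← intervalIntegral.integral_ofReal]
    push_cast
    exact h1
  have hform : ∑ i : Fin N, ∑ j : Fin N, (1 / (((i : ℕ) : ℂ) - ((j : ℕ) : ℂ))) * inner ℂ (η i) (ξ j) =
      2 * Real.pi * Complex.I *
        ∫ t in (0 : ℝ)..1, ((t - 1 / 2 : ℝ) : ℂ) * inner ℂ (X η t) (X ξ t) := by
    rw [hswap η ξ (fun t => ((t - 1 / 2 : ℝ) : ℂ)) (by fun_prop), Finset.mul_sum]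
    refine Finset.sum_congr rfl fun i _ => ?_
    rw [Finset.mul_sum]
    refine Finset.sum_congr rfl fun j _ => ?_
    rw [integral_sub_half_mul_circleChar, ← mul_assoc]
    congr 1
    push_cast
    have h2 : (2 * Real.pi * Complex.I : ℂ) ≠ 0 := Complex.two_pi_I_ne_zero
    rw [mul_one_div, div_mul_eq_div_div, div_self h2]
  set a := tupleNorm η with ha
  set b := tupleNorm ξ with hb
  have ha0 : 0 ≤ a := tupleNorm_nonneg η
  have hb0 : 0 ≤ b := tupleNorm_nonneg ξ
  have hzero : ∀ ζ : Fin N → H, tupleNorm ζ = 0 → ζ = 0 := by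
    intro ζ h
    have h1 := tupleNorm_sq ζ
    rw [h, zero_pow two_ne_zero, eq_comm,
      Finset.sum_eq_zero_iff_of_nonneg fun _ _ => by positivity] at h1
    ext i
    simpa using h1 i (Finset.mem_univ i)
  rcases ha0.eq_or_lt with h0 | hapos
  · have := hzero η h0.symm
    simp only [this, Pi.zero_apply, inner_zero_left, mul_zero, Finset.sum_const_zero, norm_zero]
    positivity
  rcases hb0.eq_or_lt with h0 | hbpos
  · have := hzero ξ h0.symm
    simp only [this, Pi.zero_apply, inner_zero_right, mul_zero, Finset.sum_const_zero, norm_zero]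
    positivity
  -- The weights `b / a` and `a / b` are chosen so that both terms integrate to `a b`; this takes
  -- the place of the Cauchy–Schwarz inequality for the integral.
  have hpt : ∀ t ∈ Set.uIoc (0 : ℝ) 1, ‖((t - 1 / 2 : ℝ) : ℂ) * inner ℂ (X η t) (X ξ t)‖ ≤
      1 / 4 * (b / a * ‖X η t‖ ^ 2 + a / b * ‖X ξ t‖ ^ 2) := by
    intro t ht
    rw [Set.uIoc_of_le zero_le_one] at ht
    rw [norm_mul, Complex.norm_real]
    have h1 : ‖t - 1 / 2‖ ≤ 1 / 2 := by
      rw [Real.norm_eq_abs, abs_le]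
      constructor <;> linarith [ht.1, ht.2]
    have h2 := norm_inner_le_norm (𝕜 := ℂ) (X η t) (X ξ t)
    have h3 : 2 * (‖X η t‖ * ‖X ξ t‖) ≤ b / a * ‖X η t‖ ^ 2 + a / b * ‖X ξ t‖ ^ 2 := by
      have h4 : b / a * ‖X η t‖ ^ 2 + a / b * ‖X ξ t‖ ^ 2 - 2 * (‖X η t‖ * ‖X ξ t‖) =
          (b * ‖X η t‖ - a * ‖X ξ t‖) ^ 2 / (a * b) := by
        field_simp
        ring
      have h5 : 0 ≤ (b * ‖X η t‖ - a * ‖X ξ t‖) ^ 2 / (a * b) := by positivity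
      linarith
    calc ‖t - 1 / 2‖ * ‖inner ℂ (X η t) (X ξ t)‖ ≤ 1 / 2 * (‖X η t‖ * ‖X ξ t‖) := by gcongr
      _ ≤ _ := by linarith
  have hint := intervalIntegral.norm_integral_le_of_norm_le (zero_le_one' ℝ)
    (Eventually.of_forall fun t ht => hpt t (by rwa [Set.uIoc_of_le zero_le_one]))
    (Continuous.intervalIntegrable (μ := volume) (by have := hX η; have := hX ξ; fun_prop) 0 1)
  rw [intervalIntegral.integral_const_mul, intervalIntegral.integral_add
    (Continuous.intervalIntegrable (by have := hX η; fun_prop) _ _)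
    (Continuous.intervalIntegrable (by have := hX ξ; fun_prop) _ _),
    intervalIntegral.integral_const_mul, intervalIntegral.integral_const_mul, hsq, hsq, ← ha,
    ← hb] at hint
  rw [hform, norm_mul]
  have h6 : ‖(2 * Real.pi * Complex.I : ℂ)‖ = 2 * Real.pi := by
    simp [Real.pi_pos.le]
  rw [h6]
  have h7 : 1 / 4 * (b / a * a ^ 2 + a / b * b ^ 2) = 1 / 2 * (a * b) := by
    field_simp
    ring
  rw [h7] at hint
  calc 2 * Real.pi * _ ≤ 2 * Real.pi * (1 / 2 * (a * b)) := by
        gcongr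
    _ = Real.pi * a * b := by ring

end HilbertMatrix

/-! ### Completely bounded multipliers: boundedness, continuity, Schur estimate -/

section Multipliers

variable {G : Type*} [Group G] [TopologicalSpace G] [IsTopologicalGroup G]
  [LocallyCompactSpace G] [MeasurableSpace G] [BorelSpace G]

theorem exists_norm_eq_one_L2 : ∃ e : L2 G, ‖e‖ = 1 := by
  obtain ⟨U, hU, hU1⟩ := exists_compact_mem_nhds (1 : G)
  have hfin : (Measure.haar : Measure G) (interior U) ≠ ⊤ :=
    ((measure_mono interior_subset).trans_lt hU.measure_lt_top).ne
  have hpos : (Measure.haar : Measure G) (interior U) ≠ 0 :=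
    (isOpen_interior.measure_pos _ ⟨1, mem_interior_iff_mem_nhds.2 hU1⟩).ne'
  let f : L2 G := indicatorConstLp 2 isOpen_interior.measurableSet hfin 1
  have hf : ‖f‖ ≠ 0 := by
    rw [norm_indicatorConstLp (by simp) (by simp)]
    simp [measureReal_def, ENNReal.toReal_eq_zero_iff, hfin, hpos]
  refine ⟨((‖f‖⁻¹ : ℝ) : ℂ) • f, ?_⟩
  rw [norm_smul, Complex.norm_real, norm_inv, norm_norm, inv_mul_cancel₀ hf]

theorem IsCBMultiplierWith.norm_apply_le {φ : G → ℂ} {C : ℝ} (h : IsCBMultiplierWith φ C)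
    (hC : 0 ≤ C) (g : G) : ‖φ g‖ ≤ C := by
  obtain ⟨M, -, hM, hcb⟩ := h
  obtain ⟨e, he⟩ := exists_norm_eq_one_L2 (G := G)
  have h1 : ‖(M (lam g) : L2 G →L[ℂ] L2 G) e‖ = ‖φ g‖ := by
    rw [hM]
    change ‖φ g • leftReg g e‖ = _
    rw [norm_smul, norm_leftReg_apply, he, mul_one]
  rw [← h1]
  refine (ContinuousLinearMap.le_opNorm _ _).trans ?_
  rw [he, mul_one]
  refine (hcb.norm_le hC _).trans ?_
  exact mul_le_of_le_one_right hC (norm_lam_le g)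

theorem IsCBMultiplierWith.mono {φ : G → ℂ} {C D : ℝ} (h : IsCBMultiplierWith φ C) (hCD : C ≤ D) :
    IsCBMultiplierWith φ D := by
  obtain ⟨M, h1, h2, h3⟩ := h
  exact ⟨M, h1, h2, h3.mono hCD⟩

theorem exists_nonneg_bound_of_mem_M0A {φ : G → ℂ} (h : φ ∈ M0A G) :
    ∃ C, 0 ≤ C ∧ IsCBMultiplierWith φ C := by
  obtain ⟨C, hC⟩ := h
  exact ⟨max C 0, le_max_right _ _, hC.mono (le_max_left _ _)⟩

theorem m0aNorm_nonneg (φ : M0A G) : 0 ≤ m0aNorm φ := Real.sInf_nonneg fun _ h => h.1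

theorem norm_apply_le_m0aNorm (φ : M0A G) (g : G) : ‖(φ : G → ℂ) g‖ ≤ m0aNorm φ :=
  le_csInf (exists_nonneg_bound_of_mem_M0A φ.2) fun _ h => h.2.norm_apply_le h.1 g

/-- For a unit vector `e`, `φ(g) = ⟪λ(g) e, M(λ(g)) e⟫`. Since `λ` is weakly continuous with values
in the unit ball, where `M` is weakly continuous, the expression with `λ(g₀) e` on the left
converges; the change of the left vector is controlled by the norm continuity of orbits. -/
theorem continuous_of_mem_M0A {φ : G → ℂ} (h : φ ∈ M0A G) : Continuous φ := by
  obtain ⟨C, hC, M, hn, hM, hcb⟩ := exists_nonneg_bound_of_mem_M0A h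
  obtain ⟨e, he⟩ := exists_norm_eq_one_L2 (G := G)
  have hφ : ∀ g, φ g = inner ℂ (leftReg g e) ((M (lam g) : L2 G →L[ℂ] L2 G) e) := by
    intro g
    rw [hM]
    change φ g = inner ℂ (leftReg g e) (φ g • leftReg g e)
    rw [inner_smul_right, inner_self_eq_norm_sq_to_K, norm_leftReg_apply, he]
    simp
  refine continuous_iff_continuousAt.2 fun g₀ => ?_
  have h1 : Tendsto (fun g => lam g) (𝓝 g₀) (ballNhds (groupVN G) (lam g₀)) := by
    refine tendsto_ballNhds_iff.2 ⟨fun ξ η => ?_, Eventually.of_forall norm_lam_le⟩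
    exact tendsto_const_nhds.inner ((continuous_leftReg ξ).tendsto g₀)
  have h2 := (hn.ballNormal e (leftReg g₀ e) (lam g₀) (norm_lam_le g₀)).comp h1
  have h3 : Tendsto (fun g => inner ℂ (leftReg g e - leftReg g₀ e)
      ((M (lam g) : L2 G →L[ℂ] L2 G) e)) (𝓝 g₀) (𝓝 0) := by
    have h4 : Tendsto (fun g => ‖leftReg g e - leftReg g₀ e‖ * C) (𝓝 g₀) (𝓝 0) := by
      have := (tendsto_iff_norm_sub_tendsto_zero.1 ((continuous_leftReg e).tendsto g₀)).mul_const C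
      rwa [zero_mul] at this
    refine squeeze_zero_norm (fun g => (norm_inner_le_norm _ _).trans ?_) h4
    refine mul_le_mul_of_nonneg_left ?_ (norm_nonneg _)
    refine (ContinuousLinearMap.le_opNorm _ _).trans ?_
    rw [he, mul_one]
    exact (hcb.norm_le hC _).trans (mul_le_of_le_one_right hC (norm_lam_le g))
  have h5 := h3.add h2
  rw [zero_add] at h5
  rw [ContinuousAt, hφ g₀]
  refine h5.congr fun g => ?_
  rw [hφ g, inner_sub_left]
  exact sub_add_cancel _ _

theorem tupleNorm_leftReg {α : Type*} [Fintype α] (r : α → G) (ζ : α → L2 G) :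
    tupleNorm (fun a => leftReg (r a) (ζ a)) = tupleNorm ζ := by
  simp only [tupleNorm, norm_leftReg_apply]

/-- The kernel `(s, t) ↦ φ (s t)` of a completely bounded multiplier is a Schur multiplier. -/
theorem IsCBMultiplierWith.norm_schur_le {φ : G → ℂ} {C : ℝ} (h : IsCBMultiplierWith φ C)
    (hC : 0 ≤ C) {ι κ : Type*} [Fintype ι] [Fintype κ] (s : ι → G) (t : κ → G)
    (c : ι → κ → ℂ) {K : ℝ} (hK : 0 ≤ K)
    (hc : ∀ (η : ι → L2 G) (ξ : κ → L2 G), ‖∑ i, ∑ j, c i j * inner ℂ (η i) (ξ j)‖ ≤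
      K * tupleNorm η * tupleNorm ξ) (η : ι → L2 G) (ξ : κ → L2 G) :
    ‖∑ i, ∑ j, c i j * φ (s i * t j) * inner ℂ (η i) (ξ j)‖ ≤
      C * K * tupleNorm η * tupleNorm ξ := by
  obtain ⟨M, -, hM, hcb⟩ := h
  have hin : ∀ (g h : G) (η ξ : L2 G), inner ℂ η (leftReg (g * h) ξ) =
      inner ℂ (leftReg g⁻¹ η) (leftReg h ξ) := by
    intro g h η ξ
    rw [inner_leftReg_left, inv_inv, leftReg_mul_apply]
  have hle : ∀ (η : ι ⊕ κ → L2 G), tupleNorm (fun i => η (Sum.inl i)) ≤ tupleNorm η ∧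
      tupleNorm (fun j => η (Sum.inr j)) ≤ tupleNorm η := by
    intro η
    unfold tupleNorm
    rw [Fintype.sum_sum_type]
    constructor <;> refine Real.sqrt_le_sqrt ?_
    · exact le_add_of_nonneg_right (by positivity)
    · exact le_add_of_nonneg_left (by positivity)
  -- A rectangular array is placed in the upper right block of a square matrix. The unitaries `λ(s
  -- i)` and `λ(t j)` are absorbed into the vectors, so the norm of this matrix is governed by the
  -- scalars `c` alone.
  let X : ι ⊕ κ → ι ⊕ κ → (groupVN G).toStarSubalgebra := fun a b =>
    Sum.elim (fun i => Sum.elim (fun _ => 0) (fun j => c i j • lam (s i * t j)) b) (fun _ => 0) a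
  have hXform : ∀ η ξ : ι ⊕ κ → L2 G,
      matrixForm (fun a b => (X a b : L2 G →L[ℂ] L2 G)) η ξ = ∑ i, ∑ j, c i j *
        inner ℂ (leftReg (s i)⁻¹ (η (Sum.inl i))) (leftReg (t j) (ξ (Sum.inr j))) := by
    intro η ξ
    simp only [matrixForm, Fintype.sum_sum_type, X, Sum.elim_inl, Sum.elim_inr,
      ZeroMemClass.coe_zero, zero_apply, inner_zero_right,
      Finset.sum_const_zero, zero_add, add_zero]
    refine Finset.sum_congr rfl fun i _ => Finset.sum_congr rfl fun j _ => ?_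
    rw [← hin, ← inner_smul_right]
    rfl
  have hMform : ∀ η ξ : ι ⊕ κ → L2 G,
      matrixForm (fun a b => (M (X a b) : L2 G →L[ℂ] L2 G)) η ξ =
        ∑ i, ∑ j, c i j * φ (s i * t j) *
          inner ℂ (leftReg (s i)⁻¹ (η (Sum.inl i))) (leftReg (t j) (ξ (Sum.inr j))) := by
    intro η ξ
    simp only [matrixForm, Fintype.sum_sum_type, X, Sum.elim_inl, Sum.elim_inr, map_zero,
      ZeroMemClass.coe_zero, zero_apply, inner_zero_right,
      Finset.sum_const_zero, zero_add, add_zero, map_smul, hM]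
    refine Finset.sum_congr rfl fun i _ => Finset.sum_congr rfl fun j _ => ?_
    rw [← hin, ← inner_smul_right, ← smul_smul]
    rfl
  have hb := hcb.matrixForm_le hC X hK ?_
    (Sum.elim (fun i => leftReg (s i) (η i)) (fun _ => 0))
    (Sum.elim (fun _ => 0) (fun j => leftReg (t j)⁻¹ (ξ j)))
  · rw [hMform] at hb
    have e1 : tupleNorm (Sum.elim (fun i => leftReg (s i) (η i)) (fun _ : κ => (0 : L2 G))) =
        tupleNorm η := by
      simp [tupleNorm, norm_leftReg_apply]
    have e2 : tupleNorm (Sum.elim (fun _ : ι => (0 : L2 G)) (fun j => leftReg (t j)⁻¹ (ξ j))) =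
        tupleNorm ξ := by
      simp [tupleNorm, norm_leftReg_apply]
    rw [e1, e2] at hb
    refine le_trans (le_of_eq ?_) hb
    congr 1
    refine Finset.sum_congr rfl fun i _ => Finset.sum_congr rfl fun j _ => ?_
    simp only [Sum.elim_inl, Sum.elim_inr]
    rw [leftReg_inv_apply_self, ← leftReg_mul_apply, mul_inv_cancel, leftReg_one]
    rfl
  · intro η ξ
    rw [hXform]
    refine (hc _ _).trans ?_
    rw [tupleNorm_leftReg (fun i => (s i)⁻¹) fun i => η (Sum.inl i),
      tupleNorm_leftReg t fun j => ξ (Sum.inr j)]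
    exact mul_le_mul (mul_le_mul_of_nonneg_left (hle η).1 hK) (hle ξ).2 (tupleNorm_nonneg _)
      (mul_nonneg hK (tupleNorm_nonneg _))

end Multipliers

/-! ### Finitely supported averages and convex hulls -/

section WeightedAverages

variable {X : Type*}

/-- A finitely supported probability measure on `X`. -/
def IsProbWeight (w : X →₀ ℝ) : Prop := (∀ x, 0 ≤ w x) ∧ ∑ x ∈ w.support, w x = 1

/-- The average of `f` with respect to a finitely supported measure. -/
def wavg (w : X →₀ ℝ) (f : X → ℂ) : ℂ := ∑ x ∈ w.support, (w x : ℂ) * f x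

theorem wavg_eq_sum {w : X →₀ ℝ} {s : Finset X} (h : w.support ⊆ s) (f : X → ℂ) :
    wavg w f = ∑ x ∈ s, (w x : ℂ) * f x :=
  Finset.sum_subset h fun x _ hx => by simp [Finsupp.notMem_support_iff.1 hx]

theorem IsProbWeight.sum_eq_one {w : X →₀ ℝ} (hw : IsProbWeight w) {s : Finset X}
    (h : w.support ⊆ s) : ∑ x ∈ s, w x = 1 := by
  rw [← hw.2]
  exact (Finset.sum_subset h fun x _ hx => Finsupp.notMem_support_iff.1 hx).symm

theorem IsProbWeight.norm_wavg_sub_le {w : X →₀ ℝ} (hw : IsProbWeight w) {f : X → ℂ} {z : ℂ}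
    {ε : ℝ} (h : ∀ x ∈ w.support, ‖f x - z‖ ≤ ε) : ‖wavg w f - z‖ ≤ ε := by
  have h1 : wavg w f - z = ∑ x ∈ w.support, (w x : ℂ) * (f x - z) := by
    simp only [mul_sub, Finset.sum_sub_distrib, ← Finset.sum_mul]
    rw [← Complex.ofReal_sum, hw.2]
    simp [wavg]
  rw [h1]
  calc ‖∑ x ∈ w.support, (w x : ℂ) * (f x - z)‖ ≤ ∑ x ∈ w.support, w x * ε := by
        refine norm_sum_le_of_le _ fun x hx => ?_
        rw [norm_mul, Complex.norm_real, Real.norm_of_nonneg (hw.1 x)]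
        exact mul_le_mul_of_nonneg_left (h x hx) (hw.1 x)
    _ = ε := by rw [← Finset.sum_mul, hw.2, one_mul]

theorem wavg_sub (w : X →₀ ℝ) (f g : X → ℂ) : wavg w f - wavg w g = wavg w (fun x => f x - g x) := by
  simp only [wavg, mul_sub, Finset.sum_sub_distrib]

theorem wavg_comm {Y : Type*} (v : X →₀ ℝ) (w : Y →₀ ℝ) (f : X → Y → ℂ) :
    wavg v (fun x => wavg w (f x)) = wavg w (fun y => wavg v (fun x => f x y)) := by
  simp only [wavg, Finset.mul_sum]
  rw [Finset.sum_comm]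
  exact Finset.sum_congr rfl fun _ _ => Finset.sum_congr rfl fun _ _ => mul_left_comm _ _ _

/-- Points in the closed convex hull of the values of finitely many functions are approximated by
averages of the functions. -/
theorem exists_wavg_approx {ι : Type*} [Fintype ι] {f : ι → X → ℂ} {z : ι → ℂ}
    (hz : z ∈ closure (convexHull ℝ (Set.range fun x i => f i x))) {ε : ℝ} (hε : 0 < ε) :
    ∃ w : X →₀ ℝ, IsProbWeight w ∧ ∀ i, ‖wavg w (f i) - z i‖ < ε := by
  classical
  have hsub : convexHull ℝ (Set.range fun x i => f i x) ⊆
      {y | ∃ w : X →₀ ℝ, IsProbWeight w ∧ y = fun i => wavg w (f i)} := by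
    refine convexHull_min ?_ ?_
    · rintro _ ⟨x, rfl⟩
      refine ⟨Finsupp.single x 1, ⟨fun y => ?_, ?_⟩, ?_⟩
      · rw [Finsupp.single_apply]
        split_ifs <;> norm_num
      · simp [Finsupp.support_single]
      · ext i
        simp [wavg, Finsupp.support_single]
    · rintro _ ⟨v, hv, rfl⟩ _ ⟨w, hw, rfl⟩ a b ha hb hab
      have hs : (a • v + b • w).support ⊆ v.support ∪ w.support :=
        Finsupp.support_add.trans (Finset.union_subset_union Finsupp.support_smul
          Finsupp.support_smul)
      refine ⟨a • v + b • w, ⟨fun x => ?_, ?_⟩, ?_⟩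
      · exact add_nonneg (mul_nonneg ha (hv.1 x)) (mul_nonneg hb (hw.1 x))
      · rw [Finset.sum_subset hs fun x _ hx => Finsupp.notMem_support_iff.1 hx]
        simp only [Finsupp.add_apply, Finsupp.smul_apply, smul_eq_mul, Finset.sum_add_distrib,
          ← Finset.mul_sum]
        rw [hv.sum_eq_one Finset.subset_union_left, hw.sum_eq_one Finset.subset_union_right,
          mul_one, mul_one, hab]
      · ext i
        rw [wavg_eq_sum hs, Pi.add_apply, Pi.smul_apply, Pi.smul_apply,
          wavg_eq_sum Finset.subset_union_left, wavg_eq_sum Finset.subset_union_right,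
          Finset.smul_sum, Finset.smul_sum, ← Finset.sum_add_distrib]
        refine Finset.sum_congr rfl fun x _ => ?_
        simp only [Finsupp.add_apply, Finsupp.smul_apply, smul_eq_mul, Complex.real_smul]
        push_cast
        ring
  obtain ⟨y, hy, hd⟩ := Metric.mem_closure_iff.1 hz ε hε
  obtain ⟨w, hw, rfl⟩ := hsub hy
  refine ⟨w, hw, fun i => ?_⟩
  rw [← dist_eq_norm, dist_comm]
  exact (dist_le_pi_dist _ _ i).trans_lt hd

end WeightedAverages

/-! ### Iterated limits and the unboundedness of triangular truncation -/

section DoubleLimit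

variable {G : Type*} [Group G] [TopologicalSpace G] [IsTopologicalGroup G]
  [LocallyCompactSpace G] [MeasurableSpace G] [BorelSpace G]

theorem tupleNorm_weighted_sum_le {H : Type*} [NormedAddCommGroup H] [NormedSpace ℂ H]
    {ι Ω : Type*} [Fintype ι] [Fintype Ω] {p : ι → Ω → ℝ} (hp : ∀ i x, 0 ≤ p i x)
    (hp1 : ∀ i, ∑ x, p i x = 1) (η : ι × Ω → H) :
    tupleNorm (fun i => ∑ x, ((√(p i x) : ℝ) : ℂ) • η (i, x)) ≤ tupleNorm η := by
  refine Real.sqrt_le_sqrt ?_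
  rw [Fintype.sum_prod_type]
  refine Finset.sum_le_sum fun i _ => ?_
  have h1 : ‖∑ x, ((√(p i x) : ℝ) : ℂ) • η (i, x)‖ ≤ ∑ x, √(p i x) * ‖η (i, x)‖ := by
    refine norm_sum_le_of_le _ fun x _ => ?_
    rw [norm_smul, Complex.norm_real, Real.norm_of_nonneg (Real.sqrt_nonneg _)]
  calc ‖∑ x, ((√(p i x) : ℝ) : ℂ) • η (i, x)‖ ^ 2 ≤ (∑ x, √(p i x) * ‖η (i, x)‖) ^ 2 := by gcongr
    _ ≤ (∑ x, √(p i x) ^ 2) * ∑ x, ‖η (i, x)‖ ^ 2 := Finset.sum_mul_sq_le_sq_mul_sq _ _ _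
    _ = ∑ x, ‖η (i, x)‖ ^ 2 := by
        simp only [Real.sq_sqrt (hp i _), hp1, one_mul]

theorem tupleNorm_sqrt_smul {H : Type*} [NormedAddCommGroup H] [NormedSpace ℂ H]
    {ι Ω : Type*} [Fintype ι] [Fintype Ω] {p : ι → Ω → ℝ} (hp : ∀ i x, 0 ≤ p i x)
    (hp1 : ∀ i, ∑ x, p i x = 1) {e : H} (he : ‖e‖ = 1) :
    tupleNorm (fun a : ι × Ω => ((√(p a.1 a.2) : ℝ) : ℂ) • e) = √(Fintype.card ι) := by
  unfold tupleNorm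
  congr 1
  simp only [norm_smul, he, mul_one, Complex.norm_real, Real.norm_of_nonneg (Real.sqrt_nonneg _),
    Real.sq_sqrt (hp _ _), Fintype.sum_prod_type, hp1]
  simp

/-- Each index `i` is split into pairs `(i, x)`. The weight of a point is shared as two square roots
between the array and the test vectors: the enlarged array still satisfies the bound `K`, and both
tuples of test vectors have norm `√(card ι)`. -/
theorem IsCBMultiplierWith.norm_schur_average_le {φ : G → ℂ} {C : ℝ} (h : IsCBMultiplierWith φ C)
    (hC : 0 ≤ C) {X Y : Type*} (s : X → G) (t : Y → G) {ι : Type*} [Fintype ι]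
    {μ : ι → X →₀ ℝ} {ν : ι → Y →₀ ℝ} (hμ : ∀ i, IsProbWeight (μ i))
    (hν : ∀ i, IsProbWeight (ν i)) (c : ι → ι → ℂ) {K : ℝ} (hK : 0 ≤ K)
    (hc : ∀ (η : ι → L2 G) (ξ : ι → L2 G), ‖∑ i, ∑ j, c i j * inner ℂ (η i) (ξ j)‖ ≤
      K * tupleNorm η * tupleNorm ξ) :
    ‖∑ i, ∑ j, c i j * wavg (μ i) (fun x => wavg (ν j) (fun y => φ (s x * t y)))‖ ≤
      C * K * Fintype.card ι := by
  classical
  obtain ⟨e, he⟩ := exists_norm_eq_one_L2 (G := G)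
  let S : Finset X := Finset.univ.biUnion fun i => (μ i).support
  let T : Finset Y := Finset.univ.biUnion fun i => (ν i).support
  have hS : ∀ i, (μ i).support ⊆ S := fun i => Finset.subset_biUnion_of_mem
    (fun i => (μ i).support) (Finset.mem_univ i)
  have hT : ∀ i, (ν i).support ⊆ T := fun i => Finset.subset_biUnion_of_mem
    (fun i => (ν i).support) (Finset.mem_univ i)
  have hp1 : ∀ i, ∑ x : S, μ i x = 1 := fun i => by
    rw [Finset.sum_coe_sort S (fun x => μ i x)]
    exact (hμ i).sum_eq_one (hS i)
  have hq1 : ∀ i, ∑ y : T, ν i y = 1 := fun i => by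
    rw [Finset.sum_coe_sort T (fun y => ν i y)]
    exact (hν i).sum_eq_one (hT i)
  have hb := h.norm_schur_le hC (fun a : ι × S => s a.2) (fun b : ι × T => t b.2)
    (fun a b => c a.1 b.1 * ((√(μ a.1 a.2) : ℝ) : ℂ) * ((√(ν b.1 b.2) : ℝ) : ℂ)) hK ?_
    (fun a => ((√(μ a.1 a.2) : ℝ) : ℂ) • e) (fun b => ((√(ν b.1 b.2) : ℝ) : ℂ) • e)
  · rw [tupleNorm_sqrt_smul (fun i (x : S) => (hμ i).1 x) hp1 he,
      tupleNorm_sqrt_smul (fun i (x : T) => (hν i).1 x) hq1 he, mul_assoc (C * K),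
      Real.mul_self_sqrt (Nat.cast_nonneg _)] at hb
    refine le_trans (le_of_eq ?_) hb
    congr 1
    simp only [Fintype.sum_prod_type]
    refine Finset.sum_congr rfl fun i _ => ?_
    rw [Finset.sum_comm]
    refine Finset.sum_congr rfl fun j _ => ?_
    rw [wavg_eq_sum (hS i), Finset.mul_sum, ← Finset.sum_coe_sort S]
    refine Finset.sum_congr rfl fun x _ => ?_
    rw [wavg_eq_sum (hT j), Finset.mul_sum, Finset.mul_sum, ← Finset.sum_coe_sort T]
    refine Finset.sum_congr rfl fun y _ => ?_
    rw [inner_smul_left, inner_smul_right, inner_self_eq_norm_sq_to_K, he, Complex.conj_ofReal]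
    have h1 : ((√(μ i x) : ℝ) : ℂ) * ((√(μ i x) : ℝ) : ℂ) = μ i x := by
      rw [← Complex.ofReal_mul, Real.mul_self_sqrt ((hμ i).1 x)]
    have h2 : ((√(ν j y) : ℝ) : ℂ) * ((√(ν j y) : ℝ) : ℂ) = ν j y := by
      rw [← Complex.ofReal_mul, Real.mul_self_sqrt ((hν j).1 y)]
    rw [← h1, ← h2]
    simp only [RCLike.ofReal_one, one_pow, mul_one]
    ring
  · intro η ξ
    have h1 := hc (fun i => ∑ x : S, ((√(μ i x) : ℝ) : ℂ) • η (i, x))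
      (fun j => ∑ y : T, ((√(ν j y) : ℝ) : ℂ) • ξ (j, y))
    have h2 := tupleNorm_weighted_sum_le (fun i (x : S) => (hμ i).1 x) hp1 η
    have h3 := tupleNorm_weighted_sum_le (fun i (x : T) => (hν i).1 x) hq1 ξ
    refine le_trans (le_of_eq ?_) (h1.trans
      (mul_le_mul (mul_le_mul_of_nonneg_left h2 hK) h3 (tupleNorm_nonneg _)
      (mul_nonneg hK (tupleNorm_nonneg _))))
    congr 1
    simp only [Fintype.sum_prod_type]
    refine Finset.sum_congr rfl fun i _ => ?_
    rw [Finset.sum_comm]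
    refine Finset.sum_congr rfl fun j _ => ?_
    simp only [sum_inner, inner_sum, inner_smul_left, inner_smul_right, Finset.mul_sum,
      Complex.conj_ofReal]
    rw [Finset.sum_comm]
    exact Finset.sum_congr rfl fun x _ => Finset.sum_congr rfl fun y _ => by ring

/-- Row `i` sums to the `i`-th harmonic number, and each of the last `m` of the `2m` rows is at
least the `m`-th one. This is the `N log N` growth. -/
theorem sum_triangle_inv_ge (m : ℕ) : (m : ℝ) * ∑ k ∈ Finset.range m, 1 / ((k : ℝ) + 1) ≤
    ∑ i ∈ Finset.range (2 * m), ∑ j ∈ Finset.range i, 1 / ((i : ℝ) - j) := by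
  have h1 : ∀ i, ∑ j ∈ Finset.range i, 1 / ((i : ℝ) - j) =
      ∑ k ∈ Finset.range i, 1 / ((k : ℝ) + 1) := by
    intro i
    rw [← Finset.sum_range_reflect]
    refine Finset.sum_congr rfl fun j hj => ?_
    have := Finset.mem_range.1 hj
    rw [Nat.cast_sub (by omega), Nat.cast_sub (by omega)]
    congr 1
    push_cast
    ring
  simp only [h1]
  have h2 : ∀ i ∈ Finset.Ico m (2 * m), ∑ k ∈ Finset.range m, 1 / ((k : ℝ) + 1) ≤
      ∑ k ∈ Finset.range i, 1 / ((k : ℝ) + 1) := fun i hi =>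
    Finset.sum_le_sum_of_subset_of_nonneg
      (Finset.range_subset_range.2 (Finset.mem_Ico.1 hi).1) fun k _ _ => by positivity
  calc (m : ℝ) * ∑ k ∈ Finset.range m, 1 / ((k : ℝ) + 1)
      = ∑ _i ∈ Finset.Ico m (2 * m), ∑ k ∈ Finset.range m, 1 / ((k : ℝ) + 1) := by
        rw [Finset.sum_const, Nat.card_Ico, nsmul_eq_mul]
        congr 2
        omega
    _ ≤ ∑ i ∈ Finset.Ico m (2 * m), ∑ k ∈ Finset.range i, 1 / ((k : ℝ) + 1) :=
        Finset.sum_le_sum h2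
    _ ≤ _ := by
        refine Finset.sum_le_sum_of_subset_of_nonneg ?_ fun k _ _ => by positivity
        intro i hi
        exact Finset.mem_range.2 (Finset.mem_Ico.1 hi).2

/-- The two iterated limits of a completely bounded multiplier agree, because triangular truncation
is not bounded. -/
theorem IsCBMultiplierWith.eq_of_triangular {φ : G → ℂ} {C : ℝ} (h : IsCBMultiplierWith φ C)
    (hC : 0 ≤ C) {X Y : Type*} (s : X → G) (t : Y → G) {α β : ℂ}
    (hseq : ∀ ε : ℝ, 0 < ε → ∃ (μ : ℕ → X →₀ ℝ) (ν : ℕ → Y →₀ ℝ), (∀ i, IsProbWeight (μ i)) ∧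
      (∀ i, IsProbWeight (ν i)) ∧
      (∀ i j, i ≤ j → ‖wavg (μ i) (fun x => wavg (ν j) (fun y => φ (s x * t y))) - α‖ ≤ ε) ∧
      (∀ i j, j < i → ‖wavg (μ i) (fun x => wavg (ν j) (fun y => φ (s x * t y))) - β‖ ≤ ε)) :
    α = β := by
  by_contra hne
  have hpos : 0 < ‖β - α‖ := norm_pos_iff.2 (sub_ne_zero.2 (Ne.symm hne))
  have key : ∀ N : ℕ, ‖β - α‖ * ∑ i ∈ Finset.range N, ∑ j ∈ Finset.range i, 1 / ((i : ℝ) - j) ≤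
      C * Real.pi * N := by
    intro N
    refine le_of_forall_pos_le_add fun δ hδ => ?_
    -- There are `N * N` entries with coefficients of modulus at most 1, so this precision keeps the
    -- total error below `δ`.
    obtain ⟨μ, ν, hμ, hν, hα, hβ⟩ := hseq (δ / (N * N + 1)) (by positivity)
    set ε := δ / (N * N + 1) with hεdef
    have hε : 0 < ε := by positivity
    have hb := h.norm_schur_average_le hC s t (ι := Fin N) (fun i => hμ i) (fun i => hν i)
      (fun i j => 1 / (((i : ℕ) : ℂ) - ((j : ℕ) : ℂ))) Real.pi_pos.le norm_hilbertMatrix_form_le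
    rw [Fintype.card_fin] at hb
    let m : ℕ → ℕ → ℂ := fun i j => wavg (μ i) (fun x => wavg (ν j) (fun y => φ (s x * t y)))
    have hb' : ‖∑ i ∈ Finset.range N, ∑ j ∈ Finset.range N, (1 / ((i : ℂ) - (j : ℂ))) * m i j‖ ≤
        C * Real.pi * N := by
      refine le_trans (le_of_eq ?_) hb
      congr 1
      rw [← Fin.sum_univ_eq_sum_range
        (fun i => ∑ j ∈ Finset.range N, (1 / ((i : ℂ) - (j : ℂ))) * m i j)]
      refine Finset.sum_congr rfl fun i _ => ?_
      rw [← Fin.sum_univ_eq_sum_range (fun j => (1 / (((i : ℕ) : ℂ) - (j : ℂ))) * m i j)]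
    -- The exact triangular array. Its constant part `α` does not contribute since the Hilbert
    -- matrix is antisymmetric; the part below the diagonal sums terms of one sign.
    let τ : ℕ → ℕ → ℂ := fun i j => α + if j < i then β - α else 0
    have hmτ : ∀ i j, ‖m i j - τ i j‖ ≤ ε := by
      intro i j
      by_cases hij : j < i
      · simpa [τ, hij] using hβ i j hij
      · simpa [τ, hij] using hα i j (not_lt.1 hij)
    have hanti : ∑ i ∈ Finset.range N, ∑ j ∈ Finset.range N, (1 / ((i : ℂ) - (j : ℂ))) = 0 := by
      have h1 : ∑ i ∈ Finset.range N, ∑ j ∈ Finset.range N, (1 / ((i : ℂ) - (j : ℂ))) =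
          -∑ i ∈ Finset.range N, ∑ j ∈ Finset.range N, (1 / ((i : ℂ) - (j : ℂ))) := by
        conv_lhs => rw [Finset.sum_comm]
        simp only [← Finset.sum_neg_distrib]
        refine Finset.sum_congr rfl fun i _ => Finset.sum_congr rfl fun j _ => ?_
        rw [← neg_sub, one_div, one_div, inv_neg]
      exact self_eq_neg.1 h1
    have hτ : ∑ i ∈ Finset.range N, ∑ j ∈ Finset.range N, (1 / ((i : ℂ) - (j : ℂ))) * τ i j =
        (β - α) * ((∑ i ∈ Finset.range N, ∑ j ∈ Finset.range i, 1 / ((i : ℝ) - j) : ℝ) : ℂ) := by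
      simp only [τ, mul_add, Finset.sum_add_distrib, ← Finset.sum_mul, hanti, zero_mul, zero_add]
      push_cast
      rw [Finset.mul_sum]
      refine Finset.sum_congr rfl fun i hi => ?_
      rw [Finset.mul_sum]
      have hsub : Finset.range i ⊆ Finset.range N :=
        Finset.range_subset_range.2 (Finset.mem_range.1 hi).le
      rw [← Finset.sum_subset hsub]
      · refine Finset.sum_congr rfl fun j hj => ?_
        rw [if_pos (Finset.mem_range.1 hj)]
        ring
      · intro j _ hj
        rw [if_neg (fun h => hj (Finset.mem_range.2 h)), mul_zero]
    have herr : ‖∑ i ∈ Finset.range N, ∑ j ∈ Finset.range N, (1 / ((i : ℂ) - (j : ℂ))) * τ i j -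
        ∑ i ∈ Finset.range N, ∑ j ∈ Finset.range N, (1 / ((i : ℂ) - (j : ℂ))) * m i j‖ ≤ δ := by
      rw [← Finset.sum_sub_distrib]
      calc _ ≤ ∑ i ∈ Finset.range N, (N : ℝ) * ε := by
            refine norm_sum_le_of_le _ fun i _ => ?_
            rw [← Finset.sum_sub_distrib]
            calc _ ≤ ∑ j ∈ Finset.range N, ε := by
                  refine norm_sum_le_of_le _ fun j _ => ?_
                  rw [← mul_sub, norm_mul, norm_sub_rev]
                  have h1 : ‖(1 : ℂ) / ((i : ℂ) - (j : ℂ))‖ ≤ 1 := by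
                    have h2 : (i : ℂ) - (j : ℂ) = (((i : ℤ) - (j : ℤ) : ℤ) : ℂ) := by push_cast; rfl
                    rw [h2, norm_div, norm_one, Complex.norm_intCast]
                    rcases eq_or_ne ((i : ℤ) - (j : ℤ)) 0 with h0 | h0
                    · rw [h0]; simp
                    · rw [div_le_one (by positivity)]
                      exact_mod_cast Int.one_le_abs h0
                  calc _ ≤ 1 * ε := mul_le_mul h1 (hmτ i j) (norm_nonneg _) zero_le_one
                    _ = ε := one_mul ε
              _ = N * ε := by simp
        _ = N * N * ε := by simp [mul_assoc]
        _ ≤ δ := by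
            rw [hεdef, mul_div_assoc', div_le_iff₀ (by positivity)]
            nlinarith
    have hfin := (norm_sub_norm_le _ _).trans herr
    rw [hτ, norm_mul, Complex.norm_real, Real.norm_of_nonneg ?_] at hfin
    · linarith
    · refine Finset.sum_nonneg fun i _ => Finset.sum_nonneg fun j hj => ?_
      have : (j : ℝ) < i := by exact_mod_cast Finset.mem_range.1 hj
      exact one_div_nonneg.2 (sub_nonneg.2 this.le)
  have hbound : ∀ m : ℕ, 0 < m →
      ∑ k ∈ Finset.range m, 1 / ((k : ℝ) + 1) ≤ 2 * C * Real.pi / ‖β - α‖ := by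
    intro m hm
    have h1 := key (2 * m)
    have h2 := mul_le_mul_of_nonneg_left (sum_triangle_inv_ge m) hpos.le
    have hm' : (0 : ℝ) < m := by exact_mod_cast hm
    rw [le_div_iff₀ hpos]
    push_cast at h1
    refine le_of_mul_le_mul_left ?_ hm'
    linarith
  have hdiv := Real.tendsto_sum_range_one_div_nat_succ_atTop
  obtain ⟨m, hm, hm0⟩ := ((hdiv.eventually_gt_atTop (2 * C * Real.pi / ‖β - α‖)).and
    (eventually_gt_atTop 0)).exists
  exact absurd (hbound m hm0) (not_le.2 hm)

end DoubleLimit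

/-! ### Invariant means and pointwise limits of averaged translates -/

section Means

variable {G : Type*} [Group G] [TopologicalSpace G] [IsTopologicalGroup G]
  [LocallyCompactSpace G] [MeasurableSpace G] [BorelSpace G]

/-- The values of a mean on finitely many functions lie in the closed convex hull of the joint
values of these functions. -/
theorem IsLeftInvariantMean.mem_closure_convexHull {m : M0A G →ₗ[ℂ] ℂ}
    (hm : IsLeftInvariantMean m) {ι : Type*} [Fintype ι] (f : ι → M0A G) :
    (fun i => m (f i)) ∈
      closure (convexHull ℝ (Set.range fun (g : G) i => (f i : G → ℂ) g)) := by
  classical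
  by_contra hnot
  -- Separation gives a single combination `F` of the functions with `Re F < u` everywhere but `Re
  -- m(F) > u`.
  obtain ⟨Λ, u, hu, hx⟩ := RCLike.geometric_hahn_banach_closed_point (𝕜 := ℂ)
    (convex_convexHull ℝ (Set.range fun (g : G) i => (f i : G → ℂ) g)).closure isClosed_closure hnot
  let F : M0A G := ∑ i, Λ (Pi.single i 1) • f i
  have hΛ : ∀ z : ι → ℂ, Λ z = ∑ i, Λ (Pi.single i 1) * z i := by
    intro z
    conv_lhs => rw [← Finset.univ_sum_single z]
    rw [map_sum]
    refine Finset.sum_congr rfl fun i _ => ?_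
    have : Pi.single i (z i) = z i • (Pi.single i 1 : ι → ℂ) := by
      rw [← Pi.single_smul, smul_eq_mul, mul_one]
    rw [this, map_smul, smul_eq_mul, mul_comm]
  have hF : ∀ g, (F : G → ℂ) g = Λ (fun i => (f i : G → ℂ) g) := by
    intro g
    rw [hΛ]
    simp [F]
  have hmF : m F = Λ (fun i => m (f i)) := by
    rw [hΛ]
    simp [F]
  have hre : ∀ g, ((F : G → ℂ) g).re < u := fun g => by
    rw [hF]
    exact hu _ (subset_closure (subset_convexHull ℝ _ ⟨g, rfl⟩))
  set r := (m F).re with hr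
  have hru : u < r := by
    rw [hr, hmF]
    exact hx
  set B := m0aNorm F with hB
  have hB0 : 0 ≤ B := m0aNorm_nonneg F
  -- For large `t` the sup norm of `F + t` is at most `√((u + t)² + B²)`, close to `u + t`, while
  -- `|m(F + t)| ≥ r + t`. The last summand contradicts the resulting `(r - u)(r + u + 2t) ≤ B²`;
  -- the others keep the quantities being squared under control.
  let t : ℝ := B + |u| + |r| + 1 + B ^ 2 / (r - u)
  have hru' : 0 < r - u := sub_pos.2 hru
  have hdiv : 0 ≤ B ^ 2 / (r - u) := by positivity
  have htB : B ≤ t := by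
    have := abs_nonneg u
    have := abs_nonneg r
    simp only [t]
    linarith
  let E : M0A G := F + (t : ℂ) • ⟨1, one_mem_M0A⟩
  have hE : ∀ g, (E : G → ℂ) g = (F : G → ℂ) g + t := fun g => by simp [E]
  have hEn : ∀ g, ‖(E : G → ℂ) g‖ ≤ √((u + t) ^ 2 + B ^ 2) := by
    intro g
    rw [hE, Complex.norm_def]
    refine Real.sqrt_le_sqrt ?_
    have h1 := norm_apply_le_m0aNorm F g
    have h2 := (Complex.abs_re_le_norm _).trans h1
    have h3 := (Complex.abs_im_le_norm _).trans h1
    rw [Complex.normSq_apply]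
    simp only [Complex.add_re, Complex.ofReal_re, Complex.add_im, Complex.ofReal_im, add_zero]
    rw [← hB] at h2 h3
    have h4 := abs_le.1 h2
    have h5 := hre g
    have h6 : ((F : G → ℂ) g).im * ((F : G → ℂ) g).im ≤ B ^ 2 := by
      rw [← abs_mul_abs_self, sq]
      exact mul_self_le_mul_self (abs_nonneg _) h3
    have h7 : (((F : G → ℂ) g).re + t) * (((F : G → ℂ) g).re + t) ≤ (u + t) ^ 2 := by
      rw [sq]
      exact mul_self_le_mul_self (by linarith) (by linarith)
    linarith
  have h1 := hm.norm_le E _ hEn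
  have h2 : r + t ≤ ‖m E‖ := by
    have h3 : (m E).re = r + t := by
      have h4 : m E = m F + t := by
        simp only [E, map_add, map_smul, hm.map_one, smul_eq_mul, mul_one]
      rw [h4, Complex.add_re, Complex.ofReal_re]
    rw [← h3]
    exact Complex.re_le_norm _
  have h4 : 0 ≤ r + t := by
    have := neg_abs_le r
    have := abs_nonneg u
    simp only [t]
    linarith
  have h5 : (r + t) ^ 2 ≤ (u + t) ^ 2 + B ^ 2 := by
    rw [← Real.le_sqrt h4 (by positivity)]
    exact h2.trans h1
  have h6 : (r - u) * (r + u + 2 * t) ≤ B ^ 2 := by nlinarith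
  have h7 : r + u + 2 * t ≤ B ^ 2 / (r - u) := by rwa [le_div_iff₀ hru', mul_comm]
  have h8 := neg_abs_le r
  have h9 := neg_abs_le u
  simp only [t] at h7
  linarith

/-- A mean does not distinguish a multiplier from its pointwise limits of averages of left
translates. -/
theorem IsLeftInvariantMean.eq_of_mem_closure_convexHull {m : M0A G →ₗ[ℂ] ℂ}
    (hm : IsLeftInvariantMean m) {X : Type*} (s : X → G) (φ A : M0A G)
    (hA : ∀ F : Finset G, (fun g : F => (A : G → ℂ) g) ∈
      closure (convexHull ℝ (Set.range fun (x : X) (g : F) => (φ : G → ℂ) (s x * g)))) :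
    m φ = m A := by
  classical
  obtain ⟨C, hC, hφ⟩ := exists_nonneg_bound_of_mem_M0A φ.2
  refine hφ.eq_of_triangular hC s id fun ε hε => ?_
  let pr : (X →₀ ℝ) × (G →₀ ℝ) → (X →₀ ℝ) × (G →₀ ℝ) → ℂ := fun a b =>
    wavg a.1 (fun x => wavg b.2 (fun y => (φ : G → ℂ) (s x * y)))
  have hε2 : 0 < ε / 2 := half_pos hε
  -- Pairs `(μ, ν)` are constructed inductively so that the averaged kernel is close to `m φ` when
  -- `ν` is not older than `μ`, and close to `m A` when `ν` is older.
  obtain ⟨f, hf, hf'⟩ := exists_seq_of_forall_finset_exists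
    (fun a : (X →₀ ℝ) × (G →₀ ℝ) => IsProbWeight a.1 ∧ IsProbWeight a.2 ∧
      ‖wavg a.2 (A : G → ℂ) - m A‖ ≤ ε / 2 ∧ ‖pr a a - m φ‖ ≤ ε)
    (fun a b => ‖pr a b - m φ‖ ≤ ε ∧ ‖pr b a - m A‖ ≤ ε) (by
      intro S hS
      let F : Finset G := S.biUnion fun a => a.2.support
      -- The new `μ` brings the averaged translates of `φ` close to `A` on the supports of all
      -- earlier `ν`, where `A` already averages to nearly `m A`.
      obtain ⟨μ, hμ, hμA⟩ := exists_wavg_approx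
        (f := fun (g : F) (x : X) => (φ : G → ℂ) (s x * g)) (hA F) hε2
      let Y : Finset X := μ.support ∪ S.biUnion fun a => a.1.support
      -- The new `ν` imitates `m` on `A` and on the translates of `φ` by the points of the new and
      -- of all earlier `μ`; by invariance `m` takes the value `m φ` on these translates.
      obtain ⟨ν, hν, hνf⟩ := exists_wavg_approx
        (hm.mem_closure_convexHull fun y : Option Y =>
          y.elim A fun x => leftTranslate (s x)⁻¹ φ) hε2
      have hνA : ‖wavg ν (A : G → ℂ) - m A‖ ≤ ε / 2 := (hνf none).le
      have hνφ : ∀ x ∈ Y, ‖wavg ν (fun y => (φ : G → ℂ) (s x * y)) - m φ‖ ≤ ε := by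
        intro x hx
        have h1 := (hνf (some ⟨x, hx⟩)).le
        rw [Option.elim_some, hm.left_invariant] at h1
        simp only [leftTranslate, inv_inv] at h1
        linarith
      refine ⟨(μ, ν), ⟨hμ, hν, hνA, ?_⟩, fun a ha => ⟨?_, ?_⟩⟩
      · exact hμ.norm_wavg_sub_le fun x hx => hνφ x (Finset.mem_union_left _ hx)
      · exact (hS a ha).1.norm_wavg_sub_le fun x hx =>
          hνφ x (Finset.mem_union_right _ (Finset.mem_biUnion.2 ⟨a, ha, hx⟩))
      · have h1 : ‖wavg a.2 (fun y => wavg μ (fun x => (φ : G → ℂ) (s x * y)) -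
            (A : G → ℂ) y) - 0‖ ≤ ε / 2 := by
          refine (hS a ha).2.1.norm_wavg_sub_le fun y hy => ?_
          rw [sub_zero]
          exact (hμA ⟨y, Finset.mem_biUnion.2 ⟨a, ha, hy⟩⟩).le
        rw [sub_zero, ← wavg_sub, ← wavg_comm] at h1
        have h2 := (hS a ha).2.2.1
        have h3 := norm_sub_le_norm_sub_add_norm_sub (pr (μ, ν) a) (wavg a.2 (A : G → ℂ)) (m A)
        change ‖pr (μ, ν) a - wavg a.2 (A : G → ℂ)‖ ≤ ε / 2 at h1
        linarith)
  refine ⟨fun i => (f i).1, fun i => (f i).2, fun i => (hf i).1, fun i => (hf i).2.1,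
    fun i j hij => ?_, fun i j hij => (hf' j i hij).2⟩
  rcases hij.eq_or_lt with rfl | hij
  · exact (hf i).2.2.2
  · exact (hf' i j hij).1

end Means

/-! ### Quotients with compact kernel: Haar measure and averaging -/

section CompactKernel

variable {G : Type*} [Group G] [TopologicalSpace G] [IsTopologicalGroup G]
  [LocallyCompactSpace G] [MeasurableSpace G] [BorelSpace G]
  {Q : Type*} [Group Q] [TopologicalSpace Q] [IsTopologicalGroup Q]
  [LocallyCompactSpace Q] [MeasurableSpace Q] [BorelSpace Q]

/-- A quotient homomorphism of topological groups with compact kernel. -/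
structure IsCompactQuotient (q : G →* Q) : Prop where
  isOpenQuotientMap : IsOpenQuotientMap q
  isProperMap : IsProperMap q

namespace IsCompactQuotient

variable {q : G →* Q}

theorem continuous (hq : IsCompactQuotient q) : Continuous q := hq.isOpenQuotientMap.continuous

theorem surjective (hq : IsCompactQuotient q) : Function.Surjective q := hq.isOpenQuotientMap.surjective

theorem compactSpace_ker (hq : IsCompactQuotient q) : CompactSpace q.ker := by
  have h : IsCompact ((q.ker : Subgroup G) : Set G) := by
    have h1 := hq.isProperMap.isCompact_preimage (isCompact_singleton (x := (1 : Q)))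
    exact h1
  exact isCompact_iff_compactSpace.1 h

theorem isHaarMeasure_map (hq : IsCompactQuotient q) : (Measure.map q (Measure.haar : Measure G)).IsHaarMeasure where
  toIsMulLeftInvariant := isMulLeftInvariant_map q.toMulHom hq.continuous.measurable hq.surjective
  toIsOpenPosMeasure := hq.continuous.isOpenPosMeasure_map hq.surjective
  lt_top_of_isCompact := by
    intro K hK
    rw [← hK.measure_closure, Measure.map_apply hq.continuous.measurable
      isClosed_closure.measurableSet]
    exact (hq.isProperMap.isCompact_preimage hK.closure).measure_lt_top

/-- Regularity is required for the uniqueness of Haar measure up to a scalar. As `q` is a closed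
map, an open `U` containing the preimage of a set contains the preimage of the open set `(q ''
Uᶜ)ᶜ`; this gives outer regularity. -/
theorem regular_map (hq : IsCompactQuotient q) : (Measure.map q (Measure.haar : Measure G)).Regular where
  lt_top_of_isCompact := hq.isHaarMeasure_map.lt_top_of_isCompact
  outerRegular := by
    intro A hA r hr
    rw [Measure.map_apply hq.continuous.measurable hA] at hr
    obtain ⟨U, hAU, hUo, hU⟩ := Set.exists_isOpen_lt_of_lt _ r hr
    have ho : IsOpen (q '' Uᶜ)ᶜ := (hq.isProperMap.isClosedMap _ hUo.isClosed_compl).isOpen_compl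
    refine ⟨(q '' Uᶜ)ᶜ, ?_, ho, ?_⟩
    · rintro y hy ⟨x, hx, rfl⟩
      exact hx (hAU hy)
    · rw [Measure.map_apply hq.continuous.measurable ho.measurableSet]
      refine (measure_mono ?_).trans_lt hU
      intro x hx
      by_contra h
      exact hx ⟨x, h, rfl⟩
  innerRegular := by
    intro U hU r hr
    rw [Measure.map_apply hq.continuous.measurable hU.measurableSet] at hr
    obtain ⟨C, hCU, hC, hr⟩ := (hU.preimage hq.continuous).exists_lt_isCompact hr
    refine ⟨q '' C, Set.image_subset_iff.2 hCU, hC.image hq.continuous, hr.trans_le ?_⟩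
    have h1 := Measure.le_map_apply_image (μ := (Measure.haar : Measure G))
      hq.continuous.aemeasurable C
    exact h1

theorem exists_map_haar_eq (hq : IsCompactQuotient q) : ∃ c : NNReal, c ≠ 0 ∧
    Measure.map q (Measure.haar : Measure G) = c • (Measure.haar : Measure Q) := by
  have h1 := hq.isHaarMeasure_map
  have h2 := hq.regular_map
  exact ⟨_, (Measure.haarScalarFactor_pos_of_isHaarMeasure _ (Measure.haar : Measure Q)).ne',
    Measure.isMulLeftInvariant_eq_smul_of_regular _ (Measure.haar : Measure Q)⟩

end IsCompactQuotient

section Average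

variable (q : G →* Q) [CompactSpace q.ker]

/-- The normalised Haar measure of the kernel. -/
def kerMeasure : Measure q.ker := Measure.haarMeasure ⊤

instance : IsProbabilityMeasure (kerMeasure q) := ⟨Measure.haarMeasure_self⟩

instance : (kerMeasure q).IsHaarMeasure :=
  inferInstanceAs (Measure.haarMeasure (⊤ : TopologicalSpace.PositiveCompacts q.ker)).IsHaarMeasure

instance : (kerMeasure q).IsMulRightInvariant where
  map_mul_right_eq_self g := by
    have : IsProbabilityMeasure (Measure.map (· * g) (kerMeasure q)) :=
      Measure.isProbabilityMeasure_map (by fun_prop)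
    exact Measure.isHaarMeasure_eq_of_isProbabilityMeasure _ _

/-- The average of a function over the kernel of `q`, acting by left translations. -/
def leftAvg (f : G → ℂ) (g : G) : ℂ := ∫ k : q.ker, f (k * g) ∂kerMeasure q

variable {q}

/-- Here `g = (g h⁻¹) h` with `g h⁻¹` in the kernel, whose Haar measure is right invariant because
the kernel is compact. -/
theorem leftAvg_eq_of_map_eq (f : G → ℂ) {g h : G} (hgh : q g = q h) :
    leftAvg q f g = leftAvg q f h := by
  have hk : g * h⁻¹ ∈ q.ker := by
    rw [MonoidHom.mem_ker, map_mul, map_inv, hgh, mul_inv_cancel]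
  have h1 := integral_mul_right_eq_self (μ := kerMeasure q) (fun k : q.ker => f (k * h)) ⟨_, hk⟩
  rw [leftAvg, leftAvg, ← h1]
  simp [mul_assoc]

theorem leftAvg_comp (f : Q → ℂ) (g : G) : leftAvg q (fun g => f (q g)) g = f (q g) := by
  have h : ∀ k : q.ker, q k = 1 := fun k => k.2
  simp [leftAvg, h]

theorem continuous_leftAvg {f : G → ℂ} (hf : Continuous f) : Continuous (leftAvg q f) := by
  rw [← continuousOn_univ]
  refine continuousOn_integral_of_compact_support (k := Set.univ) isCompact_univ ?_ ?_
  · exact Continuous.continuousOn (hf.comp (by fun_prop))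
  · intro p x _ hx
    exact absurd (Set.mem_univ x) hx

/-- The Haar measure of `G` need not be σ-finite, so Fubini is used in its form for continuous
integrands of compact support. -/
theorem integral_mul_leftAvg {a b : G → ℂ} (ha : Continuous a) (hb : Continuous b)
    (h : HasCompactSupport a ∨ HasCompactSupport b) :
    ∫ g, a g * leftAvg q b g ∂(Measure.haar : Measure G) =
      ∫ k : q.ker, ∫ g, a g * b (k * g) ∂(Measure.haar : Measure G) ∂kerMeasure q := by
  have h1 : ∀ g, a g * leftAvg q b g = ∫ k : q.ker, a g * b (k * g) ∂kerMeasure q := fun g =>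
    (integral_const_mul _ _).symm
  simp only [h1]
  refine integral_integral_swap_of_hasCompactSupport ?_ ?_
  · change Continuous fun p : G × q.ker => a p.1 * b (p.2 * p.1)
    fun_prop
  · rcases h with h | h
    · refine HasCompactSupport.intro (K := tsupport a ×ˢ Set.univ) (h.isCompact.prod isCompact_univ) ?_
      rintro ⟨g, k⟩ hgk
      change a g * b (k * g) = 0
      rw [image_eq_zero_of_notMem_tsupport (f := a) (fun hg => hgk ⟨hg, Set.mem_univ _⟩), zero_mul]
    · refine HasCompactSupport.intro
        (K := (fun p : G × q.ker => ((p.2 : G)⁻¹ * p.1, p.2)) '' (tsupport b ×ˢ Set.univ))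
        ((h.isCompact.prod isCompact_univ).image (by fun_prop)) ?_
      rintro ⟨g, k⟩ hgk
      change a g * b (k * g) = 0
      rw [image_eq_zero_of_notMem_tsupport (f := b), mul_zero]
      intro hg
      exact hgk ⟨(k * g, k), ⟨hg, Set.mem_univ _⟩, by simp⟩

/-- Averaging is symmetric with respect to functions invariant under the kernel. -/
theorem integral_mul_leftAvg_of_invariant {a : Q → ℂ} {b : G → ℂ} (ha : Continuous fun g => a (q g))
    (hb : Continuous b) (h : HasCompactSupport (fun g => a (q g)) ∨ HasCompactSupport b) :
    ∫ g, a (q g) * leftAvg q b g ∂(Measure.haar : Measure G) =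
      ∫ g, a (q g) * b g ∂(Measure.haar : Measure G) := by
  rw [integral_mul_leftAvg ha hb h]
  have h1 : ∀ k : q.ker, ∫ g, a (q g) * b (k * g) ∂(Measure.haar : Measure G) =
      ∫ g, a (q g) * b g ∂(Measure.haar : Measure G) := by
    intro k
    have hk : q k = 1 := k.2
    have h2 := integral_mul_left_eq_self (μ := (Measure.haar : Measure G))
      (fun g => a (q g) * b g) (k : G)
    simpa only [map_mul, hk, one_mul] using h2
  simp [h1]

variable (q) in
/-- The average of a function over the kernel, as a function on the quotient. -/
def quotAvg (f : G → ℂ) : Q → ℂ := fun y => leftAvg q f (Function.invFun q y)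

theorem quotAvg_apply (hq : IsCompactQuotient q) (f : G → ℂ) (g : G) :
    quotAvg q f (q g) = leftAvg q f g :=
  leftAvg_eq_of_map_eq f (Function.rightInverse_invFun hq.surjective (q g))

theorem continuous_quotAvg (hq : IsCompactQuotient q) {f : G → ℂ} (hf : Continuous f) :
    Continuous (quotAvg q f) := by
  rw [← hq.isOpenQuotientMap.continuous_comp_iff]
  have h : quotAvg q f ∘ q = leftAvg q f := funext fun g => quotAvg_apply hq f g
  rw [h]
  exact continuous_leftAvg hf

theorem hasCompactSupport_quotAvg (hq : IsCompactQuotient q) {f : G → ℂ}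
    (hf : HasCompactSupport f) : HasCompactSupport (quotAvg q f) := by
  refine HasCompactSupport.intro (K := q '' tsupport f) (hf.isCompact.image hq.continuous) ?_
  intro y hy
  obtain ⟨g, rfl⟩ := hq.surjective y
  rw [quotAvg_apply hq]
  have h1 : ∀ k : q.ker, f (k * g) = 0 := by
    intro k
    refine image_eq_zero_of_notMem_tsupport fun hk => hy ⟨k * g, hk, ?_⟩
    rw [map_mul, show q k = 1 from k.2, one_mul]
  simp [leftAvg, h1]

theorem quotAvg_comp (hq : IsCompactQuotient q) (f : Q → ℂ) :
    quotAvg q (fun g => f (q g)) = f := by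
  ext y
  obtain ⟨g, rfl⟩ := hq.surjective y
  rw [quotAvg_apply hq, leftAvg_comp]

theorem hasCompactSupport_comp (hq : IsCompactQuotient q) {f : Q → ℂ} (hf : HasCompactSupport f) :
    HasCompactSupport fun g => f (q g) := by
  refine HasCompactSupport.intro (hq.isProperMap.isCompact_preimage hf.isCompact) ?_
  intro g hg
  exact image_eq_zero_of_notMem_tsupport hg

theorem integral_comp_quotient {c : NNReal} (hq : IsCompactQuotient q)
    (hc : Measure.map q (Measure.haar : Measure G) = c • (Measure.haar : Measure Q))
    {f : Q → ℂ} (hf : AEStronglyMeasurable f (Measure.haar : Measure Q)) :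
    ∫ g, f (q g) ∂(Measure.haar : Measure G) = c * ∫ y, f y ∂(Measure.haar : Measure Q) := by
  have hf' : AEStronglyMeasurable f (Measure.map q (Measure.haar : Measure G)) := by
    rw [hc]
    exact hf.smul_measure c
  rw [← integral_map hq.continuous.aemeasurable hf', hc, integral_smul_nnreal_measure]
  rfl

end Average

end CompactKernel

/-! ### Density of compactly supported continuous functions -/

section CompactSupportDense

/-- Continuous functions with compact support are dense in `Lᵖ` of a regular measure on a locally
compact space, without any normality assumption. -/
theorem exists_hasCompactSupport_eLpNorm_sub_le_of_memLp {X E : Type*} [TopologicalSpace X]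
    [R1Space X] [LocallyCompactSpace X] [MeasurableSpace X] [BorelSpace X] [NormedAddCommGroup E]
    [NormedSpace ℝ E] {μ : Measure X} [μ.Regular] {p : ENNReal} (hp : p ≠ ⊤) {f : X → E}
    (hf : MemLp f p μ) {ε : ENNReal} (hε : ε ≠ 0) :
    ∃ g : X → E, HasCompactSupport g ∧ eLpNorm (f - g) p μ ≤ ε ∧ Continuous g ∧ MemLp g p μ := by
  suffices H : ∃ g : X → E, eLpNorm (f - g) p μ ≤ ε ∧
      Continuous g ∧ MemLp g p μ ∧ HasCompactSupport g by
    obtain ⟨g, h1, h2, h3, h4⟩ := H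
    exact ⟨g, h4, h1, h2, h3⟩
  apply hf.induction_dense hp _ _ _ _ hε
  rotate_left
  · rintro f g ⟨h1, h2, h3⟩ ⟨h4, h5, h6⟩
    exact ⟨h1.add h4, h2.add h5, h3.add h6⟩
  · rintro f ⟨_, h, _⟩
    exact h.aestronglyMeasurable
  intro c t ht htμ ε hε
  obtain ⟨δ, δpos, hδ⟩ := exists_Lp_half E μ p hε
  obtain ⟨η, ηpos, hη⟩ := exists_eLpNorm_indicator_le (μ := μ) hp c δpos.ne'
  have hη_pos : (0 : ENNReal) < η := ENNReal.coe_pos.2 ηpos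
  -- Replacing `t` by a compact subset leaves the separation of a compact set from the complement of
  -- an open one, for which local compactness suffices.
  obtain ⟨s, st, s_compact, s_closed, μs⟩ :=
    ht.exists_isCompact_isClosed_sdiff_lt htμ.ne hη_pos.ne'
  have hsμ : μ s < ⊤ := (measure_mono st).trans_lt htμ
  have I1 : eLpNorm ((s.indicator fun _ => c) - t.indicator fun _ => c) p μ ≤ δ := by
    rw [← eLpNorm_neg, neg_sub, ← Set.indicator_sdiff st]
    exact hη _ μs.le
  obtain ⟨V, sV, V_open, -, hV⟩ := s_closed.measurableSet.exists_isOpen_sdiff_lt hsμ.ne hη_pos.ne'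
  obtain ⟨g, hg1, hg2, hg3, hg4⟩ :=
    exists_continuousMap_one_of_isCompact_subset_isOpen s_compact V_open sV
  have hgc : HasCompactSupport fun x => g x • c := HasCompactSupport.smul_right (f := g) hg2
  have hcont : Continuous fun x => g x • c := by fun_prop
  have hmem : MemLp (fun x => g x • c) p μ := hcont.memLp_of_hasCompactSupport hgc
  have I2 : eLpNorm ((fun x => g x • c) - s.indicator fun _ => c) p μ ≤ δ := by
    refine le_trans (eLpNorm_mono fun x => ?_) (hη (V \ s) hV.le)
    rw [Pi.sub_apply]
    by_cases hs : x ∈ s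
    · simp [hg1 hs, hs]
    by_cases hv : x ∈ V
    · rw [Set.indicator_of_notMem hs, Set.indicator_of_mem (show x ∈ V \ s from ⟨hv, hs⟩), sub_zero,
        norm_smul, Real.norm_of_nonneg (hg4 x).1]
      exact mul_le_of_le_one_left (norm_nonneg _) (hg4 x).2
    · have : g x = 0 := image_eq_zero_of_notMem_tsupport fun h => hv (hg3 h)
      simp [this, hs]
  refine ⟨_, ?_, hcont, hmem, hgc⟩
  have h := (hδ _ _ (hmem.aestronglyMeasurable.sub
    (aestronglyMeasurable_const.indicator s_closed.measurableSet))
    ((aestronglyMeasurable_const.indicator s_closed.measurableSet).sub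
      (aestronglyMeasurable_const.indicator ht)) I2 I1).le
  rwa [sub_add_sub_cancel] at h

end CompactSupportDense

/-! ### Square integrable functions and test functions -/

section CompactSupportL2

variable {G : Type*} [Group G] [TopologicalSpace G] [IsTopologicalGroup G]
  [LocallyCompactSpace G] [MeasurableSpace G] [BorelSpace G]

theorem memLp_of_hasCompactSupport {a : G → ℂ} (ha : Continuous a) (h : HasCompactSupport a) :
    MemLp a 2 (Measure.haar : Measure G) := ha.memLp_of_hasCompactSupport h

theorem inner_toLp {a b : G → ℂ} (ha : MemLp a 2 (Measure.haar : Measure G))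
    (hb : MemLp b 2 (Measure.haar : Measure G)) : inner ℂ (ha.toLp a) (hb.toLp b) =
      ∫ g, starRingEnd ℂ (a g) * b g ∂(Measure.haar : Measure G) := by
  rw [L2.inner_def]
  refine integral_congr_ae ?_
  filter_upwards [ha.coeFn_toLp, hb.coeFn_toLp] with g h1 h2
  rw [h1, h2, RCLike.inner_apply, mul_comm]

theorem leftReg_toLp {a : G → ℂ} (ha : MemLp a 2 (Measure.haar : Measure G)) (g : G)
    (hga : MemLp (fun h => a (g⁻¹ * h)) 2 (Measure.haar : Measure G)) :
    leftReg g (ha.toLp a) = hga.toLp _ := by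
  change Lp.compMeasurePreserving _ _ _ = _
  rw [Lp.toLp_compMeasurePreserving]
  rfl

theorem leftReg_coeFn (g : G) (ξ : L2 G) :
    (leftReg g ξ : G → ℂ) =ᵐ[(Measure.haar : Measure G)] fun h => ξ (g⁻¹ * h) :=
  Lp.coeFn_compMeasurePreserving ξ (measurePreserving_mul_left (Measure.haar : Measure G) g⁻¹)

theorem exists_compactSupport_L2_approx (ξ : L2 G) {ε : ℝ} (hε : 0 < ε) :
    ∃ a : G → ℂ, Continuous a ∧ HasCompactSupport a ∧
      ∃ ha : MemLp a 2 (Measure.haar : Measure G), ‖ξ - ha.toLp a‖ ≤ ε := by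
  obtain ⟨a, h1, h2, h3, h4⟩ := exists_hasCompactSupport_eLpNorm_sub_le_of_memLp
    (by simp) (Lp.memLp ξ) (ε := ENNReal.ofReal ε) (by simpa using hε)
  refine ⟨a, h3, h1, h4, ?_⟩
  have h5 : ‖ξ - h4.toLp a‖ = (eLpNorm (⇑ξ - a) 2 (Measure.haar : Measure G)).toReal := by
    rw [Lp.norm_def]
    congr 1
    refine eLpNorm_congr_ae ?_
    filter_upwards [Lp.coeFn_sub ξ (h4.toLp a), h4.coeFn_toLp] with g h6 h7
    rw [h6, Pi.sub_apply, h7, Pi.sub_apply]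
  rw [h5]
  exact ENNReal.toReal_le_of_le_ofReal hε.le h2

theorem eq_zero_of_inner_compactSupport {ξ : L2 G}
    (h : ∀ (a : G → ℂ) (ha : MemLp a 2 (Measure.haar : Measure G)), Continuous a →
      HasCompactSupport a → inner ℂ (ha.toLp a) ξ = 0) : ξ = 0 := by
  by_contra hne
  have hpos : 0 < ‖ξ‖ := norm_pos_iff.2 hne
  obtain ⟨a, h1, h2, ha, h3⟩ := exists_compactSupport_L2_approx ξ (ε := ‖ξ‖ / 2) (by positivity)
  have h4 : inner ℂ (ξ - ha.toLp a) ξ = (‖ξ‖ : ℂ) ^ 2 := by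
    rw [inner_sub_left, h a ha h1 h2, sub_zero, inner_self_eq_norm_sq_to_K]
    rfl
  have h5 := norm_inner_le_norm (𝕜 := ℂ) (ξ - ha.toLp a) ξ
  rw [h4, norm_pow, Complex.norm_real, norm_norm] at h5
  nlinarith

end CompactSupportL2

/-! ### The embedding of `L²(Q)` in `L²(G)` as the vectors fixed by the kernel -/

section PullL2

variable {G : Type*} [Group G] [TopologicalSpace G] [IsTopologicalGroup G]
  [LocallyCompactSpace G] [MeasurableSpace G] [BorelSpace G]
  {Q : Type*} [Group Q] [TopologicalSpace Q] [IsTopologicalGroup Q]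
  [LocallyCompactSpace Q] [MeasurableSpace Q] [BorelSpace Q] {q : G →* Q}

namespace IsCompactQuotient

/-- The scalar relating the image of the Haar measure of `G` to the Haar measure of `Q`. -/
def modulus (hq : IsCompactQuotient q) : NNReal := hq.exists_map_haar_eq.choose

theorem modulus_ne_zero (hq : IsCompactQuotient q) : hq.modulus ≠ 0 :=
  hq.exists_map_haar_eq.choose_spec.1

theorem map_haar (hq : IsCompactQuotient q) :
    Measure.map q (Measure.haar : Measure G) = hq.modulus • (Measure.haar : Measure Q) :=
  hq.exists_map_haar_eq.choose_spec.2

theorem quasiMeasurePreserving (hq : IsCompactQuotient q) :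
    Measure.QuasiMeasurePreserving q (Measure.haar : Measure G) (Measure.haar : Measure Q) := by
  refine ⟨hq.continuous.measurable, ?_⟩
  rw [hq.map_haar]
  exact Measure.smul_absolutelyContinuous

theorem eLpNorm_comp (hq : IsCompactQuotient q) {f : Q → ℂ}
    (hf : AEStronglyMeasurable f (Measure.haar : Measure Q)) :
    eLpNorm (f ∘ q) 2 (Measure.haar : Measure G) =
      (hq.modulus : ENNReal) ^ (1 / 2 : ℝ) * eLpNorm f 2 (Measure.haar : Measure Q) := by
  have hf' : AEStronglyMeasurable f (Measure.map q (Measure.haar : Measure G)) := by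
    rw [hq.map_haar]
    exact hf.smul_measure _
  rw [← eLpNorm_map_measure hf' hq.continuous.aemeasurable, hq.map_haar]
  have h := eLpNorm_smul_measure_of_ne_top (p := 2) (by simp) f (hq.modulus : ENNReal)
    (μ := (Measure.haar : Measure Q))
  rw [smul_eq_mul] at h
  simpa using h

theorem memLp_comp (hq : IsCompactQuotient q) {f : Q → ℂ}
    (hf : MemLp f 2 (Measure.haar : Measure Q)) :
    MemLp (fun g => f (q g)) 2 (Measure.haar : Measure G) := by
  refine ⟨hf.1.comp_quasiMeasurePreserving hq.quasiMeasurePreserving, ?_⟩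
  have h := hq.eLpNorm_comp hf.1
  change eLpNorm (f ∘ q) 2 _ < _
  rw [h]
  exact ENNReal.mul_lt_top (ENNReal.rpow_lt_top_of_nonneg (by norm_num) ENNReal.coe_ne_top) hf.2

/-- Composition with `q` as a linear map from `L²(Q)` to `L²(G)`. -/
def compL2 (hq : IsCompactQuotient q) : L2 Q →ₗ[ℂ] L2 G where
  toFun ξ := (hq.memLp_comp (Lp.memLp ξ)).toLp _
  map_add' ξ η := by
    rw [← MemLp.toLp_add (hq.memLp_comp (Lp.memLp ξ)) (hq.memLp_comp (Lp.memLp η))]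
    refine MemLp.toLp_congr _ _ ?_
    filter_upwards [hq.quasiMeasurePreserving.ae (Lp.coeFn_add ξ η)] with g hg using hg
  map_smul' r ξ := by
    rw [RingHom.id_apply, ← MemLp.toLp_const_smul r (hq.memLp_comp (Lp.memLp ξ))]
    refine MemLp.toLp_congr _ _ ?_
    filter_upwards [hq.quasiMeasurePreserving.ae (Lp.coeFn_smul r ξ)] with g hg using hg

theorem compL2_coeFn (hq : IsCompactQuotient q) (ξ : L2 Q) :
    (hq.compL2 ξ : G → ℂ) =ᵐ[(Measure.haar : Measure G)] fun g => ξ (q g) :=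
  (hq.memLp_comp (Lp.memLp ξ)).coeFn_toLp

theorem norm_compL2 (hq : IsCompactQuotient q) (ξ : L2 Q) :
    ‖hq.compL2 ξ‖ = (hq.modulus : ℝ) ^ (1 / 2 : ℝ) * ‖ξ‖ := by
  change ‖(hq.memLp_comp (Lp.memLp ξ)).toLp _‖ = _
  rw [Lp.norm_toLp]
  have h := hq.eLpNorm_comp (Lp.memLp ξ).1
  change (eLpNorm (⇑ξ ∘ q) 2 _).toReal = _
  rw [h, ENNReal.toReal_mul, ← Lp.norm_def, ← ENNReal.toReal_rpow]
  rfl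

theorem modulus_rpow_pos (hq : IsCompactQuotient q) : 0 < (hq.modulus : ℝ) ^ (1 / 2 : ℝ) :=
  Real.rpow_pos_of_pos (NNReal.coe_pos.2 (pos_iff_ne_zero.2 hq.modulus_ne_zero)) _

/-- The isometric embedding of `L²(Q)` in `L²(G)`, a multiple of composition with `q`. -/
def pullL2 (hq : IsCompactQuotient q) : L2 Q →ₗᵢ[ℂ] L2 G where
  toLinearMap := ((((hq.modulus : ℝ) ^ (1 / 2 : ℝ))⁻¹ : ℝ) : ℂ) • hq.compL2
  norm_map' ξ := by
    rw [LinearMap.smul_apply, norm_smul, norm_compL2, Complex.norm_real,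
      Real.norm_of_nonneg (inv_nonneg.2 hq.modulus_rpow_pos.le), ← mul_assoc,
      inv_mul_cancel₀ hq.modulus_rpow_pos.ne', one_mul]

theorem pullL2_apply (hq : IsCompactQuotient q) (ξ : L2 Q) :
    hq.pullL2 ξ = ((((hq.modulus : ℝ) ^ (1 / 2 : ℝ))⁻¹ : ℝ) : ℂ) • hq.compL2 ξ := rfl

theorem compL2_eq (hq : IsCompactQuotient q) (ξ : L2 Q) :
    hq.compL2 ξ = hq.pullL2 (((((hq.modulus : ℝ) ^ (1 / 2 : ℝ)) : ℝ) : ℂ) • ξ) := by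
  rw [map_smul]
  change _ = ((((hq.modulus : ℝ) ^ (1 / 2 : ℝ) : ℝ)) : ℂ) •
    (((((hq.modulus : ℝ) ^ (1 / 2 : ℝ))⁻¹ : ℝ) : ℂ) • hq.compL2 ξ)
  rw [smul_smul, ← Complex.ofReal_mul, mul_inv_cancel₀ hq.modulus_rpow_pos.ne', Complex.ofReal_one,
    one_smul]

theorem leftReg_compL2 (hq : IsCompactQuotient q) (g : G) (ξ : L2 Q) :
    leftReg g (hq.compL2 ξ) = hq.compL2 (leftReg (q g) ξ) := by
  apply Lp.ext
  filter_upwards [leftReg_coeFn g (hq.compL2 ξ), hq.compL2_coeFn (leftReg (q g) ξ),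
    hq.quasiMeasurePreserving.ae (leftReg_coeFn (q g) ξ),
    (measurePreserving_mul_left (Measure.haar : Measure G) g⁻¹).quasiMeasurePreserving.ae
      (hq.compL2_coeFn ξ)] with h h1 h2 h3 h4
  rw [h1, h2, h3, h4, map_mul, map_inv]

theorem leftReg_pullL2 (hq : IsCompactQuotient q) (g : G) (ξ : L2 Q) :
    leftReg g (hq.pullL2 ξ) = hq.pullL2 (leftReg (q g) ξ) := by
  rw [pullL2_apply, pullL2_apply, map_smul, leftReg_compL2]

theorem leftReg_ker_pullL2 (hq : IsCompactQuotient q) (k : q.ker) (ξ : L2 Q) :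
    leftReg (k : G) (hq.pullL2 ξ) = hq.pullL2 ξ := by
  rw [leftReg_pullL2, show q k = 1 from k.2, leftReg_one]
  rfl

theorem compL2_toLp (hq : IsCompactQuotient q) {f : Q → ℂ}
    (hf : MemLp f 2 (Measure.haar : Measure Q)) :
    hq.compL2 (hf.toLp f) = (hq.memLp_comp hf).toLp _ := by
  apply Lp.ext
  filter_upwards [hq.compL2_coeFn (hf.toLp f), (hq.memLp_comp hf).coeFn_toLp,
    hq.quasiMeasurePreserving.ae hf.coeFn_toLp] with g h1 h2 h3
  rw [h1, h2, h3]

theorem continuous_leftReg_ker (ξ : L2 G) : Continuous fun k : q.ker => leftReg (k : G) ξ :=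
  (continuous_leftReg ξ).comp continuous_subtype_val

theorem integrable_leftReg_ker [CompactSpace q.ker] (ξ : L2 G) :
    Integrable (fun k : q.ker => leftReg (k : G) ξ) (kerMeasure q) :=
  (continuous_leftReg_ker ξ).integrable_of_hasCompactSupport (HasCompactSupport.of_compactSpace _)

/-- Links the vector valued integral of translates with the pointwise average; equality is tested
weakly against continuous functions of compact support. -/
theorem integral_leftReg_toLp [CompactSpace q.ker] (hq : IsCompactQuotient q) {a : G → ℂ}
    (hac : Continuous a) (has : HasCompactSupport a) (ha : MemLp a 2 (Measure.haar : Measure G))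
    (ha' : MemLp (quotAvg q a) 2 (Measure.haar : Measure Q)) :
    ∫ k : q.ker, leftReg (k : G)⁻¹ (ha.toLp a) ∂kerMeasure q = hq.compL2 (ha'.toLp _) := by
  have hint : Integrable (fun k : q.ker => leftReg (k : G)⁻¹ (ha.toLp a)) (kerMeasure q) :=
    ((continuous_leftReg _).comp (continuous_subtype_val.inv)).integrable_of_hasCompactSupport
      (HasCompactSupport.of_compactSpace _)
  rw [← sub_eq_zero]
  refine eq_zero_of_inner_compactSupport fun b hb hbc hbs => ?_
  rw [inner_sub_right, sub_eq_zero, ← integral_inner hint, compL2_toLp, inner_toLp]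
  have h1 : ∀ k : q.ker, inner ℂ (hb.toLp b) (leftReg (k : G)⁻¹ (ha.toLp a)) =
      ∫ g, starRingEnd ℂ (b g) * a (k * g) ∂(Measure.haar : Measure G) := by
    intro k
    have h2 : MemLp (fun h => a ((k : G)⁻¹⁻¹ * h)) 2 (Measure.haar : Measure G) :=
      ha.comp_measurePreserving (measurePreserving_mul_left _ _)
    rw [leftReg_toLp ha _ h2, inner_toLp, inv_inv]
  simp only [h1, quotAvg_apply hq]
  refine (integral_mul_leftAvg (by fun_prop) hac (Or.inr has)).symm

/-- For a test function `a`, invariance of `ξ` allows replacing `a` by its average over the kernel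
in `⟪ξ, a⟫`, and this average lies in the range of the embedding. -/
theorem eq_zero_of_fixed (hq : IsCompactQuotient q) {ξ : L2 G}
    (hfix : ∀ k : q.ker, leftReg (k : G) ξ = ξ) (h0 : ∀ η, inner ℂ (hq.pullL2 η) ξ = 0) : ξ = 0 := by
  have := hq.compactSpace_ker
  refine eq_zero_of_inner_compactSupport fun a ha hac has => ?_
  have ha' : MemLp (quotAvg q a) 2 (Measure.haar : Measure Q) :=
    memLp_of_hasCompactSupport (continuous_quotAvg hq hac) (hasCompactSupport_quotAvg hq has)
  have hint : Integrable (fun k : q.ker => leftReg (k : G)⁻¹ (ha.toLp a)) (kerMeasure q) :=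
    ((continuous_leftReg _).comp (continuous_subtype_val.inv)).integrable_of_hasCompactSupport
      (HasCompactSupport.of_compactSpace _)
  have h1 : inner ℂ ξ (hq.compL2 (ha'.toLp _)) = 0 := by
    rw [compL2_eq, ← inner_conj_symm, h0, map_zero]
  rw [← hq.integral_leftReg_toLp hac has ha ha', ← integral_inner hint] at h1
  have h2 : ∀ k : q.ker, inner ℂ ξ (leftReg (k : G)⁻¹ (ha.toLp a)) = inner ℂ ξ (ha.toLp a) := by
    intro k
    rw [← inner_leftReg_left, hfix]
  simp only [h2, integral_const, probReal_univ, one_smul] at h1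
  rw [← inner_conj_symm, h1, map_zero]

/-- The adjoint of the embedding of `L²(Q)` in `L²(G)`. -/
def pushL2 (hq : IsCompactQuotient q) : L2 G →L[ℂ] L2 Q :=
  ContinuousLinearMap.adjoint hq.pullL2.toContinuousLinearMap

theorem inner_pushL2_right (hq : IsCompactQuotient q) (ξ : L2 G) (η : L2 Q) :
    inner ℂ η (hq.pushL2 ξ) = inner ℂ (hq.pullL2 η) ξ :=
  ContinuousLinearMap.adjoint_inner_right _ _ _

theorem pushL2_pullL2 (hq : IsCompactQuotient q) (η : L2 Q) : hq.pushL2 (hq.pullL2 η) = η := by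
  refine ext_inner_left ℂ fun ζ => ?_
  rw [inner_pushL2_right, hq.pullL2.inner_map_map]

theorem norm_pushL2_le (hq : IsCompactQuotient q) (ξ : L2 G) : ‖hq.pushL2 ξ‖ ≤ ‖ξ‖ := by
  have h1 : ‖hq.pushL2‖ ≤ 1 := by
    rw [pushL2, LinearIsometryEquiv.norm_map]
    exact hq.pullL2.norm_toContinuousLinearMap_le
  exact (hq.pushL2.le_of_opNorm_le h1 ξ).trans_eq (one_mul _)

theorem leftReg_pushL2 (hq : IsCompactQuotient q) (g : G) (ξ : L2 G) :
    leftReg (q g) (hq.pushL2 ξ) = hq.pushL2 (leftReg g ξ) := by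
  refine ext_inner_left ℂ fun η => ?_
  rw [inner_pushL2_right, ← inv_inv (q g), ← inner_leftReg_left, inner_pushL2_right, ← map_inv,
    ← leftReg_pullL2, inner_leftReg_left, inv_inv]

/-- The range of the embedding consists of the vectors fixed by the kernel. -/
theorem pullL2_pushL2_of_fixed (hq : IsCompactQuotient q) {ξ : L2 G}
    (hfix : ∀ k : q.ker, leftReg (k : G) ξ = ξ) : hq.pullL2 (hq.pushL2 ξ) = ξ := by
  rw [← sub_eq_zero]
  refine hq.eq_zero_of_fixed (fun k => ?_) fun η => ?_
  · rw [map_sub, leftReg_ker_pullL2, hfix]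
  · rw [inner_sub_right, hq.pullL2.inner_map_map, inner_pushL2_right, sub_self]

/-- The projection onto the vectors fixed by the kernel is the average of the translations. -/
theorem pullL2_pushL2 [CompactSpace q.ker] (hq : IsCompactQuotient q) (ξ : L2 G) :
    hq.pullL2 (hq.pushL2 ξ) = ∫ k : q.ker, leftReg (k : G) ξ ∂kerMeasure q := by
  have hfix : ∀ k' : q.ker, leftReg (k' : G) (∫ k : q.ker, leftReg (k : G) ξ ∂kerMeasure q) =
      ∫ k : q.ker, leftReg (k : G) ξ ∂kerMeasure q := by
    intro k'
    rw [← ContinuousLinearMap.integral_comp_comm _ (integrable_leftReg_ker ξ)]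
    have h := integral_mul_left_eq_self (μ := kerMeasure q)
      (fun k : q.ker => leftReg (k : G) ξ) k'
    rw [← h]
    simp only [Subgroup.coe_mul, leftReg_mul_apply]
  rw [← hq.pullL2_pushL2_of_fixed hfix]
  congr 1
  refine ext_inner_left ℂ fun η => ?_
  rw [inner_pushL2_right, inner_pushL2_right, ← integral_inner (integrable_leftReg_ker ξ)]
  have h : ∀ k : q.ker, inner ℂ (hq.pullL2 η) (leftReg (k : G) ξ) = inner ℂ (hq.pullL2 η) ξ := by
    intro k
    rw [← inv_inv (k : G), ← inner_leftReg_left]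
    have := hq.leftReg_ker_pullL2 k⁻¹ η
    rw [Subgroup.coe_inv] at this
    rw [this]
  simp [h]

end IsCompactQuotient
end PullL2

/-! ### Averaging a multiplier over the kernel -/

section PushMultiplier

theorem integral_mem_closure_convexHull {X : Type*} [TopologicalSpace X] [CompactSpace X]
    [MeasurableSpace X] [OpensMeasurableSpace X] (μ : Measure X) [IsProbabilityMeasure μ]
    {ι : Type*} [Fintype ι] {f : ι → X → ℂ} (hf : ∀ i, Continuous (f i)) :
    (fun i => ∫ x, f i x ∂μ) ∈ closure (convexHull ℝ (Set.range fun x i => f i x)) := by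
  have hint : ∀ i, Integrable (f i) μ := fun i =>
    (hf i).integrable_of_hasCompactSupport (HasCompactSupport.of_compactSpace _)
  have hint' : Integrable (fun x i => f i x) μ := Integrable.of_eval hint
  have h := (convex_convexHull ℝ (Set.range fun x i => f i x)).closure.integral_mem (μ := μ)
    isClosed_closure
    (ae_of_all _ fun x => subset_closure (subset_convexHull _ _ (Set.mem_range_self x))) hint'
  convert h using 1
  ext i
  exact (eval_integral hint i).symm

variable {G : Type*} [Group G] [TopologicalSpace G] [IsTopologicalGroup G]
  [LocallyCompactSpace G] [MeasurableSpace G] [BorelSpace G]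
  {Q : Type*} [Group Q] [TopologicalSpace Q] [IsTopologicalGroup Q]
  [LocallyCompactSpace Q] [MeasurableSpace Q] [BorelSpace Q] {q : G →* Q}

namespace IsCompactQuotient

/-- An operator commuting with the translations by the kernel preserves their fixed vectors, which
form the range of the embedding. -/
theorem apply_pullL2_of_commute (hq : IsCompactQuotient q) {T : L2 G →L[ℂ] L2 G}
    (hT : ∀ g, Commute (leftReg g) T) (ξ : L2 Q) :
    hq.pullL2 (hq.pushL2 (T (hq.pullL2 ξ))) = T (hq.pullL2 ξ) := by
  refine hq.pullL2_pushL2_of_fixed fun k => ?_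
  have h := congrArg (fun S => S (hq.pullL2 ξ)) (hT k).eq
  change leftReg (k : G) (T (hq.pullL2 ξ)) = T (leftReg (k : G) (hq.pullL2 ξ)) at h
  rw [h, leftReg_ker_pullL2]

theorem pushL2_apply_of_commute (hq : IsCompactQuotient q) {T : L2 G →L[ℂ] L2 G}
    (hT : ∀ g, Commute (leftReg g) T) (ξ : L2 G) :
    hq.pushL2 (T (hq.pullL2 (hq.pushL2 ξ))) = hq.pushL2 (T ξ) := by
  have hT' : ∀ g, Commute (leftReg g) (ContinuousLinearMap.adjoint T) := by
    intro g
    have h := (hT g⁻¹).star_star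
    rwa [star_leftReg, inv_inv] at h
  refine ext_inner_left ℂ fun η => ?_
  rw [inner_pushL2_right, inner_pushL2_right, ← ContinuousLinearMap.adjoint_inner_left,
    ← ContinuousLinearMap.adjoint_inner_left, ← hq.apply_pullL2_of_commute hT',
    hq.pullL2.inner_map_map, inner_pushL2_right]

/-- The embedding `y ↦ J y J*` of `L(Q)` in `L(G)`. -/
def pullVN (hq : IsCompactQuotient q) :
    (groupVN Q).toStarSubalgebra →ₗ[ℂ] (groupVN G).toStarSubalgebra where
  toFun y := ⟨hq.pullL2.toContinuousLinearMap ∘L (y : L2 Q →L[ℂ] L2 Q) ∘L hq.pushL2, by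
    refine mem_groupVN_iff.2 fun T hT => ?_
    have hS : ∀ h, Commute (leftReg h) (hq.pushL2 ∘L T ∘L hq.pullL2.toContinuousLinearMap) := by
      intro h
      obtain ⟨g, rfl⟩ := hq.surjective h
      ext1 ξ
      have h1 := congrArg (fun S => S (hq.pullL2 ξ)) (hT g).eq
      change leftReg g (T (hq.pullL2 ξ)) = T (leftReg g (hq.pullL2 ξ)) at h1
      change leftReg (q g) (hq.pushL2 (T (hq.pullL2 ξ))) =
        hq.pushL2 (T (hq.pullL2 (leftReg (q g) ξ)))
      rw [leftReg_pushL2, h1, leftReg_pullL2]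
    have hy := mem_groupVN_iff.1 y.2 _ hS
    ext1 ξ
    have h1 := congrArg (fun S => S (hq.pushL2 ξ)) hy.eq
    change (y : L2 Q →L[ℂ] L2 Q) (hq.pushL2 (T (hq.pullL2 (hq.pushL2 ξ)))) =
      hq.pushL2 (T (hq.pullL2 ((y : L2 Q →L[ℂ] L2 Q) (hq.pushL2 ξ)))) at h1
    change hq.pullL2 ((y : L2 Q →L[ℂ] L2 Q) (hq.pushL2 (T ξ))) =
      T (hq.pullL2 ((y : L2 Q →L[ℂ] L2 Q) (hq.pushL2 ξ)))
    rw [← hq.apply_pullL2_of_commute hT, ← h1, hq.pushL2_apply_of_commute hT]⟩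
  map_add' x y := by
    apply Subtype.ext
    ext1 ξ
    exact map_add hq.pullL2 _ _
  map_smul' r x := by
    apply Subtype.ext
    ext1 ξ
    exact map_smul hq.pullL2 r _

theorem pullVN_apply (hq : IsCompactQuotient q) (y : (groupVN Q).toStarSubalgebra) (ξ : L2 G) :
    (hq.pullVN y : L2 G →L[ℂ] L2 G) ξ = hq.pullL2 ((y : L2 Q →L[ℂ] L2 Q) (hq.pushL2 ξ)) := rfl

/-- The compression `z ↦ J* z J` from `L(G)` to `L(Q)`. -/
def pushVN (hq : IsCompactQuotient q) :
    (groupVN G).toStarSubalgebra →ₗ[ℂ] (groupVN Q).toStarSubalgebra where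
  toFun z := ⟨hq.pushL2 ∘L (z : L2 G →L[ℂ] L2 G) ∘L hq.pullL2.toContinuousLinearMap, by
    refine mem_groupVN_iff.2 fun S hS => ?_
    have hT : ∀ g, Commute (leftReg g) (hq.pullL2.toContinuousLinearMap ∘L S ∘L hq.pushL2) := by
      intro g
      ext1 ξ
      have h1 := congrArg (fun S => S (hq.pushL2 ξ)) (hS (q g)).eq
      change leftReg (q g) (S (hq.pushL2 ξ)) = S (leftReg (q g) (hq.pushL2 ξ)) at h1
      change leftReg g (hq.pullL2 (S (hq.pushL2 ξ))) = hq.pullL2 (S (hq.pushL2 (leftReg g ξ)))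
      rw [leftReg_pullL2, h1, leftReg_pushL2]
    have hz := mem_groupVN_iff.1 z.2 _ hT
    ext1 ξ
    have h1 := congrArg (fun S => hq.pushL2 (S (hq.pullL2 ξ))) hz.eq
    change hq.pushL2 ((z : L2 G →L[ℂ] L2 G) (hq.pullL2 (S (hq.pushL2 (hq.pullL2 ξ))))) =
      hq.pushL2 (hq.pullL2 (S (hq.pushL2 ((z : L2 G →L[ℂ] L2 G) (hq.pullL2 ξ))))) at h1
    rw [pushL2_pullL2, pushL2_pullL2] at h1
    exact h1⟩
  map_add' x y := by
    apply Subtype.ext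
    ext1 ξ
    exact map_add hq.pushL2 _ _
  map_smul' r x := by
    apply Subtype.ext
    ext1 ξ
    exact map_smul hq.pushL2 r _

theorem pushVN_apply (hq : IsCompactQuotient q) (z : (groupVN G).toStarSubalgebra) (ξ : L2 Q) :
    (hq.pushVN z : L2 Q →L[ℂ] L2 Q) ξ = hq.pushL2 ((z : L2 G →L[ℂ] L2 G) (hq.pullL2 ξ)) := rfl

theorem inner_pullVN (hq : IsCompactQuotient q) (y : (groupVN Q).toStarSubalgebra) (ξ η : L2 G) :
    inner ℂ η ((hq.pullVN y : L2 G →L[ℂ] L2 G) ξ) =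
      inner ℂ (hq.pushL2 η) ((y : L2 Q →L[ℂ] L2 Q) (hq.pushL2 ξ)) := by
  rw [pullVN_apply, ← inner_conj_symm, ← inner_pushL2_right, inner_conj_symm]

theorem inner_pushVN (hq : IsCompactQuotient q) (z : (groupVN G).toStarSubalgebra) (ξ η : L2 Q) :
    inner ℂ η ((hq.pushVN z : L2 Q →L[ℂ] L2 Q) ξ) =
      inner ℂ (hq.pullL2 η) ((z : L2 G →L[ℂ] L2 G) (hq.pullL2 ξ)) := by
  rw [pushVN_apply, inner_pushL2_right]

theorem norm_pullVN_le (hq : IsCompactQuotient q) (y : (groupVN Q).toStarSubalgebra) :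
    ‖(hq.pullVN y : L2 G →L[ℂ] L2 G)‖ ≤ ‖(y : L2 Q →L[ℂ] L2 Q)‖ := by
  refine ContinuousLinearMap.opNorm_le_bound _ (norm_nonneg _) fun ξ => ?_
  rw [pullVN_apply, LinearIsometry.norm_map]
  refine (ContinuousLinearMap.le_opNorm _ _).trans ?_
  exact mul_le_mul_of_nonneg_left (hq.norm_pushL2_le ξ) (norm_nonneg _)

theorem tupleNorm_pushL2_le (hq : IsCompactQuotient q) {ι : Type*} [Fintype ι] (ξ : ι → L2 G) :
    tupleNorm (fun i => hq.pushL2 (ξ i)) ≤ tupleNorm ξ :=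
  Real.sqrt_le_sqrt (Finset.sum_le_sum fun i _ =>
    pow_le_pow_left₀ (norm_nonneg _) (hq.norm_pushL2_le (ξ i)) 2)

theorem tupleNorm_pullL2 (hq : IsCompactQuotient q) {ι : Type*} [Fintype ι] (ξ : ι → L2 Q) :
    tupleNorm (fun i => hq.pullL2 (ξ i)) = tupleNorm ξ := by
  simp only [tupleNorm, LinearIsometry.norm_map]

theorem cbBound_compress (hq : IsCompactQuotient q)
    {M : (groupVN G).toStarSubalgebra →ₗ[ℂ] (groupVN G).toStarSubalgebra} {C : ℝ} (hC : 0 ≤ C)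
    (hM : CBBound (groupVN G) M C) :
    CBBound (groupVN Q) (hq.pushVN ∘ₗ M ∘ₗ hq.pullVN) C := by
  refine cbBound_of_matrixForm_le hC fun n X K hK hX η ξ => ?_
  have h := hM.matrixForm_le hC (fun i j => hq.pullVN (X i j)) hK (fun η ξ => ?_)
    (fun i => hq.pullL2 (η i)) (fun i => hq.pullL2 (ξ i))
  · rw [tupleNorm_pullL2, tupleNorm_pullL2] at h
    refine le_of_eq_of_le ?_ h
    simp only [matrixForm, LinearMap.comp_apply, inner_pushVN]
  · have h := hX (fun i => hq.pushL2 (η i)) (fun i => hq.pushL2 (ξ i))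
    refine (le_of_eq_of_le ?_ h).trans ?_
    · simp only [matrixForm, inner_pullVN]
    · exact mul_le_mul (mul_le_mul_of_nonneg_left (hq.tupleNorm_pushL2_le η) hK)
        (hq.tupleNorm_pushL2_le ξ) (tupleNorm_nonneg _) (mul_nonneg hK (tupleNorm_nonneg _))

theorem isNormalMap_compress (hq : IsCompactQuotient q)
    {M : (groupVN G).toStarSubalgebra →ₗ[ℂ] (groupVN G).toStarSubalgebra}
    (hM : IsNormalMap (groupVN G) M) :
    IsNormalMap (groupVN Q) (hq.pushVN ∘ₗ M ∘ₗ hq.pullVN) := by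
  refine isNormalMap_of_ballNormal fun ξ η => ?_
  have h := (hM.ballNormal (hq.pullL2 ξ) (hq.pullL2 η)).comp (A := groupVN Q) (Φ := hq.pullVN)
    (fun ζ θ => ?_) (fun T hT => (hq.norm_pullVN_le T).trans hT)
  · simp only [LinearMap.comp_apply, inner_pushVN]
    exact h
  · simp only [inner_pullVN]
    exact ballNormal_inner _ _

/-- Normal scalar functions on `L(G)` evaluated at the image of `λ(q g)` are averages over the
kernel. -/
theorem ballNormal_apply_pullVN_lam [CompactSpace q.ker] (hq : IsCompactQuotient q)
    {f : (groupVN G).toStarSubalgebra →ₗ[ℂ] ℂ} (hf : BallNormal (groupVN G) f) (g : G)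
    (hcont : Continuous fun g => f (lam g)) :
    f (hq.pullVN (lam (q g))) = leftAvg q (fun g => f (lam g)) g := by
  classical
  have hin : ∀ ξ η : L2 G, inner ℂ η ((hq.pullVN (lam (q g)) : L2 G →L[ℂ] L2 G) ξ) =
      ∫ k : q.ker, inner ℂ η (leftReg (k * g) ξ) ∂kerMeasure q := by
    intro ξ η
    rw [pullVN_apply]
    change inner ℂ η (hq.pullL2 (leftReg (q g) (hq.pushL2 ξ))) = _
    rw [leftReg_pushL2, pullL2_pushL2, ← integral_inner (integrable_leftReg_ker _)]
    simp only [leftReg_mul_apply]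
  have hw : ∀ p : Finset (L2 G × L2 G) × ℕ, ∃ w : q.ker →₀ ℝ, IsProbWeight w ∧
      (∀ x ∈ p.1, ‖wavg w (fun k => inner ℂ x.2 (leftReg (k * g) x.1)) -
        inner ℂ x.2 ((hq.pullVN (lam (q g)) : L2 G →L[ℂ] L2 G) x.1)‖ < 1 / ((p.2 : ℝ) + 1)) ∧
      ‖wavg w (fun k => f (lam (k * g))) - leftAvg q (fun g => f (lam g)) g‖ <
        1 / ((p.2 : ℝ) + 1) := by
    intro p
    -- The extra coordinate `none` makes the same weights approximate the integral of `f` and the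
    -- matrix coefficients simultaneously.
    let F : Option p.1 → q.ker → ℂ := fun o k => match o with
      | none => f (lam (k * g))
      | some x => inner ℂ x.1.2 (leftReg (k * g) x.1.1)
    have hF : ∀ o, Continuous (F o) := by
      rintro (_ | x)
      · exact hcont.comp (by fun_prop : Continuous fun k : q.ker => (k : G) * g)
      · exact continuous_const.inner ((continuous_leftReg _).comp
          (by fun_prop : Continuous fun k : q.ker => (k : G) * g))
    obtain ⟨w, hw, h⟩ := exists_wavg_approx
      (integral_mem_closure_convexHull (kerMeasure q) hF) (ε := 1 / ((p.2 : ℝ) + 1)) (by positivity)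
    refine ⟨w, hw, fun x hx => ?_, h none⟩
    rw [hin]
    exact h (some ⟨x, hx⟩)
  choose w hw1 hw2 hw3 using hw
  have hn : Tendsto (fun p : Finset (L2 G × L2 G) × ℕ => 1 / ((p.2 : ℝ) + 1)) atTop (𝓝 0) :=
    tendsto_one_div_add_atTop_nhds_zero_nat.comp
      (by rw [← prod_atTop_atTop_eq]; exact tendsto_snd)
  -- Convex combinations of the `λ(k g)`; they stay in the unit ball and converge weakly to `J λ(q
  -- g) J⋆`, so normality of `f` applies.
  let S : Finset (L2 G × L2 G) × ℕ → (groupVN G).toStarSubalgebra := fun p =>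
    ∑ k ∈ (w p).support, ((w p k : ℝ) : ℂ) • lam ((k : G) * g)
  have hSin : ∀ p (ξ η : L2 G), inner ℂ η ((S p : L2 G →L[ℂ] L2 G) ξ) =
      wavg (w p) (fun k => inner ℂ η (leftReg (k * g) ξ)) := by
    intro p ξ η
    have h1 : (S p : L2 G →L[ℂ] L2 G) ξ =
        ∑ k ∈ (w p).support, ((w p k : ℝ) : ℂ) • leftReg (k * g) ξ := by
      have h2 : (S p : L2 G →L[ℂ] L2 G) =
          ∑ k ∈ (w p).support, ((w p k : ℝ) : ℂ) • leftReg (k * g) :=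
        map_sum (groupVN G).toStarSubalgebra.subtype _ _
      rw [h2, sum_apply]
      rfl
    rw [h1, inner_sum]
    simp only [inner_smul_right, wavg]
  have hSnorm : ∀ p, ‖(S p : L2 G →L[ℂ] L2 G)‖ ≤ 1 := by
    intro p
    have h2 : (S p : L2 G →L[ℂ] L2 G) =
        ∑ k ∈ (w p).support, ((w p k : ℝ) : ℂ) • leftReg (k * g) :=
      map_sum (groupVN G).toStarSubalgebra.subtype _ _
    rw [h2, ← (hw1 p).2]
    refine norm_sum_le_of_le _ fun k _ => ?_
    rw [norm_smul, Complex.norm_real, Real.norm_of_nonneg ((hw1 p).1 k)]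
    exact mul_le_of_le_one_right ((hw1 p).1 k) (norm_leftReg_le _)
  have ht : Tendsto S atTop (ballNhds (groupVN G) (hq.pullVN (lam (q g)))) := by
    refine tendsto_ballNhds_iff.2 ⟨fun ξ η => ?_, Eventually.of_forall hSnorm⟩
    rw [tendsto_iff_norm_sub_tendsto_zero]
    refine squeeze_zero' (Eventually.of_forall fun _ => norm_nonneg _) ?_ hn
    filter_upwards [eventually_ge_atTop (({(ξ, η)} : Finset (L2 G × L2 G)), 0)] with p hp
    rw [hSin]
    exact (hw2 p (ξ, η) (hp.1 (Finset.mem_singleton_self _))).le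
  refine tendsto_nhds_unique ((hf _ ((hq.norm_pullVN_le _).trans (norm_lam_le _))).comp ht) ?_
  rw [tendsto_iff_norm_sub_tendsto_zero]
  refine squeeze_zero (fun _ => norm_nonneg _) (fun p => ?_) hn
  have h1 : f (S p) = wavg (w p) (fun k => f (lam (k * g))) := by
    simp only [S, map_sum, map_smul, smul_eq_mul, wavg]
  rw [Function.comp_apply, h1]
  exact (hw3 p).le

/-- Averaging a completely bounded multiplier over a compact normal subgroup gives a completely
bounded multiplier of the quotient, with the same bound. -/
theorem isCBMultiplierWith_quotAvg [CompactSpace q.ker] (hq : IsCompactQuotient q) {φ : G → ℂ}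
    {C : ℝ} (hC : 0 ≤ C) (h : IsCBMultiplierWith φ C) : IsCBMultiplierWith (quotAvg q φ) C := by
  have hφ : Continuous φ := continuous_of_mem_M0A ⟨C, h⟩
  obtain ⟨M, hM, hMφ, hMC⟩ := h
  -- `M` sends the average of `λ(k g)` to that of `φ(k g) λ(k g)`, and every `λ(k g)` compresses to
  -- `λ(q g)`.
  refine ⟨hq.pushVN ∘ₗ M ∘ₗ hq.pullVN, hq.isNormalMap_compress hM, fun y => ?_,
    hq.cbBound_compress hC hMC⟩
  obtain ⟨g, rfl⟩ := hq.surjective y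
  apply Subtype.ext
  ext1 ξ
  refine ext_inner_left ℂ fun η => ?_
  rw [LinearMap.comp_apply, LinearMap.comp_apply, inner_pushVN]
  let f : (groupVN G).toStarSubalgebra →ₗ[ℂ] ℂ :=
    { toFun := fun T => inner ℂ (hq.pullL2 η) ((M T : L2 G →L[ℂ] L2 G) (hq.pullL2 ξ))
      map_add' := fun S T => by
        rw [map_add]
        exact inner_add_right _ _ _
      map_smul' := fun r T => by
        rw [map_smul]
        exact inner_smul_right _ _ _ }
  have hf : ∀ g, f (lam g) = φ g * inner ℂ η (leftReg (q g) ξ) := by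
    intro g
    change inner ℂ (hq.pullL2 η) ((M (lam g) : L2 G →L[ℂ] L2 G) (hq.pullL2 ξ)) = _
    rw [hMφ]
    change inner ℂ (hq.pullL2 η) (φ g • leftReg g (hq.pullL2 ξ)) = _
    rw [inner_smul_right, leftReg_pullL2, hq.pullL2.inner_map_map]
  have h1 := hq.ballNormal_apply_pullVN_lam (f := f) (hM.ballNormal _ _) g (by
    simp only [hf]
    exact hφ.mul (continuous_const.inner ((continuous_leftReg ξ).comp hq.continuous)))
  refine h1.trans ?_
  change _ = inner ℂ η (quotAvg q φ (q g) • leftReg (q g) ξ)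
  rw [inner_smul_right, quotAvg_apply hq, leftAvg, leftAvg, ← integral_mul_const]
  refine integral_congr_ae (ae_of_all _ fun k => ?_)
  have hk : q k = 1 := k.2
  simp only [hf, map_mul, hk, one_mul]

end IsCompactQuotient
end PushMultiplier

/-! ### Normal functionals on `L(G)` and their symbols -/

section NormalFunctional

variable {G : Type*} [Group G] [TopologicalSpace G] [IsTopologicalGroup G]
  [LocallyCompactSpace G] [MeasurableSpace G] [BorelSpace G]
  {R : Type*} [Group R] [TopologicalSpace R] [IsTopologicalGroup R]
  [LocallyCompactSpace R] [MeasurableSpace R] [BorelSpace R]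

/-- `f` is a bounded normal functional on `L(G)` with `f (λ(g)) = χ(g)`. -/
structure IsNormalWith (f : (groupVN G).toStarSubalgebra →ₗ[ℂ] ℂ) (χ : G → ℂ) : Prop where
  ballNormal : BallNormal (groupVN G) f
  bounded : ∃ B : ℝ, ∀ x : (groupVN G).toStarSubalgebra, ‖f x‖ ≤ B * ‖(x : L2 G →L[ℂ] L2 G)‖
  apply_lam : ∀ g, f (lam g) = χ g

namespace IsNormalWith

variable {f f' : (groupVN G).toStarSubalgebra →ₗ[ℂ] ℂ} {χ χ' : G → ℂ}

theorem add (h : IsNormalWith f χ) (h' : IsNormalWith f' χ') :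
    IsNormalWith (f + f') (fun g => χ g + χ' g) where
  ballNormal := fun T hT => (h.ballNormal T hT).add (h'.ballNormal T hT)
  bounded := by
    obtain ⟨B, hB⟩ := h.bounded
    obtain ⟨B', hB'⟩ := h'.bounded
    refine ⟨B + B', fun x => ?_⟩
    rw [add_mul]
    exact norm_add_le_of_le (hB x) (hB' x)
  apply_lam g := by rw [LinearMap.add_apply, h.apply_lam, h'.apply_lam]

theorem smul (r : ℂ) (h : IsNormalWith f χ) : IsNormalWith (r • f) (fun g => r * χ g) where
  ballNormal := h.ballNormal.const_mul r
  bounded := by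
    obtain ⟨B, hB⟩ := h.bounded
    refine ⟨‖r‖ * B, fun x => ?_⟩
    rw [LinearMap.smul_apply, norm_smul, mul_assoc]
    exact mul_le_mul_of_nonneg_left (hB x) (norm_nonneg r)
  apply_lam g := by rw [LinearMap.smul_apply, h.apply_lam, smul_eq_mul]

theorem sub (h : IsNormalWith f χ) (h' : IsNormalWith f' χ') :
    IsNormalWith (f - f') (fun g => χ g - χ' g) := by
  have h1 := h.add (h'.smul (-1))
  simpa [sub_eq_add_neg] using h1

theorem zero : IsNormalWith (0 : (groupVN G).toStarSubalgebra →ₗ[ℂ] ℂ) (fun _ => 0) where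
  ballNormal := fun _ _ => tendsto_const_nhds
  bounded := ⟨0, fun x => by simp⟩
  apply_lam _ := rfl

theorem sum {ι : Type*} (s : Finset ι) {F : ι → (groupVN G).toStarSubalgebra →ₗ[ℂ] ℂ}
    {X : ι → G → ℂ} (h : ∀ i ∈ s, IsNormalWith (F i) (X i)) :
    IsNormalWith (∑ i ∈ s, F i) (fun g => ∑ i ∈ s, X i g) := by
  classical
  induction s using Finset.induction_on with
  | empty => simpa using zero
  | insert a s ha ih =>
    simp only [Finset.sum_insert ha]
    exact (h a (Finset.mem_insert_self a s)).add
      (ih fun i hi => h i (Finset.mem_insert_of_mem hi))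

/-- The main tool for identities between functionals in what follows: a comparison of symbols is
enough. -/
theorem unique (h : IsNormalWith f χ) (h' : IsNormalWith f' χ') (he : ∀ g, χ g = χ' g) :
    f = f' := by
  have h1 := h.sub h'
  obtain ⟨B, hB⟩ := h1.bounded
  rw [← sub_eq_zero]
  exact eq_zero_of_ballNormal h1.ballNormal hB fun g => by rw [h1.apply_lam, he, sub_self]

end IsNormalWith

/-- A bounded family of normal functionals on `L(G)` whose symbols are coefficients of multiples of
`λ(π(g))` defines a linear map `L(G) → L(R)`. -/
theorem exists_linearMap_of_isNormalWith {χ : G → ℂ} {π : G → R} {B : ℝ}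
    {f : L2 R → L2 R → (groupVN G).toStarSubalgebra →ₗ[ℂ] ℂ}
    (hf : ∀ d c, IsNormalWith (f d c) (fun g => χ g * inner ℂ d (leftReg (π g) c)))
    (hB : ∀ d c x, ‖f d c x‖ ≤ B * ‖(x : L2 G →L[ℂ] L2 G)‖ * ‖d‖ * ‖c‖) :
    ∃ Φ : (groupVN G).toStarSubalgebra →ₗ[ℂ] (groupVN R).toStarSubalgebra,
      ∀ x d c, inner ℂ d ((Φ x : L2 R →L[ℂ] L2 R) c) = f d c x := by
  -- Nothing is assumed about the dependence of `f` on the vectors; sesquilinearity is forced by the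
  -- symbols, and the Riesz representation then yields the operators.
  have hadd : ∀ d c c', f d (c + c') = f d c + f d c' := fun d c c' =>
    (hf d (c + c')).unique ((hf d c).add (hf d c')) fun g => by
      rw [map_add, inner_add_right, mul_add]
  have hsmul : ∀ d (r : ℂ) c, f d (r • c) = r • f d c := fun d r c =>
    (hf d (r • c)).unique ((hf d c).smul r) fun g => by
      rw [map_smul, inner_smul_right]
      ring
  have hadd' : ∀ d d' c, f (d + d') c = f d c + f d' c := fun d d' c =>
    (hf (d + d') c).unique ((hf d c).add (hf d' c)) fun g => by
      rw [inner_add_left, mul_add]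
  have hsmul' : ∀ (r : ℂ) d c, f (r • d) c = starRingEnd ℂ r • f d c := fun r d c =>
    (hf (r • d) c).unique ((hf d c).smul _) fun g => by
      rw [inner_smul_left]
      ring
  have hop : ∀ x, ∃ T : L2 R →L[ℂ] L2 R, ∀ d c, inner ℂ d (T c) = f d c x := by
    intro x
    let S : L2 R →L⋆[ℂ] L2 R →L[ℂ] ℂ := LinearMap.mkContinuous₂
      (LinearMap.mk₂'ₛₗ (starRingEnd ℂ) (RingHom.id ℂ) (fun d c => f d c x)
        (fun d d' c => by rw [hadd']; rfl) (fun r d c => by rw [hsmul']; rfl)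
        (fun d c c' => by rw [hadd]; rfl) (fun r d c => by rw [hsmul]; rfl))
      (B * ‖(x : L2 G →L[ℂ] L2 G)‖) (fun d c => hB d c x)
    refine ⟨ContinuousLinearMap.adjoint (InnerProductSpace.continuousLinearMapOfBilin S),
      fun d c => ?_⟩
    rw [ContinuousLinearMap.adjoint_inner_right,
      InnerProductSpace.continuousLinearMapOfBilin_apply]
    rfl
  choose T hT using hop
  have hmem : ∀ x, T x ∈ (groupVN R).toStarSubalgebra := by
    intro x
    refine mem_groupVN_iff.2 fun A hA => ?_
    -- An operator commuting with `λ(R)` can be moved across the form, again by comparing symbols;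
    -- so `T x` lies in the double commutant.
    have hA' : ∀ d c, f d (A c) = f (ContinuousLinearMap.adjoint A d) c := fun d c =>
      (hf d (A c)).unique (hf (ContinuousLinearMap.adjoint A d) c) fun g => by
        rw [ContinuousLinearMap.adjoint_inner_left]
        congr 2
        exact congrArg (fun S => S c) (hA (π g)).eq
    ext1 c
    refine ext_inner_left ℂ fun d => ?_
    change inner ℂ d (T x (A c)) = inner ℂ d (A (T x c))
    rw [hT, hA', ← hT, ContinuousLinearMap.adjoint_inner_left]
  refine ⟨{ toFun := fun x => ⟨T x, hmem x⟩, map_add' := fun x y => ?_, map_smul' := fun r x => ?_ },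
    fun x d c => hT x d c⟩
  · apply Subtype.ext
    ext1 c
    refine ext_inner_left ℂ fun d => ?_
    change inner ℂ d (T (x + y) c) = inner ℂ d (T x c + T y c)
    rw [inner_add_right, hT, hT, hT, map_add]
  · apply Subtype.ext
    ext1 c
    refine ext_inner_left ℂ fun d => ?_
    change inner ℂ d (T (r • x) c) = inner ℂ d (r • T x c)
    rw [inner_smul_right, hT, hT, map_smul, smul_eq_mul]

/-- A criterion for completely bounded multipliers in terms of normal functionals. -/
theorem isCBMultiplierWith_of_isNormalWith {φ : G → ℂ} {C : ℝ} (hC : 0 ≤ C)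
    {f : L2 G → L2 G → (groupVN G).toStarSubalgebra →ₗ[ℂ] ℂ}
    (hf : ∀ b a, IsNormalWith (f b a) (fun g => φ g * inner ℂ b (leftReg g a)))
    (hcb : ∀ (n : ℕ) (X : Fin n → Fin n → (groupVN G).toStarSubalgebra) (K : ℝ), 0 ≤ K →
      (∀ η ξ : Fin n → L2 G, ‖matrixForm (fun i j => (X i j : L2 G →L[ℂ] L2 G)) η ξ‖ ≤
        K * tupleNorm η * tupleNorm ξ) → ∀ b a : Fin n → L2 G,
      ‖∑ i, ∑ j, f (b i) (a j) (X i j)‖ ≤ C * K * tupleNorm b * tupleNorm a) :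
    IsCBMultiplierWith φ C := by
  have hB : ∀ b a x, ‖f b a x‖ ≤ C * ‖(x : L2 G →L[ℂ] L2 G)‖ * ‖b‖ * ‖a‖ := by
    intro b a x
    have h := hcb 1 (fun _ _ => x) ‖(x : L2 G →L[ℂ] L2 G)‖ (norm_nonneg _) (fun η ξ => ?_)
      (fun _ => b) (fun _ => a)
    · simpa [tupleNorm, Real.sqrt_sq (norm_nonneg _)] using h
    · simp only [matrixForm, tupleNorm, Finset.univ_unique, Finset.sum_singleton,
        Real.sqrt_sq (norm_nonneg _)]
      refine (norm_inner_le_norm _ _).trans ?_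
      rw [mul_comm _ ‖η _‖, mul_assoc]
      exact mul_le_mul_of_nonneg_left (ContinuousLinearMap.le_opNorm _ _) (norm_nonneg _)
  obtain ⟨M, hM⟩ := exists_linearMap_of_isNormalWith (π := id) hf hB
  refine ⟨M, isNormalMap_of_ballNormal fun ξ η => ?_, fun g => ?_, ?_⟩
  · simp only [hM]
    exact (hf η ξ).ballNormal
  · apply Subtype.ext
    ext1 ξ
    refine ext_inner_left ℂ fun η => ?_
    rw [hM, (hf η ξ).apply_lam]
    exact (inner_smul_right _ _ _).symm
  · refine cbBound_of_matrixForm_le hC fun n X K hK hX η ξ => ?_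
    simp only [matrixForm, hM]
    exact hcb n X K hK hX η ξ

end NormalFunctional

/-! ### Vector valued `L²` functions as a Hilbert space tensor product -/

section VectorValued

variable {X : Type*} [MeasurableSpace X] {μ : Measure X}
  {E : Type*} [NormedAddCommGroup E] [InnerProductSpace ℂ E] [CompleteSpace E]

/-- The elementary tensor `a ⊗ c`, as a vector valued function. -/
def elemTensor (a : Lp ℂ 2 μ) (c : E) : Lp E 2 μ :=
  ((1 : ℂ →L[ℂ] ℂ).smulRight c).compLpL 2 μ a

theorem elemTensor_coeFn (a : Lp ℂ 2 μ) (c : E) : elemTensor a c =ᵐ[μ] fun s => a s • c := by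
  filter_upwards [ContinuousLinearMap.coeFn_compLpL ((1 : ℂ →L[ℂ] ℂ).smulRight c) a] with s hs
  rw [elemTensor, hs]
  rfl

theorem norm_elemTensor_le (a : Lp ℂ 2 μ) (c : E) : ‖elemTensor a c‖ ≤ ‖c‖ * ‖a‖ := by
  refine (ContinuousLinearMap.le_opNorm _ _).trans ?_
  refine mul_le_mul_of_nonneg_right ((ContinuousLinearMap.norm_compLpL_le _).trans ?_) (norm_nonneg _)
  rw [ContinuousLinearMap.norm_smulRight_apply]
  exact mul_le_of_le_one_left (norm_nonneg _) ContinuousLinearMap.norm_id_le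

theorem elemTensor_sub_right (a : Lp ℂ 2 μ) (c c' : E) :
    elemTensor a (c - c') = elemTensor a c - elemTensor a c' := by
  apply Lp.ext
  filter_upwards [elemTensor_coeFn a (c - c'), elemTensor_coeFn a c, elemTensor_coeFn a c',
    Lp.coeFn_sub (elemTensor a c) (elemTensor a c')] with s h1 h2 h3 h4
  rw [h1, h4, Pi.sub_apply, h2, h3, smul_sub]

theorem elemTensor_smul (r : ℂ) (a : Lp ℂ 2 μ) (c : E) :
    elemTensor (r • a) c = elemTensor a (r • c) := by
  apply Lp.ext
  filter_upwards [elemTensor_coeFn (r • a) c, elemTensor_coeFn a (r • c),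
    Lp.coeFn_smul r a] with s h1 h2 h3
  rw [h1, h2, h3, Pi.smul_apply, smul_eq_mul, mul_comm, mul_smul]

theorem inner_elemTensor (a b : Lp ℂ 2 μ) (c d : E) :
    inner ℂ (elemTensor a c) (elemTensor b d) = inner ℂ a b * inner ℂ c d := by
  rw [L2.inner_def, L2.inner_def, ← integral_mul_const]
  refine integral_congr_ae ?_
  filter_upwards [elemTensor_coeFn a c, elemTensor_coeFn b d] with s h1 h2
  rw [h1, h2, inner_smul_left, inner_smul_right, RCLike.inner_apply]
  ring

/-- Elementary tensors span a dense subspace. -/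
theorem mem_closure_span_elemTensor (τ : Lp E 2 μ) :
    τ ∈ (Submodule.span ℂ {x : Lp E 2 μ | ∃ a c, x = elemTensor a c}).topologicalClosure := by
  refine Lp.induction (by simp) (motive := fun τ => τ ∈ (Submodule.span ℂ
    {x : Lp E 2 μ | ∃ a c, x = elemTensor a c}).topologicalClosure) ?_ ?_ ?_ τ
  · intro c s hs hμs
    refine Submodule.le_topologicalClosure _ (Submodule.subset_span
      ⟨indicatorConstLp 2 hs hμs.ne (1 : ℂ), c, ?_⟩)
    rw [Lp.simpleFunc.coe_indicatorConst]
    apply Lp.ext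
    filter_upwards [elemTensor_coeFn (indicatorConstLp 2 hs hμs.ne (1 : ℂ)) c,
      indicatorConstLp_coeFn (p := 2) (hs := hs) (hμs := hμs.ne) (c := c),
      indicatorConstLp_coeFn (p := 2) (hs := hs) (hμs := hμs.ne) (c := (1 : ℂ))] with x h1 h2 h3
    rw [h1, h2, h3]
    by_cases hx : x ∈ s <;> simp [hx]
  · intro f g hf hg _ h1 h2
    exact add_mem h1 h2
  · exact Submodule.isClosed_topologicalClosure _

/-- The coordinate function of a vector valued function. -/
def coordL2 (f : E) : Lp E 2 μ →L[ℂ] Lp ℂ 2 μ := (innerSL ℂ f).compLpL 2 μ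

theorem coordL2_coeFn (f : E) (τ : Lp E 2 μ) : coordL2 f τ =ᵐ[μ] fun s => inner ℂ f (τ s) :=
  ContinuousLinearMap.coeFn_compLpL (innerSL ℂ f) τ

variable {κ : Type*} (b : HilbertBasis κ ℂ E)

/-- The pointwise projection onto the span of finitely many basis vectors. -/
def projBasis (F : Finset κ) : E →L[ℂ] E := ∑ k ∈ F, (innerSL ℂ (b k)).smulRight (b k)

theorem projBasis_apply (F : Finset κ) (c : E) :
    projBasis b F c = ∑ k ∈ F, inner ℂ (b k) c • b k := by
  rw [projBasis, sum_apply]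
  rfl

theorem tendsto_projBasis (c : E) : Tendsto (fun F => projBasis b F c) atTop (𝓝 c) := by
  simp only [projBasis_apply]
  have h := b.hasSum_repr c
  simp only [HilbertBasis.repr_apply_apply] at h
  exact h

theorem norm_projBasis_le (F : Finset κ) : ‖projBasis b F‖ ≤ 1 := by
  classical
  refine ContinuousLinearMap.opNorm_le_bound _ zero_le_one fun c => ?_
  rw [one_mul, projBasis_apply, ← sq_le_sq₀ (norm_nonneg _) (norm_nonneg _)]
  have h1 := b.orthonormal.inner_sum (fun k => inner ℂ (b k) c) (fun k => inner ℂ (b k) c) F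
  rw [inner_self_eq_norm_sq_to_K] at h1
  have h2 : ‖∑ k ∈ F, inner ℂ (b k) c • b k‖ ^ 2 = ∑ k ∈ F, ‖inner ℂ (b k) c‖ ^ 2 := by
    have h3 : ∀ k, starRingEnd ℂ (inner ℂ (b k) c) * inner ℂ (b k) c =
        ((‖inner ℂ (b k) c‖ ^ 2 : ℝ) : ℂ) := fun k => by
      rw [RCLike.conj_mul]
      norm_cast
    simp only [h3] at h1
    apply Complex.ofReal_injective
    push_cast at h1 ⊢
    exact h1
  rw [h2]
  exact b.orthonormal.sum_inner_products_le c

theorem projBasis_compLpL_elemTensor (F : Finset κ) (a : Lp ℂ 2 μ) (c : E) :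
    (projBasis b F).compLpL 2 μ (elemTensor a c) = elemTensor a (projBasis b F c) := by
  apply Lp.ext
  filter_upwards [ContinuousLinearMap.coeFn_compLpL (projBasis b F) (elemTensor a c),
    elemTensor_coeFn a c, elemTensor_coeFn a (projBasis b F c)] with s h1 h2 h3
  rw [h1, h2, h3, map_smul]

theorem norm_projBasis_compLpL_le (F : Finset κ) (τ : Lp E 2 μ) :
    ‖(projBasis b F).compLpL 2 μ τ‖ ≤ ‖τ‖ := by
  refine (ContinuousLinearMap.le_of_opNorm_le _
    ((ContinuousLinearMap.norm_compLpL_le _).trans (norm_projBasis_le b F)) τ).trans_eq (one_mul _)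

theorem tendsto_projBasis_compLpL (τ : Lp E 2 μ) :
    Tendsto (fun F => (projBasis b F).compLpL 2 μ τ) atTop (𝓝 τ) := by
  have hspan : ∀ τ ∈ Submodule.span ℂ {x : Lp E 2 μ | ∃ a c, x = elemTensor a c},
      Tendsto (fun F => (projBasis b F).compLpL 2 μ τ) atTop (𝓝 τ) := by
    intro τ hτ
    refine Submodule.span_induction (p := fun τ _ =>
      Tendsto (fun F => (projBasis b F).compLpL 2 μ τ) atTop (𝓝 τ)) ?_ ?_ ?_ ?_ hτ
    · rintro _ ⟨a, c, rfl⟩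
      simp only [projBasis_compLpL_elemTensor]
      rw [tendsto_iff_norm_sub_tendsto_zero]
      have h1 := (tendsto_iff_norm_sub_tendsto_zero.1 (tendsto_projBasis b c)).mul_const ‖a‖
      rw [zero_mul] at h1
      refine squeeze_zero (fun _ => norm_nonneg _) (fun F => ?_) h1
      rw [← elemTensor_sub_right]
      exact norm_elemTensor_le _ _
    · simp
    · intro x y _ _ hx hy
      simp only [map_add]
      exact hx.add hy
    · intro r x _ hx
      simp only [map_smul]
      exact hx.const_smul r
  rw [Metric.tendsto_nhds]
  intro ε hε
  obtain ⟨σ, hσ, hτσ⟩ := Metric.mem_closure_iff.1 (mem_closure_span_elemTensor τ) (ε / 3)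
    (by positivity)
  filter_upwards [Metric.tendsto_nhds.1 (hspan σ hσ) (ε / 3) (by positivity)] with F hF
  have h1 := norm_projBasis_compLpL_le b F (τ - σ)
  rw [map_sub, ← dist_eq_norm, ← dist_eq_norm] at h1
  have h2 := dist_triangle4 ((projBasis b F).compLpL 2 μ τ) ((projBasis b F).compLpL 2 μ σ) σ τ
  rw [dist_comm σ τ] at h2
  linarith

theorem sum_inner_coordL2 (F : Finset κ) (σ τ : Lp E 2 μ) :
    ∑ k ∈ F, inner ℂ (coordL2 (b k) σ) (coordL2 (b k) τ) =
      inner ℂ σ ((projBasis b F).compLpL 2 μ τ) := by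
  simp only [L2.inner_def]
  rw [← integral_finsetSum _ fun k _ => L2.integrable_inner _ _]
  refine integral_congr_ae ?_
  have h1 : ∀ᵐ s ∂μ, ∀ k ∈ F, (coordL2 (b k) σ : X → ℂ) s = inner ℂ (b k) (σ s) ∧
      (coordL2 (b k) τ : X → ℂ) s = inner ℂ (b k) (τ s) := by
    refine (ae_ball_iff F.countable_toSet).2 fun k _ => ?_
    exact (coordL2_coeFn (b k) σ).and (coordL2_coeFn (b k) τ)
  filter_upwards [h1, ContinuousLinearMap.coeFn_compLpL (projBasis b F) τ] with s h2 h3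
  rw [h3, projBasis_apply, inner_sum]
  refine Finset.sum_congr rfl fun k hk => ?_
  rw [(h2 k hk).1, (h2 k hk).2, inner_smul_right, RCLike.inner_apply, inner_conj_symm]

/-- The basis may be uncountable, so dominated convergence along finite subsets is replaced by the
norm convergence of the contractions `projBasis`, which is checked on elementary tensors. -/
theorem hasSum_inner_coordL2 (σ τ : Lp E 2 μ) :
    HasSum (fun k => inner ℂ (coordL2 (b k) σ) (coordL2 (b k) τ)) (inner ℂ σ τ) := by
  have h : Tendsto (fun F : Finset κ => inner ℂ σ ((projBasis b F).compLpL 2 μ τ)) atTop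
      (𝓝 (inner ℂ σ τ)) := tendsto_const_nhds.inner (tendsto_projBasis_compLpL b τ)
  simp only [← sum_inner_coordL2] at h
  exact h

theorem hasSum_norm_sq_coordL2 (τ : Lp E 2 μ) :
    HasSum (fun k => ‖coordL2 (b k) τ‖ ^ 2) (‖τ‖ ^ 2) := by
  have h := hasSum_inner_coordL2 b τ τ
  simp only [inner_self_eq_norm_sq_to_K] at h
  exact_mod_cast h

theorem sum_norm_sq_coordL2_le (F : Finset κ) (τ : Lp E 2 μ) :
    ∑ k ∈ F, ‖coordL2 (b k) τ‖ ^ 2 ≤ ‖τ‖ ^ 2 :=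
  sum_le_hasSum F (fun _ _ => by positivity) (hasSum_norm_sq_coordL2 b τ)

end VectorValued

/-! ### The ampliation `x ↦ x ⊗ 1` -/

section Ampliation

theorem norm_tsum_sub_sum_le {κ : Type*} {t : κ → ℂ} {u : κ → ℝ} (hu : Summable u)
    (h : ∀ k, ‖t k‖ ≤ u k) (F : Finset κ) : ‖∑' k, t k - ∑ k ∈ F, t k‖ ≤ ∑' k, u k - ∑ k ∈ F, u k := by
  have ht : Summable t := Summable.of_norm_bounded hu h
  have h1 := ht.sum_add_tsum_subtype_compl F
  have h2 := hu.sum_add_tsum_subtype_compl F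
  rw [← h1, ← h2, add_sub_cancel_left, add_sub_cancel_left]
  exact tsum_of_norm_bounded (hu.subtype _).hasSum fun k => h k

variable {G : Type*} [Group G] [TopologicalSpace G] [IsTopologicalGroup G]
  [LocallyCompactSpace G] [MeasurableSpace G] [BorelSpace G]
  {E : Type*} [NormedAddCommGroup E] [InnerProductSpace ℂ E] [CompleteSpace E]

/-- The translation action on vector valued functions. -/
def vecTranslate (g : G) (τ : Lp E 2 (Measure.haar : Measure G)) :
    Lp E 2 (Measure.haar : Measure G) :=
  Lp.compMeasurePreserving (fun h : G => g⁻¹ * h)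
    (measurePreserving_mul_left (Measure.haar : Measure G) g⁻¹) τ

theorem vecTranslate_coeFn (g : G) (τ : Lp E 2 (Measure.haar : Measure G)) :
    vecTranslate g τ =ᵐ[(Measure.haar : Measure G)] fun h => τ (g⁻¹ * h) :=
  Lp.coeFn_compMeasurePreserving τ (measurePreserving_mul_left (Measure.haar : Measure G) g⁻¹)

theorem coordL2_vecTranslate (f : E) (g : G) (τ : Lp E 2 (Measure.haar : Measure G)) :
    coordL2 f (vecTranslate g τ) = leftReg g (coordL2 f τ) := by
  apply Lp.ext
  filter_upwards [coordL2_coeFn f (vecTranslate g τ), vecTranslate_coeFn g τ,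
    leftReg_coeFn g (coordL2 f τ),
    (measurePreserving_mul_left (Measure.haar : Measure G) g⁻¹).quasiMeasurePreserving.ae
      (coordL2_coeFn f τ)] with s h1 h2 h3 h4
  rw [h1, h2, h3, h4]

variable {κ : Type*} (b : HilbertBasis κ ℂ E)

theorem norm_inner_coordL2_le (σ τ : Lp E 2 (Measure.haar : Measure G)) (x : L2 G →L[ℂ] L2 G)
    (k : κ) : ‖inner ℂ (coordL2 (b k) σ) (x (coordL2 (b k) τ))‖ ≤
      ‖x‖ * (‖coordL2 (b k) σ‖ ^ 2 + ‖coordL2 (b k) τ‖ ^ 2) := by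
  refine (norm_inner_le_norm _ _).trans ?_
  refine (mul_le_mul_of_nonneg_left (x.le_opNorm _) (norm_nonneg _)).trans ?_
  rw [mul_left_comm]
  refine mul_le_mul_of_nonneg_left ?_ (norm_nonneg _)
  nlinarith [sq_nonneg (‖coordL2 (b k) σ‖ - ‖coordL2 (b k) τ‖), sq_nonneg ‖coordL2 (b k) σ‖,
    sq_nonneg ‖coordL2 (b k) τ‖]

theorem summable_norm_sq_coordL2 (σ τ : Lp E 2 (Measure.haar : Measure G)) :
    Summable fun k => ‖coordL2 (b k) σ‖ ^ 2 + ‖coordL2 (b k) τ‖ ^ 2 :=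
  (hasSum_norm_sq_coordL2 b σ).summable.add (hasSum_norm_sq_coordL2 b τ).summable

theorem summable_inner_coordL2 (σ τ : Lp E 2 (Measure.haar : Measure G)) (x : L2 G →L[ℂ] L2 G) :
    Summable fun k => inner ℂ (coordL2 (b k) σ) (x (coordL2 (b k) τ)) :=
  Summable.of_norm_bounded ((summable_norm_sq_coordL2 b σ τ).mul_left ‖x‖)
    (norm_inner_coordL2_le b σ τ x)

/-- The functional `x ↦ ⟪σ, (x ⊗ 1) τ⟫` on `L(G)`. -/
def ampFunctional (σ τ : Lp E 2 (Measure.haar : Measure G)) :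
    (groupVN G).toStarSubalgebra →ₗ[ℂ] ℂ where
  toFun x := ∑' k, inner ℂ (coordL2 (b k) σ) ((x : L2 G →L[ℂ] L2 G) (coordL2 (b k) τ))
  map_add' x y := by
    rw [← (summable_inner_coordL2 b σ τ _).tsum_add (summable_inner_coordL2 b σ τ _)]
    exact tsum_congr fun k => inner_add_right _ _ _
  map_smul' r x := by
    rw [RingHom.id_apply, smul_eq_mul, ← tsum_mul_left]
    exact tsum_congr fun k => inner_smul_right _ _ _

theorem isNormalWith_ampFunctional (σ τ : Lp E 2 (Measure.haar : Measure G)) :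
    IsNormalWith (ampFunctional b σ τ) (fun g => inner ℂ σ (vecTranslate g τ)) where
  ballNormal := by
    have hu := summable_norm_sq_coordL2 b σ τ
    refine BallNormal.of_approx fun ε hε => ?_
    -- On the unit ball the remainder is dominated by the tail of a fixed summable series, so finite
    -- sums of vector functionals approximate uniformly.
    obtain ⟨F, hF⟩ := (Metric.tendsto_nhds.1 hu.hasSum ε hε).exists
    refine ⟨fun x => ∑ k ∈ F, inner ℂ (coordL2 (b k) σ)
      ((x : L2 G →L[ℂ] L2 G) (coordL2 (b k) τ)), BallNormal.sum F fun k _ => ballNormal_inner _ _,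
      fun T hT => ?_⟩
    have h1 := norm_tsum_sub_sum_le hu (t := fun k => inner ℂ (coordL2 (b k) σ)
      ((T : L2 G →L[ℂ] L2 G) (coordL2 (b k) τ))) (fun k =>
        (norm_inner_coordL2_le b σ τ (T : L2 G →L[ℂ] L2 G) k).trans
          (mul_le_of_le_one_left (by positivity) hT)) F
    rw [Real.dist_eq, abs_sub_comm] at hF
    exact h1.trans ((le_abs_self _).trans hF.le)
  bounded := by
    refine ⟨∑' k, (‖coordL2 (b k) σ‖ ^ 2 + ‖coordL2 (b k) τ‖ ^ 2), fun x => ?_⟩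
    rw [mul_comm, ← tsum_mul_left]
    exact tsum_of_norm_bounded ((summable_norm_sq_coordL2 b σ τ).mul_left _).hasSum
      (norm_inner_coordL2_le b σ τ (x : L2 G →L[ℂ] L2 G))
  apply_lam g := by
    rw [← (hasSum_inner_coordL2 b σ (vecTranslate g τ)).tsum_eq]
    refine tsum_congr fun k => ?_
    rw [coordL2_vecTranslate]
    rfl

/-- Amplification preserves bounds of matrices. -/
theorem norm_sum_ampFunctional_le {n : Type*} [Fintype n]
    {X : n → n → (groupVN G).toStarSubalgebra} {K : ℝ} (hK : 0 ≤ K)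
    (hX : ∀ η ξ : n → L2 G, ‖matrixForm (fun i j => (X i j : L2 G →L[ℂ] L2 G)) η ξ‖ ≤
      K * tupleNorm η * tupleNorm ξ) (σ τ : n → Lp E 2 (Measure.haar : Measure G)) :
    ‖∑ i, ∑ j, ampFunctional b (σ i) (τ j) (X i j)‖ ≤ K * tupleNorm σ * tupleNorm τ := by
  have ht : Tendsto (fun F : Finset κ => ∑ i, ∑ j, ∑ k ∈ F, inner ℂ (coordL2 (b k) (σ i))
      ((X i j : L2 G →L[ℂ] L2 G) (coordL2 (b k) (τ j)))) atTop
      (𝓝 (∑ i, ∑ j, ampFunctional b (σ i) (τ j) (X i j))) :=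
    tendsto_finsetSum _ fun i _ => tendsto_finsetSum _ fun j _ =>
      (summable_inner_coordL2 b (σ i) (τ j) _).hasSum
  refine le_of_tendsto ht.norm (Eventually.of_forall fun F => ?_)
  have h1 : ∑ i, ∑ j, ∑ k ∈ F, inner ℂ (coordL2 (b k) (σ i))
      ((X i j : L2 G →L[ℂ] L2 G) (coordL2 (b k) (τ j))) =
      ∑ k ∈ F, matrixForm (fun i j => (X i j : L2 G →L[ℂ] L2 G)) (fun i => coordL2 (b k) (σ i))
        (fun j => coordL2 (b k) (τ j)) := by
    simp only [matrixForm]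
    rw [Finset.sum_comm]
    simp only [Finset.sum_comm (s := Finset.univ) (t := F)]
    refine Finset.sum_congr rfl fun k _ => Finset.sum_comm
  have h2 : ∀ σ : n → Lp E 2 (Measure.haar : Measure G),
      √(∑ k ∈ F, tupleNorm (fun i => coordL2 (b k) (σ i)) ^ 2) ≤ tupleNorm σ := by
    intro σ
    refine Real.sqrt_le_sqrt ?_
    simp only [tupleNorm_sq]
    rw [Finset.sum_comm]
    exact Finset.sum_le_sum fun i _ => sum_norm_sq_coordL2_le b F (σ i)
  -- The matrix bound is applied in every basis coordinate separately; the Cauchy–Schwarz inequality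
  -- over the coordinates recombines the estimates.
  rw [h1]
  refine (norm_sum_le_of_le F fun k _ => hX _ _).trans ?_
  simp only [mul_assoc]
  rw [← Finset.mul_sum]
  refine mul_le_mul_of_nonneg_left ?_ hK
  refine (Real.sum_mul_le_sqrt_mul_sqrt F _ _).trans ?_
  exact mul_le_mul (h2 σ) (h2 τ) (Real.sqrt_nonneg _) (tupleNorm_nonneg _)

end Ampliation

open BoundedContinuousFunction

/-! ### Twisting by orbit maps: absorption of `λ ∘ q` -/

section Twist

variable {G : Type*} [Group G] [TopologicalSpace G] [IsTopologicalGroup G]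
  [LocallyCompactSpace G] [MeasurableSpace G] [BorelSpace G]
  {E : Type*} [NormedAddCommGroup E] [InnerProductSpace ℂ E] [CompleteSpace E]

/-- A continuous `u` need not be strongly measurable when `G` is large and `E` is not separable.
Here `a` is an almost everywhere limit of continuous functions of compact support, whose products
with `u` are strongly measurable. -/
theorem aestronglyMeasurable_smul_continuous (a : L2 G) {u : G → E} (hu : Continuous u) :
    AEStronglyMeasurable (fun s => a s • u s) (Measure.haar : Measure G) := by
  have h : ∀ n : ℕ, ∃ f : G → ℂ, HasCompactSupport f ∧
      eLpNorm (⇑a - f) 2 (Measure.haar : Measure G) ≤ ENNReal.ofReal (1 / ((n : ℝ) + 1)) ∧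
      Continuous f ∧ MemLp f 2 (Measure.haar : Measure G) := fun n =>
    exists_hasCompactSupport_eLpNorm_sub_le_of_memLp (by simp) (Lp.memLp a)
      (by rw [ne_eq, ENNReal.ofReal_eq_zero, not_le]; positivity)
  choose f hf1 hf2 hf3 hf4 using h
  have h0 : Tendsto (fun n => eLpNorm (f n - ⇑a) 2 (Measure.haar : Measure G)) atTop (𝓝 0) := by
    have h1 : Tendsto (fun n : ℕ => ENNReal.ofReal (1 / ((n : ℝ) + 1))) atTop (𝓝 0) := by
      have := ENNReal.tendsto_ofReal (tendsto_one_div_add_atTop_nhds_zero_nat (𝕜 := ℝ))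
      simpa using this
    refine tendsto_of_tendsto_of_tendsto_of_le_of_le tendsto_const_nhds h1 (fun _ => bot_le)
      fun n => ?_
    rw [eLpNorm_sub_comm]
    exact hf2 n
  obtain ⟨ns, -, hns⟩ := (tendstoInMeasure_of_tendsto_eLpNorm (by simp)
    (fun n => (hf4 n).1) (Lp.aestronglyMeasurable a) h0).exists_seq_tendsto_ae
  refine aestronglyMeasurable_of_tendsto_ae atTop (f := fun n s => f (ns n) s • u s)
    (fun n => ?_) ?_
  · refine StronglyMeasurable.aestronglyMeasurable ?_
    exact ((hf3 (ns n)).smul hu).stronglyMeasurable_of_hasCompactSupport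
      ((hf1 (ns n)).smul_right)
  · filter_upwards [hns] with s hs using hs.smul_const _

theorem memLp_smul_boundedContinuous (a : L2 G) (u : G →ᵇ E) :
    MemLp (fun s => a s • u s) 2 (Measure.haar : Measure G) := by
  refine MemLp.of_le_mul (c := ‖u‖) (Lp.memLp a)
    (aestronglyMeasurable_smul_continuous a u.continuous) (ae_of_all _ fun s => ?_)
  rw [norm_smul, mul_comm]
  exact mul_le_mul_of_nonneg_right (u.norm_coe_le_norm s) (norm_nonneg _)

/-- The product of an `L²` function with a bounded continuous vector valued function. -/
def twist (u : G →ᵇ E) (a : L2 G) : Lp E 2 (Measure.haar : Measure G) :=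
  (memLp_smul_boundedContinuous a u).toLp _

theorem twist_coeFn (u : G →ᵇ E) (a : L2 G) :
    twist u a =ᵐ[(Measure.haar : Measure G)] fun s => a s • u s :=
  (memLp_smul_boundedContinuous a u).coeFn_toLp

theorem inner_twist {u v : G →ᵇ E} {z : ℂ} (h : ∀ s, inner ℂ (u s) (v s) = z) (a b : L2 G) :
    inner ℂ (twist u a) (twist v b) = inner ℂ a b * z := by
  rw [L2.inner_def, L2.inner_def, ← integral_mul_const]
  refine integral_congr_ae ?_
  filter_upwards [twist_coeFn u a, twist_coeFn v b] with s h1 h2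
  rw [h1, h2, inner_smul_left, inner_smul_right, RCLike.inner_apply, h]
  ring

variable {Q : Type*} [Group Q] [TopologicalSpace Q] [IsTopologicalGroup Q]
  [LocallyCompactSpace Q] [MeasurableSpace Q] [BorelSpace Q] {q : G →* Q}

/-- The orbit map `s ↦ λ(q s) c`. -/
def orbit (hq : Continuous q) (c : L2 Q) : G →ᵇ L2 Q :=
  BoundedContinuousFunction.ofNormedAddCommGroup (fun s => leftReg (q s) c)
    ((continuous_leftReg c).comp hq) ‖c‖ fun _ => (norm_leftReg_apply _ _).le

/-- The inverse orbit map `s ↦ λ(q s)⁻¹ c`. -/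
def coorbit (hq : Continuous q) (c : L2 Q) : G →ᵇ L2 Q :=
  BoundedContinuousFunction.ofNormedAddCommGroup (fun s => leftReg (q s)⁻¹ c)
    ((continuous_leftReg c).comp hq.inv) ‖c‖ fun _ => (norm_leftReg_apply _ _).le

theorem inner_leftReg_leftReg (g : G) (ξ η : L2 G) :
    inner ℂ (leftReg g η) (leftReg g ξ) = inner ℂ η ξ := by
  rw [inner_leftReg_left, leftReg_inv_apply_self]

theorem inner_twist_orbit (hq : Continuous q) (d c : L2 Q) (b a : L2 G) :
    inner ℂ (twist (orbit hq d) b) (twist (orbit hq c) a) = inner ℂ b a * inner ℂ d c :=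
  inner_twist (fun _ => inner_leftReg_leftReg _ _ _) b a

theorem inner_twist_coorbit (hq : Continuous q) (d c : L2 Q) (b a : L2 G) :
    inner ℂ (twist (coorbit hq d) b) (twist (coorbit hq c) a) = inner ℂ b a * inner ℂ d c :=
  inner_twist (fun _ => inner_leftReg_leftReg _ _ _) b a

/-- The isometry `a ⊗ c ↦ twist (coorbit c) a` intertwines `λ(g) ⊗ λ(q g)` with `λ(g) ⊗ 1`. So
conjugating `x ⊗ 1` by it defines the coaction on all of `L(G)`. -/
theorem vecTranslate_twist_coorbit (hq : Continuous q) (g : G) (c : L2 Q) (a : L2 G) :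
    vecTranslate g (twist (coorbit hq c) a) =
      twist (coorbit hq (leftReg (q g) c)) (leftReg g a) := by
  apply Lp.ext
  filter_upwards [vecTranslate_coeFn g (twist (coorbit hq c) a),
    (measurePreserving_mul_left (Measure.haar : Measure G) g⁻¹).quasiMeasurePreserving.ae
      (twist_coeFn (coorbit hq c) a),
    twist_coeFn (coorbit hq (leftReg (q g) c)) (leftReg g a), leftReg_coeFn g a] with s h1 h2 h3 h4
  rw [h1, h2, h3, h4]
  congr 1
  change leftReg (q (g⁻¹ * s))⁻¹ c = leftReg (q s)⁻¹ (leftReg (q g) c)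
  rw [← leftReg_mul_apply, map_mul, map_inv, mul_inv_rev, inv_inv]

variable (q) in
/-- The tensor product of the regular representation of `G` with that of `Q`, as a representation
of `G`. -/
def vecAct (g : G) (τ : Lp (L2 Q) 2 (Measure.haar : Measure G)) :
    Lp (L2 Q) 2 (Measure.haar : Measure G) :=
  (leftReg (q g)).compLpL 2 (Measure.haar : Measure G) (vecTranslate g τ)

variable (q) in
theorem vecAct_coeFn (g : G) (τ : Lp (L2 Q) 2 (Measure.haar : Measure G)) :
    vecAct q g τ =ᵐ[(Measure.haar : Measure G)] fun s => leftReg (q g) (τ (g⁻¹ * s)) := by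
  filter_upwards [ContinuousLinearMap.coeFn_compLpL (leftReg (q g)) (vecTranslate g τ),
    vecTranslate_coeFn g τ] with s h1 h2
  rw [vecAct, h1, h2]

variable (q) in
theorem vecAct_add (g : G) (σ τ : Lp (L2 Q) 2 (Measure.haar : Measure G)) :
    vecAct q g (σ + τ) = vecAct q g σ + vecAct q g τ := by
  rw [vecAct, vecTranslate, map_add, map_add]
  rfl

variable (q) in
theorem vecAct_sum (g : G) {ι : Type*} (s : Finset ι)
    (τ : ι → Lp (L2 Q) 2 (Measure.haar : Measure G)) :
    vecAct q g (∑ i ∈ s, τ i) = ∑ i ∈ s, vecAct q g (τ i) := by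
  rw [vecAct, vecTranslate, map_sum, map_sum]
  rfl

variable (q) in
theorem continuous_vecAct (g : G) : Continuous (vecAct q g) :=
  ((leftReg (q g)).compLpL 2 (Measure.haar : Measure G)).continuous.comp
    (Lp.isometry_compMeasurePreserving
      (measurePreserving_mul_left (Measure.haar : Measure G) g⁻¹)).continuous

theorem vecAct_elemTensor (g : G) (a : L2 G) (c : L2 Q) :
    vecAct q g (elemTensor a c) = elemTensor (leftReg g a) (leftReg (q g) c) := by
  apply Lp.ext
  filter_upwards [vecAct_coeFn q g (elemTensor a c),
    (measurePreserving_mul_left (Measure.haar : Measure G) g⁻¹).quasiMeasurePreserving.ae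
      (elemTensor_coeFn a c),
    elemTensor_coeFn (leftReg g a) (leftReg (q g) c), leftReg_coeFn g a] with s h1 h2 h3 h4
  rw [h1, h2, h3, h4, map_smul]

/-- For fixed `c`, the twist intertwines `λ(g)` with `λ(g) ⊗ λ(q g)`; compressing by it recovers
`λ(g)` from the coaction. -/
theorem vecAct_twist_orbit (hq : Continuous q) (g : G) (c : L2 Q) (a : L2 G) :
    vecAct q g (twist (orbit hq c) a) = twist (orbit hq c) (leftReg g a) := by
  apply Lp.ext
  filter_upwards [vecAct_coeFn q g (twist (orbit hq c) a),
    (measurePreserving_mul_left (Measure.haar : Measure G) g⁻¹).quasiMeasurePreserving.ae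
      (twist_coeFn (orbit hq c) a),
    twist_coeFn (orbit hq c) (leftReg g a), leftReg_coeFn g a] with s h1 h2 h3 h4
  rw [h1, h2, h3, h4, map_smul]
  congr 1
  change leftReg (q g) (leftReg (q (g⁻¹ * s)) c) = leftReg (q s) c
  rw [← leftReg_mul_apply, ← map_mul, mul_inv_cancel_left]

end Twist

/-! ### Slices of the coaction and finite corners of `id ⊗ N` -/

section Slices

theorem norm_sq_sum_of_orthogonal {F : Type*} [NormedAddCommGroup F] [InnerProductSpace ℂ F]
    {ι : Type*} (s : Finset ι) {w : ι → F} (h : ∀ i j, i ≠ j → inner ℂ (w i) (w j) = 0) :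
    ‖∑ i ∈ s, w i‖ ^ 2 = ∑ i ∈ s, ‖w i‖ ^ 2 := by
  classical
  induction s using Finset.induction_on with
  | empty => simp
  | insert a s ha ih =>
    rw [Finset.sum_insert ha, Finset.sum_insert ha, ← ih]
    have h0 : inner ℂ (w a) (∑ i ∈ s, w i) = 0 := by
      rw [inner_sum]
      exact Finset.sum_eq_zero fun i hi => h a i fun hai => ha (hai ▸ hi)
    have := norm_add_sq_eq_norm_sq_add_norm_sq_of_inner_eq_zero (𝕜 := ℂ) (w a) _ h0
    simpa only [sq] using this

variable {G : Type*} [Group G] [TopologicalSpace G] [IsTopologicalGroup G]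
  [LocallyCompactSpace G] [MeasurableSpace G] [BorelSpace G]
  {Q : Type*} [Group Q] [TopologicalSpace Q] [IsTopologicalGroup Q]
  [LocallyCompactSpace Q] [MeasurableSpace Q] [BorelSpace Q] {q : G →* Q}
  {ι κ : Type*} (e : HilbertBasis ι ℂ (L2 G)) (b : HilbertBasis κ ℂ (L2 Q))

theorem vecTranslate_sum {E : Type*} [NormedAddCommGroup E] [InnerProductSpace ℂ E]
    [CompleteSpace E] (g : G) {α : Type*} (s : Finset α)
    (τ : α → Lp E 2 (Measure.haar : Measure G)) :
    vecTranslate g (∑ i ∈ s, τ i) = ∑ i ∈ s, vecTranslate g (τ i) := map_sum _ _ _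

theorem ampFunctional_sum {α β : Type*} (s : Finset α) (t : Finset β)
    (σ : α → Lp (L2 Q) 2 (Measure.haar : Measure G))
    (τ : β → Lp (L2 Q) 2 (Measure.haar : Measure G)) :
    ampFunctional b (∑ i ∈ s, σ i) (∑ j ∈ t, τ j) =
      ∑ i ∈ s, ∑ j ∈ t, ampFunctional b (σ i) (τ j) := by
  refine (isNormalWith_ampFunctional b _ _).unique (IsNormalWith.sum s fun i _ =>
    IsNormalWith.sum t fun j _ => isNormalWith_ampFunctional b (σ i) (τ j)) fun g => ?_
  simp only [vecTranslate_sum, sum_inner, inner_sum]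
  exact Finset.sum_comm

theorem norm_twist_coorbit (hq : Continuous q) (c : L2 Q) (a : L2 G) :
    ‖twist (coorbit hq c) a‖ = ‖a‖ * ‖c‖ := by
  have h := inner_twist_coorbit hq c c a a
  simp only [inner_self_eq_norm_sq_to_K] at h
  have h1 : ‖twist (coorbit hq c) a‖ ^ 2 = (‖a‖ * ‖c‖) ^ 2 := by
    rw [mul_pow]
    exact_mod_cast h
  exact (sq_eq_sq₀ (norm_nonneg _) (by positivity)).1 h1

theorem norm_twist_orbit (hq : Continuous q) (c : L2 Q) (a : L2 G) :
    ‖twist (orbit hq c) a‖ = ‖a‖ * ‖c‖ := by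
  have h := inner_twist_orbit hq c c a a
  simp only [inner_self_eq_norm_sq_to_K] at h
  have h1 : ‖twist (orbit hq c) a‖ ^ 2 = (‖a‖ * ‖c‖) ^ 2 := by
    rw [mul_pow]
    exact_mod_cast h
  exact (sq_eq_sq₀ (norm_nonneg _) (by positivity)).1 h1

theorem norm_ampFunctional_le (σ τ : Lp (L2 Q) 2 (Measure.haar : Measure G))
    (x : (groupVN G).toStarSubalgebra) :
    ‖ampFunctional b σ τ x‖ ≤ ‖(x : L2 G →L[ℂ] L2 G)‖ * ‖σ‖ * ‖τ‖ := by
  have h := norm_sum_ampFunctional_le b (n := Unit) (X := fun _ _ => x)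
    (norm_nonneg (x : L2 G →L[ℂ] L2 G)) (fun η ξ => ?_) (fun _ => σ) (fun _ => τ)
  · simpa [tupleNorm, Real.sqrt_sq (norm_nonneg _)] using h
  · simp only [matrixForm, tupleNorm, Finset.univ_unique, Finset.sum_singleton,
      Real.sqrt_sq (norm_nonneg _)]
    refine (norm_inner_le_norm _ _).trans ?_
    rw [mul_comm _ ‖η _‖, mul_assoc]
    exact mul_le_mul_of_nonneg_left (ContinuousLinearMap.le_opNorm _ _) (norm_nonneg _)

/-- The slice of the coaction `λ(g) ↦ λ(g) ⊗ λ(q g)` by a vector functional of `L(G)`. -/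
theorem exists_coaction_slice (hq : Continuous q) (η ξ : L2 G) :
    ∃ Φ : (groupVN G).toStarSubalgebra →ₗ[ℂ] (groupVN Q).toStarSubalgebra,
      ∀ x d c, inner ℂ d ((Φ x : L2 Q →L[ℂ] L2 Q) c) =
        ampFunctional b (twist (coorbit hq d) η) (twist (coorbit hq c) ξ) x := by
  refine exists_linearMap_of_isNormalWith (χ := fun g => inner ℂ η (leftReg g ξ)) (π := q)
    (B := ‖η‖ * ‖ξ‖) (fun d c => ?_) fun d c x => ?_
  · have h := isNormalWith_ampFunctional b (twist (coorbit hq d) η) (twist (coorbit hq c) ξ)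
    simpa only [vecTranslate_twist_coorbit, inner_twist_coorbit] using h
  · refine (norm_ampFunctional_le b _ _ x).trans_eq ?_
    rw [norm_twist_coorbit, norm_twist_coorbit]
    ring

/-- The slice of the coaction by a pair of vectors. -/
def coactionSlice (hq : Continuous q) (η ξ : L2 G) :
    (groupVN G).toStarSubalgebra →ₗ[ℂ] (groupVN Q).toStarSubalgebra :=
  (exists_coaction_slice b hq η ξ).choose

theorem inner_coactionSlice (hq : Continuous q) (η ξ : L2 G) (x : (groupVN G).toStarSubalgebra)
    (d c : L2 Q) : inner ℂ d ((coactionSlice b hq η ξ x : L2 Q →L[ℂ] L2 Q) c) =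
      ampFunctional b (twist (coorbit hq d) η) (twist (coorbit hq c) ξ) x :=
  (exists_coaction_slice b hq η ξ).choose_spec x d c

theorem coactionSlice_lam (hq : Continuous q) (η ξ : L2 G) (g : G) :
    coactionSlice b hq η ξ (lam g) = (inner ℂ η (leftReg g ξ) : ℂ) • lam (q g) := by
  apply Subtype.ext
  ext1 c
  refine ext_inner_left ℂ fun d => ?_
  rw [inner_coactionSlice, (isNormalWith_ampFunctional b _ _).apply_lam,
    vecTranslate_twist_coorbit, inner_twist_coorbit]
  exact (inner_smul_right _ _ _).symm

theorem norm_coactionSlice_le (hq : Continuous q) (η ξ : L2 G)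
    (x : (groupVN G).toStarSubalgebra) :
    ‖(coactionSlice b hq η ξ x : L2 Q →L[ℂ] L2 Q)‖ ≤
      ‖η‖ * ‖ξ‖ * ‖(x : L2 G →L[ℂ] L2 G)‖ := by
  refine ContinuousLinearMap.opNorm_le_bound _ (by positivity) fun c => ?_
  set y := (coactionSlice b hq η ξ x : L2 Q →L[ℂ] L2 Q) c with hy
  have h1 : ‖inner ℂ y y‖ ≤ ‖(x : L2 G →L[ℂ] L2 G)‖ * (‖η‖ * ‖y‖) * (‖ξ‖ * ‖c‖) := by
    have h := norm_ampFunctional_le b (twist (coorbit hq y) η) (twist (coorbit hq c) ξ) x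
    rwa [← inner_coactionSlice, norm_twist_coorbit, norm_twist_coorbit] at h
  rw [inner_self_eq_norm_sq_to_K, norm_pow, RCLike.norm_ofReal, abs_of_nonneg (norm_nonneg _)] at h1
  rcases (norm_nonneg y).eq_or_lt with h0 | h0
  · rw [← h0]
    positivity
  · refine le_of_mul_le_mul_left ?_ h0
    nlinarith

variable {N : (groupVN Q).toStarSubalgebra →ₗ[ℂ] (groupVN Q).toStarSubalgebra} {ψ : Q → ℂ}

/-- The functional `x ↦ ⟪d, N (Φ x) c⟫` for a slice `Φ` of the coaction. -/
def sliceFunctional (N : (groupVN Q).toStarSubalgebra →ₗ[ℂ] (groupVN Q).toStarSubalgebra)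
    (hq : Continuous q) (η ξ : L2 G) (d c : L2 Q) : (groupVN G).toStarSubalgebra →ₗ[ℂ] ℂ where
  toFun x := inner ℂ d ((N (coactionSlice b hq η ξ x) : L2 Q →L[ℂ] L2 Q) c)
  map_add' x y := by
    rw [map_add, map_add]
    exact inner_add_right _ _ _
  map_smul' r x := by
    rw [map_smul, map_smul]
    exact inner_smul_right _ _ _

/-- Unit vectors make the slice a contraction, so that it maps the unit ball into the unit ball, on
which `N` is known to be continuous. -/
theorem isNormalWith_sliceFunctional (hN : IsNormalMap (groupVN Q) N)
    (hNψ : ∀ h, N (lam h) = ψ h • lam h) {C : ℝ} (hC : 0 ≤ C) (hNC : CBBound (groupVN Q) N C)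
    (hq : Continuous q) {η ξ : L2 G} (hη : ‖η‖ = 1) (hξ : ‖ξ‖ = 1) (d c : L2 Q) :
    IsNormalWith (sliceFunctional b N hq η ξ d c)
      (fun g => ψ (q g) * inner ℂ (elemTensor η d) (vecAct q g (elemTensor ξ c))) where
  ballNormal := by
    refine (hN.ballNormal c d).comp (Φ := coactionSlice b hq η ξ) (fun ζ θ => ?_) fun T hT => ?_
    · simp only [inner_coactionSlice]
      exact (isNormalWith_ampFunctional b _ _).ballNormal
    · refine (norm_coactionSlice_le b hq η ξ T).trans ?_
      rwa [hη, hξ, one_mul, one_mul]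
  bounded := by
    refine ⟨‖d‖ * (C * ‖c‖), fun x => ?_⟩
    have h0 : ‖sliceFunctional b N hq η ξ d c x‖ ≤
        ‖d‖ * ‖(N (coactionSlice b hq η ξ x) : L2 Q →L[ℂ] L2 Q) c‖  :=
      norm_inner_le_norm (𝕜 := ℂ) d ((N (coactionSlice b hq η ξ x) : L2 Q →L[ℂ] L2 Q) c)
    refine h0.trans ?_
    rw [mul_assoc]
    refine mul_le_mul_of_nonneg_left ?_ (norm_nonneg d)
    refine (ContinuousLinearMap.le_opNorm _ _).trans ?_
    rw [mul_right_comm]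
    refine mul_le_mul_of_nonneg_right ((hNC.norm_le hC _).trans ?_) (norm_nonneg c)
    refine mul_le_mul_of_nonneg_left ?_ hC
    have h := norm_coactionSlice_le b hq η ξ x
    rwa [hη, hξ, one_mul, one_mul] at h
  apply_lam g := by
    change inner ℂ d ((N (coactionSlice b hq η ξ (lam g)) : L2 Q →L[ℂ] L2 Q) c) = _
    rw [coactionSlice_lam, map_smul, hNψ, vecAct_elemTensor, inner_elemTensor]
    change inner ℂ d (inner ℂ η (leftReg g ξ) • ψ (q g) • leftReg (q g) c) = _
    rw [inner_smul_right, inner_smul_right]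
    ring

/-- The vector `∑ eᵢ ⊗ cᵢ`. -/
def tensorSum (c : ι →₀ L2 Q) : Lp (L2 Q) 2 (Measure.haar : Measure G) :=
  ∑ i ∈ c.support, elemTensor (e i) (c i)

theorem elemTensor_zero (a : L2 G) : elemTensor a (0 : L2 Q) = 0 := by
  have h := elemTensor_sub_right a (0 : L2 Q) 0
  rwa [sub_self, sub_self] at h

theorem tensorSum_eq {c : ι →₀ L2 Q} {s : Finset ι} (hs : c.support ⊆ s) :
    tensorSum e c = ∑ i ∈ s, elemTensor (e i) (c i) := by
  refine Finset.sum_subset hs fun i _ hi => ?_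
  rw [Finsupp.notMem_support_iff.1 hi, elemTensor_zero]

theorem tensorSum_sub (c d : ι →₀ L2 Q) : tensorSum e (c - d) = tensorSum e c - tensorSum e d := by
  classical
  rw [tensorSum_eq e (s := c.support ∪ d.support) Finsupp.support_sub,
    tensorSum_eq e (c := c) Finset.subset_union_left,
    tensorSum_eq e (c := d) Finset.subset_union_right, ← Finset.sum_sub_distrib]
  simp only [Finsupp.sub_apply, elemTensor_sub_right]

theorem norm_sq_sum_elemTensor (s : Finset ι) (c : ι → L2 Q) :
    ‖∑ i ∈ s, elemTensor (e i) (c i)‖ ^ 2 = ∑ i ∈ s, ‖c i‖ ^ 2 := by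
  classical
  rw [norm_sq_sum_of_orthogonal s fun i j hij => by
    rw [inner_elemTensor, e.orthonormal.inner_eq_zero hij, zero_mul]]
  refine Finset.sum_congr rfl fun i _ => ?_
  have h := inner_elemTensor (e i) (e i) (c i) (c i)
  simp only [inner_self_eq_norm_sq_to_K, e.orthonormal.norm_eq_one] at h
  simp only [RCLike.ofReal_one, one_pow, one_mul] at h
  exact_mod_cast h

/-- The functional on `L(G)` attached to a pair of finite sums of elementary tensors. -/
def tensorFunctional (N : (groupVN Q).toStarSubalgebra →ₗ[ℂ] (groupVN Q).toStarSubalgebra)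
    (hq : Continuous q) (d c : ι →₀ L2 Q) : (groupVN G).toStarSubalgebra →ₗ[ℂ] ℂ :=
  ∑ i ∈ d.support, ∑ j ∈ c.support, sliceFunctional b N hq (e i) (e j) (d i) (c j)

theorem sliceFunctional_zero_left (hq : Continuous q) (η ξ : L2 G) (c : L2 Q) :
    sliceFunctional b N hq η ξ 0 c = 0 :=
  LinearMap.ext fun x =>
    inner_zero_left ((N (coactionSlice b hq η ξ x) : L2 Q →L[ℂ] L2 Q) c)

theorem sliceFunctional_zero_right (hq : Continuous q) (η ξ : L2 G) (d : L2 Q) :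
    sliceFunctional b N hq η ξ d 0 = 0 := by
  refine LinearMap.ext fun x => ?_
  change inner ℂ d ((N (coactionSlice b hq η ξ x) : L2 Q →L[ℂ] L2 Q) 0) = 0
  rw [map_zero, inner_zero_right]

theorem tensorFunctional_eq (hq : Continuous q) {d c : ι →₀ L2 Q} {s : Finset ι}
    (hd : d.support ⊆ s) (hc : c.support ⊆ s) : tensorFunctional e b N hq d c =
      ∑ i ∈ s, ∑ j ∈ s, sliceFunctional b N hq (e i) (e j) (d i) (c j) := by
  have h1 : ∀ i, ∑ j ∈ c.support, sliceFunctional b N hq (e i) (e j) (d i) (c j) =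
      ∑ j ∈ s, sliceFunctional b N hq (e i) (e j) (d i) (c j) := fun i =>
    Finset.sum_subset hc fun j _ hj => by
      rw [Finsupp.notMem_support_iff.1 hj, sliceFunctional_zero_right]
  rw [tensorFunctional]
  simp only [h1]
  refine Finset.sum_subset hd fun i _ hi => ?_
  simp only [Finsupp.notMem_support_iff.1 hi, sliceFunctional_zero_left, Finset.sum_const_zero]

theorem isNormalWith_tensorFunctional (hN : IsNormalMap (groupVN Q) N)
    (hNψ : ∀ h, N (lam h) = ψ h • lam h) {C : ℝ} (hC : 0 ≤ C) (hNC : CBBound (groupVN Q) N C)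
    (hq : Continuous q) (d c : ι →₀ L2 Q) :
    IsNormalWith (tensorFunctional e b N hq d c)
      (fun g => ψ (q g) * inner ℂ (tensorSum e d) (vecAct q g (tensorSum e c))) := by
  have h := IsNormalWith.sum d.support fun i _ => IsNormalWith.sum c.support fun j _ =>
    isNormalWith_sliceFunctional b hN hNψ hC hNC hq (e.orthonormal.norm_eq_one i)
      (e.orthonormal.norm_eq_one j) (d i) (c j)
  simp only [← Finset.mul_sum] at h
  have h1 : ∀ g, inner ℂ (tensorSum e d) (vecAct q g (tensorSum e c)) =
      ∑ i ∈ d.support, ∑ j ∈ c.support,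
        inner ℂ (elemTensor (e i) (d i)) (vecAct q g (elemTensor (e j) (c j))) := by
    intro g
    simp only [tensorSum, vecAct_sum, sum_inner, inner_sum]
    exact Finset.sum_comm
  simp only [h1]
  exact h

/-- Slicing by basis vectors `e i`, `e j` gives the entries of a finite corner of the coaction.
Applying the complete bound of `N` to matrices indexed by `n × s` amounts to bounding `id ⊗ N` on
this corner, with a constant independent of `s`. -/
theorem norm_sum_tensorFunctional_le {C : ℝ} (hC : 0 ≤ C) (hNC : CBBound (groupVN Q) N C)
    (hq : Continuous q) {n : Type*} [Fintype n] {X : n → n → (groupVN G).toStarSubalgebra} {K : ℝ}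
    (hK : 0 ≤ K) (hX : ∀ η ξ : n → L2 G, ‖matrixForm (fun i j => (X i j : L2 G →L[ℂ] L2 G)) η ξ‖ ≤
      K * tupleNorm η * tupleNorm ξ) (d c : n → ι →₀ L2 Q) :
    ‖∑ k, ∑ l, tensorFunctional e b N hq (d k) (c l) (X k l)‖ ≤
      C * K * tupleNorm (fun k => tensorSum e (d k)) * tupleNorm (fun k => tensorSum e (c k)) := by
  classical
  let s : Finset ι := (Finset.univ.biUnion fun k => (d k).support) ∪
    Finset.univ.biUnion fun k => (c k).support
  have hd : ∀ k, (d k).support ⊆ s := fun k =>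
    (Finset.subset_biUnion_of_mem (fun k => (d k).support) (Finset.mem_univ k)).trans
      Finset.subset_union_left
  have hc : ∀ k, (c k).support ⊆ s := fun k =>
    (Finset.subset_biUnion_of_mem (fun k => (c k).support) (Finset.mem_univ k)).trans
      Finset.subset_union_right
  have hnorm : ∀ d : n → ι →₀ L2 Q, (∀ k, (d k).support ⊆ s) →
      tupleNorm (fun p : n × s => d p.1 p.2) = tupleNorm (fun k => tensorSum e (d k)) := by
    intro d hd
    rw [tupleNorm, tupleNorm, Fintype.sum_prod_type]
    congr 1
    refine Finset.sum_congr rfl fun k _ => ?_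
    rw [tensorSum_eq e (hd k), norm_sq_sum_elemTensor]
    exact Finset.sum_coe_sort s (fun i => ‖d k i‖ ^ 2)
  have h := hNC.matrixForm_le hC
    (fun p r : n × s => coactionSlice b hq (e p.2) (e r.2) (X p.1 r.1)) hK (fun η ξ => ?_)
    (fun p => d p.1 p.2) (fun p => c p.1 p.2)
  · rw [hnorm d hd, hnorm c hc] at h
    refine le_of_eq_of_le ?_ h
    congr 1
    simp only [matrixForm, Fintype.sum_prod_type]
    refine Finset.sum_congr rfl fun k _ => ?_
    rw [Finset.sum_comm]
    refine Finset.sum_congr rfl fun l _ => ?_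
    rw [tensorFunctional_eq e b hq (hd k) (hc l), LinearMap.sum_apply]
    simp only [LinearMap.sum_apply]
    rw [← Finset.sum_coe_sort s]
    refine Finset.sum_congr rfl fun i _ => ?_
    rw [← Finset.sum_coe_sort s]
    rfl
  -- Twists of orthogonal basis vectors are orthogonal, so the bound for the matrix of slices
  -- reduces to that of the ampliation of `X`.
  · have hortho : ∀ η : n × s → L2 Q, tupleNorm (fun k => ∑ i : s,
        twist (coorbit hq (η (k, i))) (e i)) = tupleNorm η := by
      intro η
      rw [tupleNorm, tupleNorm, Fintype.sum_prod_type]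
      congr 1
      refine Finset.sum_congr rfl fun k _ => ?_
      rw [norm_sq_sum_of_orthogonal _ fun i j hij => by
        rw [inner_twist_coorbit, e.orthonormal.inner_eq_zero (Subtype.coe_injective.ne hij),
          zero_mul]]
      simp only [norm_twist_coorbit, e.orthonormal.norm_eq_one, one_mul]
    have h1 := norm_sum_ampFunctional_le b hK hX
      (fun k => ∑ i : s, twist (coorbit hq (η (k, i))) (e i))
      (fun k => ∑ i : s, twist (coorbit hq (ξ (k, i))) (e i))
    rw [hortho, hortho] at h1
    refine le_of_eq_of_le ?_ h1
    congr 1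
    simp only [matrixForm, Fintype.sum_prod_type]
    refine Finset.sum_congr rfl fun k _ => ?_
    rw [Finset.sum_comm]
    refine Finset.sum_congr rfl fun l _ => ?_
    rw [ampFunctional_sum, LinearMap.sum_apply]
    simp only [LinearMap.sum_apply, inner_coactionSlice]

end Slices

/-! ### Pulling back multipliers along a continuous homomorphism -/

section Pullback

variable {G : Type*} [Group G] [TopologicalSpace G] [IsTopologicalGroup G]
  [LocallyCompactSpace G] [MeasurableSpace G] [BorelSpace G]
  {Q : Type*} [Group Q] [TopologicalSpace Q] [IsTopologicalGroup Q]
  [LocallyCompactSpace Q] [MeasurableSpace Q] [BorelSpace Q] {q : G →* Q}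

/-- A sequence of normal functionals that is Cauchy in norm converges to a normal functional. -/
theorem exists_isNormalWith_of_cauchy {f : ℕ → (groupVN G).toStarSubalgebra →ₗ[ℂ] ℂ}
    {χ : ℕ → G → ℂ} {χ' : G → ℂ} (hf : ∀ m, IsNormalWith (f m) (χ m))
    (hχ : ∀ g, Tendsto (fun m => χ m g) atTop (𝓝 (χ' g))) {δ : ℕ → ℝ}
    (hδ : Tendsto δ atTop (𝓝 0))
    (h : ∀ m n k (x : (groupVN G).toStarSubalgebra), k ≤ m → k ≤ n →
      ‖f m x - f n x‖ ≤ δ k * ‖(x : L2 G →L[ℂ] L2 G)‖) :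
    ∃ F, IsNormalWith F χ' ∧ ∀ x, Tendsto (fun m => f m x) atTop (𝓝 (F x)) := by
  have hlim : ∀ x, ∃ z, Tendsto (fun m => f m x) atTop (𝓝 z) := by
    intro x
    refine cauchySeq_tendsto_of_complete (cauchySeq_of_le_tendsto_0
      (fun k => δ k * ‖(x : L2 G →L[ℂ] L2 G)‖) (fun m n k hm hn => ?_) ?_)
    · rw [dist_eq_norm]
      exact h m n k x hm hn
    · simpa using hδ.mul_const ‖(x : L2 G →L[ℂ] L2 G)‖
  choose F hF using hlim
  have hFm : ∀ m (x : (groupVN G).toStarSubalgebra),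
      ‖F x - f m x‖ ≤ δ m * ‖(x : L2 G →L[ℂ] L2 G)‖ := by
    intro m x
    refine le_of_tendsto ((hF x).sub_const (f m x)).norm ?_
    filter_upwards [eventually_ge_atTop m] with n hn using h n m m x hn le_rfl
  obtain ⟨F', rfl⟩ : ∃ F' : (groupVN G).toStarSubalgebra →ₗ[ℂ] ℂ, ⇑F' = F := by
    refine ⟨⟨⟨F, fun x y => ?_⟩, fun r x => ?_⟩, rfl⟩
    · refine tendsto_nhds_unique (hF (x + y)) ?_
      simp only [map_add]
      exact (hF x).add (hF y)
    · refine tendsto_nhds_unique (hF (r • x)) ?_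
      simp only [map_smul]
      exact (hF x).const_smul r
  refine ⟨F', ⟨?_, ?_, ?_⟩, hF⟩
  · refine BallNormal.of_approx fun ε hε => ?_
    obtain ⟨m, hm⟩ := (hδ.eventually_lt_const hε).exists
    refine ⟨f m, (hf m).ballNormal, fun T hT => (hFm m T).trans ?_⟩
    rcases le_or_gt 0 (δ m) with h1 | h1
    · exact (mul_le_of_le_one_right h1 hT).trans hm.le
    · exact (mul_nonpos_of_nonpos_of_nonneg h1.le (norm_nonneg _)).trans hε.le
  · obtain ⟨B, hB⟩ := (hf 0).bounded
    refine ⟨δ 0 + B, fun x => ?_⟩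
    calc ‖F' x‖ = ‖(F' x - f 0 x) + f 0 x‖ := by rw [sub_add_cancel]
      _ ≤ ‖F' x - f 0 x‖ + ‖f 0 x‖ := norm_add_le _ _
      _ ≤ δ 0 * ‖(x : L2 G →L[ℂ] L2 G)‖ + B * ‖(x : L2 G →L[ℂ] L2 G)‖ :=
        add_le_add (hFm 0 x) (hB x)
      _ = (δ 0 + B) * ‖(x : L2 G →L[ℂ] L2 G)‖ := (add_mul _ _ _).symm
  · intro g
    refine tendsto_nhds_unique (hF (lam g)) ?_
    simp only [(hf _).apply_lam]
    exact hχ g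

variable {ι κ : Type*} (e : HilbertBasis ι ℂ (L2 G)) (b : HilbertBasis κ ℂ (L2 Q))

theorem elemTensor_add_right (a : L2 G) (c c' : L2 Q) :
    elemTensor a (c + c') = elemTensor a c + elemTensor a c' := by
  have h := elemTensor_sub_right a (c + c') c'
  rw [add_sub_cancel_right] at h
  rw [h, sub_add_cancel]

theorem elemTensor_smul_right (r : ℂ) (a : L2 G) (c : L2 Q) :
    elemTensor a (r • c) = r • elemTensor a c := by
  rw [← elemTensor_smul]
  exact map_smul _ _ _

/-- Finite sums `∑ eᵢ ⊗ cᵢ` are dense. -/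
theorem exists_tensorSum_approx (τ : Lp (L2 Q) 2 (Measure.haar : Measure G)) {ε : ℝ} (hε : 0 < ε) :
    ∃ c : ι →₀ L2 Q, ‖τ - tensorSum e c‖ < ε := by
  classical
  let D : Submodule ℂ (Lp (L2 Q) 2 (Measure.haar : Measure G)) :=
    { carrier := Set.range (tensorSum e)
      zero_mem' := ⟨0, by simp [tensorSum]⟩
      add_mem' := by
        rintro _ _ ⟨c, rfl⟩ ⟨d, rfl⟩
        refine ⟨c + d, ?_⟩
        rw [tensorSum_eq e (s := c.support ∪ d.support) Finsupp.support_add,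
          tensorSum_eq e (c := c) Finset.subset_union_left,
          tensorSum_eq e (c := d) Finset.subset_union_right, ← Finset.sum_add_distrib]
        simp only [Finsupp.add_apply, elemTensor_add_right]
      smul_mem' := by
        rintro r _ ⟨c, rfl⟩
        refine ⟨r • c, ?_⟩
        rw [tensorSum_eq e (c := r • c) Finsupp.support_smul, tensorSum, Finset.smul_sum]
        simp only [Finsupp.smul_apply, elemTensor_smul_right] }
  have hle : Submodule.span ℂ {x : Lp (L2 Q) 2 (Measure.haar : Measure G) |
      ∃ a c, x = elemTensor a c} ≤ D.topologicalClosure := by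
    refine Submodule.span_le.2 ?_
    rintro _ ⟨a, c, rfl⟩
    have h1 : HasSum (fun i => elemTensor (e.repr a i • e i) c) (elemTensor a c) :=
      (((1 : ℂ →L[ℂ] ℂ).smulRight c).compLpL 2 (Measure.haar : Measure G)).hasSum (e.hasSum_repr a)
    refine mem_closure_of_tendsto h1 (Eventually.of_forall fun s => sum_mem fun i _ => ?_)
    rw [elemTensor_smul]
    refine ⟨Finsupp.single i (e.repr a i • c), ?_⟩
    rw [tensorSum_eq e (s := {i}) Finsupp.support_single_subset, Finset.sum_singleton,
      Finsupp.single_eq_same]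
  have h2 : τ ∈ D.topologicalClosure :=
    Submodule.topologicalClosure_minimal _ hle (Submodule.isClosed_topologicalClosure _)
      (mem_closure_span_elemTensor τ)
  obtain ⟨_, ⟨c, rfl⟩, hc⟩ := Metric.mem_closure_iff.1 h2 ε hε
  exact ⟨c, by rwa [← dist_eq_norm]⟩

/-- The difference is split as `(d - d', c)` plus `(d', c - c')`, which is verified on symbols. The
estimate makes the functionals Cauchy when the tensors converge. -/
theorem norm_tensorFunctional_sub_le {N : (groupVN Q).toStarSubalgebra →ₗ[ℂ]
    (groupVN Q).toStarSubalgebra} {ψ : Q → ℂ} (hN : IsNormalMap (groupVN Q) N)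
    (hNψ : ∀ h, N (lam h) = ψ h • lam h) {C : ℝ} (hC : 0 ≤ C) (hNC : CBBound (groupVN Q) N C)
    (hq : Continuous q) (d c d' c' : ι →₀ L2 Q) (x : (groupVN G).toStarSubalgebra) :
    ‖tensorFunctional e b N hq d c x - tensorFunctional e b N hq d' c' x‖ ≤
      C * (‖tensorSum e d - tensorSum e d'‖ * ‖tensorSum e c‖ +
        ‖tensorSum e d'‖ * ‖tensorSum e c - tensorSum e c'‖) * ‖(x : L2 G →L[ℂ] L2 G)‖ := by
  have hn := isNormalWith_tensorFunctional e b hN hNψ hC hNC hq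
  have h1 : ∀ d c, ‖tensorFunctional e b N hq d c x‖ ≤
      C * (‖tensorSum e d‖ * ‖tensorSum e c‖) * ‖(x : L2 G →L[ℂ] L2 G)‖ := by
    intro d c
    have h := norm_sum_tensorFunctional_le e b hC hNC hq (n := Unit) (X := fun _ _ => x)
      (norm_nonneg (x : L2 G →L[ℂ] L2 G)) (fun η ξ => ?_) (fun _ => d) (fun _ => c)
    · simp only [tupleNorm, Finset.univ_unique, Finset.sum_singleton,
        Real.sqrt_sq (norm_nonneg _)] at h
      exact h.trans_eq (by ring)
    · simp only [matrixForm, tupleNorm, Finset.univ_unique, Finset.sum_singleton,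
        Real.sqrt_sq (norm_nonneg _)]
      refine (norm_inner_le_norm _ _).trans ?_
      rw [mul_comm _ ‖η _‖, mul_assoc]
      exact mul_le_mul_of_nonneg_left (ContinuousLinearMap.le_opNorm _ _) (norm_nonneg _)
  have hadd : ∀ g (σ τ : Lp (L2 Q) 2 (Measure.haar : Measure G)),
      vecAct q g (σ - τ) = vecAct q g σ - vecAct q g τ := by
    intro g σ τ
    rw [eq_sub_iff_add_eq, ← vecAct_add, sub_add_cancel]
  have h2 : tensorFunctional e b N hq d c - tensorFunctional e b N hq d' c' =
      tensorFunctional e b N hq (d - d') c + tensorFunctional e b N hq d' (c - c') := by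
    refine ((hn d c).sub (hn d' c')).unique ((hn (d - d') c).add (hn d' (c - c'))) fun g => ?_
    rw [tensorSum_sub, tensorSum_sub, hadd, inner_sub_left, inner_sub_right]
    ring
  have h3 := congrArg (fun f => f x) h2
  simp only [LinearMap.sub_apply, LinearMap.add_apply] at h3
  rw [h3, ← tensorSum_sub, ← tensorSum_sub, mul_add, add_mul]
  exact norm_add_le_of_le (h1 _ _) (h1 _ _)

/-- Pulling back a completely bounded multiplier along a continuous homomorphism gives a completely
bounded multiplier with the same bound. -/
theorem IsCBMultiplierWith.comp_hom {ψ : Q → ℂ} {C : ℝ} (hC : 0 ≤ C)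
    (h : IsCBMultiplierWith ψ C) (hq : Continuous q) :
    IsCBMultiplierWith (fun g => ψ (q g)) C := by
  obtain ⟨N, hN, hNψ, hNC⟩ := h
  obtain ⟨w, e, -⟩ := exists_hilbertBasis ℂ (L2 G)
  obtain ⟨v, b, -⟩ := exists_hilbertBasis ℂ (L2 Q)
  obtain ⟨c₀, hc₀⟩ := exists_norm_eq_one_L2 (G := Q)
  -- The wanted functionals are `⟪V d, (id ⊗ N)(Δ x) V a⟫`; they are obtained as limits over finite
  -- tensor sums approximating `V d` and `V a`.
  let V : L2 G → Lp (L2 Q) 2 (Measure.haar : Measure G) := fun a => twist (orbit hq c₀) a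
  have hV : ∀ a, ‖V a‖ = ‖a‖ := fun a => by
    rw [norm_twist_orbit, hc₀, mul_one]
  have happ : ∀ (a : L2 G) (m : ℕ), ∃ c : w →₀ L2 Q,
      ‖V a - tensorSum e c‖ < 1 / ((m : ℝ) + 1) := fun a m =>
    exists_tensorSum_approx e (V a) (by positivity)
  choose c hc using happ
  have hlim : ∀ a, Tendsto (fun m => tensorSum e (c a m)) atTop (𝓝 (V a)) := by
    intro a
    rw [tendsto_iff_norm_sub_tendsto_zero]
    refine squeeze_zero (fun _ => norm_nonneg _) (fun m => ?_)
      (tendsto_one_div_add_atTop_nhds_zero_nat (𝕜 := ℝ))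
    rw [norm_sub_rev]
    exact (hc a m).le
  have hbd : ∀ a m, ‖tensorSum e (c a m)‖ ≤ ‖a‖ + 1 := by
    intro a m
    have h1 := norm_sub_norm_le (tensorSum e (c a m)) (V a)
    rw [norm_sub_rev, hV] at h1
    have h2 : 1 / ((m : ℝ) + 1) ≤ 1 := by
      rw [div_le_one (by positivity)]
      linarith [(Nat.cast_nonneg m : (0 : ℝ) ≤ m)]
    linarith [hc a m]
  have hdiff : ∀ a m n k, k ≤ m → k ≤ n →
      ‖tensorSum e (c a m) - tensorSum e (c a n)‖ ≤ 2 * (1 / ((k : ℝ) + 1)) := by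
    intro a m n k hm hn
    have h1 := norm_sub_le_norm_sub_add_norm_sub (tensorSum e (c a m)) (V a) (tensorSum e (c a n))
    rw [norm_sub_rev _ (V a)] at h1
    have h2 := one_div_le_one_div_of_le (by positivity)
      (by exact_mod_cast Nat.add_le_add_right hm 1 : (k : ℝ) + 1 ≤ (m : ℝ) + 1)
    have h3 := one_div_le_one_div_of_le (by positivity)
      (by exact_mod_cast Nat.add_le_add_right hn 1 : (k : ℝ) + 1 ≤ (n : ℝ) + 1)
    linarith [hc a m, hc a n]
  have hn := isNormalWith_tensorFunctional e b hN hNψ hC hNC hq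
  have hex : ∀ d a, ∃ F, IsNormalWith F (fun g => ψ (q g) * inner ℂ d (leftReg g a)) ∧
      ∀ x, Tendsto (fun m => tensorFunctional e b N hq (c d m) (c a m) x) atTop (𝓝 (F x)) := by
    intro d a
    refine exists_isNormalWith_of_cauchy (fun m => hn (c d m) (c a m)) (fun g => ?_)
      (δ := fun k => C * (2 * (1 / ((k : ℝ) + 1)) * (‖a‖ + 1) +
        (‖d‖ + 1) * (2 * (1 / ((k : ℝ) + 1))))) ?_ fun m n k x hm hn' => ?_
    · refine Tendsto.const_mul _ ?_
      have h1 := (hlim d).inner (((continuous_vecAct q g).tendsto _).comp (hlim a)) (𝕜 := ℂ)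
      -- The normalisation of `c₀` ensures that the limit has the symbol of the multiplier `ψ ∘ q`,
      -- without an extra factor.
      have h2 : inner ℂ (V d) (vecAct q g (V a)) = inner ℂ d (leftReg g a) := by
        rw [vecAct_twist_orbit, inner_twist_orbit, inner_self_eq_norm_sq_to_K, hc₀]
        simp
      rw [h2] at h1
      exact h1
    · have h1 := tendsto_one_div_add_atTop_nhds_zero_nat (𝕜 := ℝ)
      have h2 := ((((h1.const_mul 2).mul_const (‖a‖ + 1)).add
        ((h1.const_mul 2).const_mul (‖d‖ + 1))).const_mul C)
      simpa using h2
    · refine (norm_tensorFunctional_sub_le e b hN hNψ hC hNC hq _ _ _ _ x).trans ?_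
      refine mul_le_mul_of_nonneg_right (mul_le_mul_of_nonneg_left ?_ hC) (norm_nonneg _)
      exact add_le_add
        (mul_le_mul (hdiff d m n k hm hn') (hbd a m) (norm_nonneg _) (by positivity))
        (mul_le_mul (hbd d n) (hdiff a m n k hm hn') (norm_nonneg _) (by positivity))
  choose F hF1 hF2 using hex
  refine isCBMultiplierWith_of_isNormalWith hC hF1 fun n X K hK hX d a => ?_
  have ht : Tendsto (fun m => ∑ i, ∑ j,
      tensorFunctional e b N hq (c (d i) m) (c (a j) m) (X i j)) atTop
      (𝓝 (∑ i, ∑ j, F (d i) (a j) (X i j))) :=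
    tendsto_finsetSum _ fun i _ => tendsto_finsetSum _ fun j _ => hF2 _ _ _
  have htn : ∀ a : Fin n → L2 G, Tendsto (fun m => tupleNorm fun i => tensorSum e (c (a i) m))
      atTop (𝓝 (tupleNorm a)) := by
    intro a
    have h1 : Tendsto (fun m => ∑ i, ‖tensorSum e (c (a i) m)‖ ^ 2) atTop
        (𝓝 (∑ i, ‖V (a i)‖ ^ 2)) := tendsto_finsetSum _ fun i _ => (hlim (a i)).norm.pow 2
    simp only [hV] at h1
    exact (Real.continuous_sqrt.tendsto _).comp h1
  refine le_of_tendsto_of_tendsto' ht.norm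
    (((htn d).const_mul (C * K)).mul (htn a)) fun m => ?_
  exact norm_sum_tensorFunctional_le e b hC hNC hq hK hX (fun i => c (d i) m) fun i => c (a i) m

end Pullback

/-! ### Transport of means and preduals between `G` and `Q` -/

section Transport

variable {G : Type*} [Group G] [TopologicalSpace G] [IsTopologicalGroup G]
  [LocallyCompactSpace G] [MeasurableSpace G] [BorelSpace G]
  {Q : Type*} [Group Q] [TopologicalSpace Q] [IsTopologicalGroup Q]
  [LocallyCompactSpace Q] [MeasurableSpace Q] [BorelSpace Q] {q : G →* Q}

/-- A completely contractive comparison of multipliers decreases the norm. -/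
theorem m0aNorm_le_of_imp {φ : M0A G} {ψ : M0A Q}
    (h : ∀ C : ℝ, 0 ≤ C → IsCBMultiplierWith (φ : G → ℂ) C → IsCBMultiplierWith (ψ : Q → ℂ) C) :
    m0aNorm ψ ≤ m0aNorm φ :=
  csInf_le_csInf ⟨0, fun _ hC => hC.1⟩ (exists_nonneg_bound_of_mem_M0A φ.2)
    fun C hC => ⟨hC.1, h C hC.1 hC.2⟩

/-- Elements of the predual are approximated by continuous densities of compact support. -/
theorem exists_hasCompactSupport_of_mem_predual {x : M0A G →ₗ[ℂ] ℂ} (hx : x ∈ predual G) {ε : ℝ}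
    (hε : 0 < ε) : ∃ a : G → ℂ, Continuous a ∧ HasCompactSupport a ∧ ∀ φ : M0A G,
      ‖x φ - ∫ g, a g * (φ : G → ℂ) g ∂(Measure.haar : Measure G)‖ ≤ ε * m0aNorm φ := by
  obtain ⟨f, hf, hfx⟩ := hx (ε / 2) (half_pos hε)
  obtain ⟨a, ha, hfa, hac, hai⟩ := exists_hasCompactSupport_eLpNorm_sub_le_of_memLp (p := 1)
    ENNReal.one_ne_top (memLp_one_iff_integrable.2 hf) (ε := ENNReal.ofReal (ε / 2))
    (by simpa using hε)
  refine ⟨a, hac, ha, fun φ => ?_⟩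
  have hai' : Integrable a (Measure.haar : Measure G) := memLp_one_iff_integrable.1 hai
  have hint : ∀ {b : G → ℂ}, Integrable b (Measure.haar : Measure G) →
      Integrable (fun g => b g * (φ : G → ℂ) g) (Measure.haar : Measure G) := fun {b} hb =>
    hb.mul_bdd (c := m0aNorm φ) (continuous_of_mem_M0A φ.2).aestronglyMeasurable
      (ae_of_all _ fun g => norm_apply_le_m0aNorm φ g)
  have h1 : ∫ g, ‖f g - a g‖ ∂(Measure.haar : Measure G) ≤ ε / 2 := by
    have h2 := integral_norm_eq_lintegral_enorm (hf.sub hai').aestronglyMeasurable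
    rw [← eLpNorm_one_eq_lintegral_enorm] at h2
    calc _ = _ := h2
      _ ≤ (ENNReal.ofReal (ε / 2)).toReal := ENNReal.toReal_mono ENNReal.ofReal_ne_top hfa
      _ = ε / 2 := ENNReal.toReal_ofReal (half_pos hε).le
  have h3 : ‖(∫ g, f g * (φ : G → ℂ) g ∂(Measure.haar : Measure G)) -
      ∫ g, a g * (φ : G → ℂ) g ∂(Measure.haar : Measure G)‖ ≤ ε / 2 * m0aNorm φ := by
    rw [← integral_sub (hint hf) (hint hai')]
    calc _ ≤ ∫ g, ‖f g - a g‖ * m0aNorm φ ∂(Measure.haar : Measure G) := by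
          refine norm_integral_le_of_norm_le ((hf.sub hai').norm.mul_const _)
            (ae_of_all _ fun g => ?_)
          rw [← sub_mul, norm_mul]
          exact mul_le_mul_of_nonneg_left (norm_apply_le_m0aNorm φ g) (norm_nonneg _)
      _ = (∫ g, ‖f g - a g‖ ∂(Measure.haar : Measure G)) * m0aNorm φ := integral_mul_const _ _
      _ ≤ _ := mul_le_mul_of_nonneg_right h1 (m0aNorm_nonneg φ)
  calc _ = ‖(x φ - ∫ g, f g * (φ : G → ℂ) g ∂(Measure.haar : Measure G)) +
        ((∫ g, f g * (φ : G → ℂ) g ∂(Measure.haar : Measure G)) -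
          ∫ g, a g * (φ : G → ℂ) g ∂(Measure.haar : Measure G))‖ := by rw [sub_add_sub_cancel]
    _ ≤ ε / 2 * m0aNorm φ + ε / 2 * m0aNorm φ := norm_add_le_of_le (hfx φ) h3
    _ = ε * m0aNorm φ := by ring

/-- A linear map whose transpose respects the preduals is weak* continuous. -/
theorem continuous_weakStar {T : M0A G →ₗ[ℂ] M0A Q} (hT : ∀ x ∈ predual Q, x ∘ₗ T ∈ predual G)
    {m : M0A Q →ₗ[ℂ] ℂ} (hm : @Continuous _ _ (weakStar Q) inferInstance m) :
    @Continuous _ _ (weakStar G) inferInstance (m ∘ₗ T) := by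
  have h : @Continuous _ _ (weakStar G) (weakStar Q) T := by
    refine continuous_iInf_rng.2 fun x => continuous_iInf_rng.2 fun hx => ?_
    refine continuous_induced_rng.2 ?_
    exact continuous_iInf_dom (i := x ∘ₗ T)
      (continuous_iInf_dom (i := hT x hx) continuous_induced_dom)
  exact @Continuous.comp _ _ _ (weakStar G) (weakStar Q) _ _ _ hm h

section Average

variable [CompactSpace q.ker]

theorem integrable_kerMeasure {f : G → ℂ} (hf : Continuous f) (g : G) :
    Integrable (fun k : q.ker => f (k * g)) (kerMeasure q) := by
  refine Continuous.integrable_of_hasCompactSupport ?_ (HasCompactSupport.of_compactSpace _)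
  fun_prop

theorem leftAvg_add {f f' : G → ℂ} (hf : Continuous f) (hf' : Continuous f') (g : G) :
    leftAvg q (f + f') g = leftAvg q f g + leftAvg q f' g :=
  integral_add (integrable_kerMeasure hf g) (integrable_kerMeasure hf' g)

theorem leftAvg_smul (c : ℂ) (f : G → ℂ) (g : G) :
    leftAvg q (c • f) g = c • leftAvg q f g :=
  integral_smul c _

theorem norm_leftAvg_le {f : G → ℂ} {c : ℝ} (hf : ∀ g, ‖f g‖ ≤ c) (g : G) :
    ‖leftAvg q f g‖ ≤ c := by
  have h := norm_integral_le_of_norm_le_const (μ := kerMeasure q)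
    (ae_of_all _ fun k : q.ker => hf (k * g))
  simpa [leftAvg] using h

theorem leftAvg_nonneg {f : G → ℂ} (hf : ∀ g, ∃ r : ℝ, 0 ≤ r ∧ f g = r) (g : G) :
    ∃ r : ℝ, 0 ≤ r ∧ leftAvg q f g = r := by
  choose r hr hfr using hf
  refine ⟨∫ k : q.ker, r (k * g) ∂kerMeasure q, integral_nonneg fun k => hr _, ?_⟩
  rw [leftAvg, ← integral_complex_ofReal]
  simp only [hfr]

/-- The image is again a Haar probability measure on the kernel, and there is only one. -/
theorem map_conj_kerMeasure (g : G) :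
    Measure.map (MulAut.conjNormal g : q.ker ≃* q.ker) (kerMeasure q) = kerMeasure q := by
  have hc : Continuous (MulAut.conjNormal g : q.ker ≃* q.ker) := by
    refine Continuous.subtype_mk (f := fun k : q.ker => g * k * g⁻¹) (by fun_prop) _
  have h1 : (Measure.map (MulAut.conjNormal g : q.ker ≃* q.ker) (kerMeasure q)).IsHaarMeasure :=
    Measure.isHaarMeasure_map_of_isFiniteMeasure (μ := kerMeasure q)
      (MulAut.conjNormal g : q.ker ≃* q.ker).toMonoidHom hc (MulEquiv.surjective _)
  have h2 : IsProbabilityMeasure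
      (Measure.map (MulAut.conjNormal g : q.ker ≃* q.ker) (kerMeasure q)) :=
    Measure.isProbabilityMeasure_map hc.aemeasurable
  exact Measure.isHaarMeasure_eq_of_isProbabilityMeasure _ _

/-- Averaging over the kernel commutes with left translations. -/
theorem leftAvg_translate {f : G → ℂ} (hf : Continuous f) (g h : G) :
    leftAvg q (fun x => f (g⁻¹ * x)) h = leftAvg q f (g⁻¹ * h) := by
  have hc : Continuous (MulAut.conjNormal g⁻¹ : q.ker ≃* q.ker) := by
    refine Continuous.subtype_mk (f := fun k : q.ker => g⁻¹ * k * g⁻¹⁻¹) (by fun_prop) _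
  rw [leftAvg, leftAvg]
  conv_rhs => rw [← map_conj_kerMeasure g⁻¹]
  rw [integral_map hc.aemeasurable]
  · refine integral_congr_ae (ae_of_all _ fun k => ?_)
    change f (g⁻¹ * (k * h)) = f (g⁻¹ * k * g⁻¹⁻¹ * (g⁻¹ * h))
    congr 1
    group
  · exact Continuous.aestronglyMeasurable (by fun_prop)

end Average

namespace IsCompactQuotient

/-- Composition with the quotient map `q`, as a map `M₀A(Q) → M₀A(G)`. -/
def pullM0A (hq : IsCompactQuotient q) : M0A Q →ₗ[ℂ] M0A G where
  toFun φ := ⟨fun g => (φ : Q → ℂ) (q g), by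
    obtain ⟨C, hC, h⟩ := exists_nonneg_bound_of_mem_M0A φ.2
    exact ⟨C, h.comp_hom hC hq.continuous⟩⟩
  map_add' _ _ := rfl
  map_smul' _ _ := rfl

theorem m0aNorm_pullM0A_le (hq : IsCompactQuotient q) (φ : M0A Q) :
    m0aNorm (hq.pullM0A φ) ≤ m0aNorm φ :=
  m0aNorm_le_of_imp fun _ hC h => h.comp_hom hC hq.continuous

theorem isLeftInvariantMean_comp_pullM0A (hq : IsCompactQuotient q) {m : M0A G →ₗ[ℂ] ℂ}
    (hm : IsLeftInvariantMean m) : IsLeftInvariantMean (m ∘ₗ hq.pullM0A) where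
  nonneg φ h := hm.nonneg _ fun g => h (q g)
  map_one := hm.map_one
  norm_le φ c h := hm.norm_le _ c fun g => h (q g)
  left_invariant y φ := by
    obtain ⟨g, rfl⟩ := hq.surjective y
    rw [LinearMap.comp_apply, LinearMap.comp_apply, ← hm.left_invariant g (hq.pullM0A φ)]
    congr 1
    ext h
    change (φ : Q → ℂ) ((q g)⁻¹ * q h) = (φ : Q → ℂ) (q (g⁻¹ * h))
    rw [map_mul, map_inv]

variable [CompactSpace q.ker]

/-- A density `a` on `G` is replaced by its average on `Q`, times `modulus` to account for the two
Haar normalisations. The norm inequality for `pullM0A` controls the error. -/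
theorem comp_pullM0A_mem_predual (hq : IsCompactQuotient q) {x : M0A G →ₗ[ℂ] ℂ}
    (hx : x ∈ predual G) : x ∘ₗ hq.pullM0A ∈ predual Q := by
  intro ε hε
  obtain ⟨a, hac, ha, hax⟩ := exists_hasCompactSupport_of_mem_predual hx hε
  have hqc := continuous_quotAvg hq hac
  have hqs := hasCompactSupport_quotAvg hq ha
  refine ⟨fun y => hq.modulus * quotAvg q a y,
    (hqc.integrable_of_hasCompactSupport hqs).const_mul _, fun φ => ?_⟩
  have hφ := continuous_of_mem_M0A φ.2
  have h1 : ∫ y, hq.modulus * quotAvg q a y * (φ : Q → ℂ) y ∂(Measure.haar : Measure Q) =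
      ∫ g, a g * (hq.pullM0A φ : G → ℂ) g ∂(Measure.haar : Measure G) := by
    calc _ = hq.modulus * ∫ y, (φ : Q → ℂ) y * quotAvg q a y ∂(Measure.haar : Measure Q) := by
          rw [← integral_const_mul]
          congr 1 with y
          ring
      _ = ∫ g, (φ : Q → ℂ) (q g) * quotAvg q a (q g) ∂(Measure.haar : Measure G) :=
          (integral_comp_quotient hq hq.map_haar (hφ.mul hqc).aestronglyMeasurable).symm
      _ = ∫ g, (φ : Q → ℂ) (q g) * a g ∂(Measure.haar : Measure G) := by
          simp only [quotAvg_apply hq]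
          exact integral_mul_leftAvg_of_invariant (hφ.comp hq.continuous) hac (Or.inr ha)
      _ = _ := by
          congr 1 with g
          exact mul_comm _ _
  rw [h1]
  exact (hax _).trans (mul_le_mul_of_nonneg_left (hq.m0aNorm_pullM0A_le φ) hε.le)

/-- Averaging over the kernel of `q`, as a map `M₀A(G) → M₀A(Q)`. -/
def pushM0A (hq : IsCompactQuotient q) : M0A G →ₗ[ℂ] M0A Q where
  toFun φ := ⟨quotAvg q φ, by
    obtain ⟨C, hC, h⟩ := exists_nonneg_bound_of_mem_M0A φ.2
    exact ⟨C, hq.isCBMultiplierWith_quotAvg hC h⟩⟩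
  map_add' φ ψ := by
    ext y
    exact leftAvg_add (continuous_of_mem_M0A φ.2) (continuous_of_mem_M0A ψ.2) _
  map_smul' c φ := by
    ext y
    exact leftAvg_smul c _ _

theorem m0aNorm_pushM0A_le (hq : IsCompactQuotient q) (φ : M0A G) :
    m0aNorm (hq.pushM0A φ) ≤ m0aNorm φ :=
  m0aNorm_le_of_imp fun _ hC h => hq.isCBMultiplierWith_quotAvg hC h

theorem pushM0A_pullM0A (hq : IsCompactQuotient q) (φ : M0A Q) :
    hq.pushM0A (hq.pullM0A φ) = φ :=
  Subtype.ext (quotAvg_comp hq _)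

theorem isLeftInvariantMean_comp_pushM0A (hq : IsCompactQuotient q) {m : M0A Q →ₗ[ℂ] ℂ}
    (hm : IsLeftInvariantMean m) : IsLeftInvariantMean (m ∘ₗ hq.pushM0A) where
  nonneg φ h := hm.nonneg _ fun y => leftAvg_nonneg h _
  map_one := by
    rw [← hm.map_one]
    exact congrArg m (hq.pushM0A_pullM0A ⟨1, one_mem_M0A⟩)
  norm_le φ c h := hm.norm_le _ c fun y => norm_leftAvg_le h _
  left_invariant g φ := by
    rw [LinearMap.comp_apply, LinearMap.comp_apply, ← hm.left_invariant (q g) (hq.pushM0A φ)]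
    congr 1
    ext y
    obtain ⟨h, rfl⟩ := hq.surjective y
    change quotAvg q (fun x => (φ : G → ℂ) (g⁻¹ * x)) (q h) = quotAvg q φ ((q g)⁻¹ * q h)
    rw [← map_inv, ← map_mul, quotAvg_apply hq, quotAvg_apply hq,
      leftAvg_translate (continuous_of_mem_M0A φ.2)]

/-- A density `a` on `Q` is replaced by `a ∘ q`, divided by `modulus`. Since `a ∘ q` is invariant
under the kernel, pairing with it does not see the averaging. -/
theorem comp_pushM0A_mem_predual (hq : IsCompactQuotient q) {x : M0A Q →ₗ[ℂ] ℂ}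
    (hx : x ∈ predual Q) : x ∘ₗ hq.pushM0A ∈ predual G := by
  intro ε hε
  obtain ⟨a, hac, ha, hax⟩ := exists_hasCompactSupport_of_mem_predual hx hε
  have hac' : Continuous fun g => a (q g) := hac.comp hq.continuous
  have ha' := hasCompactSupport_comp hq ha
  refine ⟨fun g => (hq.modulus : ℂ)⁻¹ * a (q g),
    (hac'.integrable_of_hasCompactSupport ha').const_mul _, fun φ => ?_⟩
  have hφ := continuous_of_mem_M0A φ.2
  have hc : (hq.modulus : ℂ) ≠ 0 := by
    exact_mod_cast hq.modulus_ne_zero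
  have h1 : ∫ g, (hq.modulus : ℂ)⁻¹ * a (q g) * (φ : G → ℂ) g ∂(Measure.haar : Measure G) =
      ∫ y, a y * (hq.pushM0A φ : Q → ℂ) y ∂(Measure.haar : Measure Q) := by
    calc _ = (hq.modulus : ℂ)⁻¹ * ∫ g, a (q g) * (φ : G → ℂ) g ∂(Measure.haar : Measure G) := by
          rw [← integral_const_mul]
          simp only [mul_assoc]
      _ = (hq.modulus : ℂ)⁻¹ *
          ∫ g, a (q g) * quotAvg q φ (q g) ∂(Measure.haar : Measure G) := by
          simp only [quotAvg_apply hq]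
          rw [integral_mul_leftAvg_of_invariant hac' hφ (Or.inl ha')]
      _ = _ := by
          rw [integral_comp_quotient hq (f := fun y => a y * quotAvg q φ y) hq.map_haar
            (hac.mul (continuous_quotAvg hq hφ)).aestronglyMeasurable, inv_mul_cancel_left₀ hc]
          rfl
  rw [h1]
  exact (hax _).trans (mul_le_mul_of_nonneg_left (hq.m0aNorm_pushM0A_le φ) hε.le)

/-- A left invariant mean does not change when a multiplier is averaged over the kernel. -/
theorem isLeftInvariantMean_apply_eq (hq : IsCompactQuotient q) {m : M0A G →ₗ[ℂ] ℂ}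
    (hm : IsLeftInvariantMean m) (φ : M0A G) : m φ = m (hq.pullM0A (hq.pushM0A φ)) := by
  -- At finitely many points the average over the kernel lies in the closed convex hull of the
  -- values of the translates, being an integral over a probability measure.
  refine hm.eq_of_mem_closure_convexHull (fun k : q.ker => (k : G)) φ _ fun F => ?_
  have hφ := continuous_of_mem_M0A φ.2
  have h := integral_mem_closure_convexHull (kerMeasure q)
    (f := fun (g : F) (k : q.ker) => (φ : G → ℂ) (k * g)) fun g => by fun_prop
  convert h using 1
  ext g
  exact quotAvg_apply hq _ _

end IsCompactQuotient

/-- Property (T*) passes between a group and its quotients by compact kernels. -/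
theorem IsCompactQuotient.exists_weakStar_continuous_mean_iff (hq : IsCompactQuotient q) :
    (∃ m : M0A G →ₗ[ℂ] ℂ, IsLeftInvariantMean m ∧
      (∀ m' : M0A G →ₗ[ℂ] ℂ, IsLeftInvariantMean m' → m' = m) ∧
      @Continuous _ _ (weakStar G) inferInstance m) ↔
    ∃ m : M0A Q →ₗ[ℂ] ℂ, IsLeftInvariantMean m ∧
      (∀ m' : M0A Q →ₗ[ℂ] ℂ, IsLeftInvariantMean m' → m' = m) ∧
      @Continuous _ _ (weakStar Q) inferInstance m := by
  have := hq.compactSpace_ker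
  constructor
  · rintro ⟨m, hm, huniq, hcont⟩
    refine ⟨m ∘ₗ hq.pullM0A, hq.isLeftInvariantMean_comp_pullM0A hm, fun m' hm' => ?_,
      continuous_weakStar (fun x hx => hq.comp_pullM0A_mem_predual hx) hcont⟩
    -- Uniqueness on `Q`: `m' = m' ∘ pushM0A ∘ pullM0A`, and `m' ∘ pushM0A` is the unique mean on
    -- `M₀A(G)`.
    ext φ
    rw [← huniq _ (hq.isLeftInvariantMean_comp_pushM0A hm')]
    change m' φ = m' (hq.pushM0A (hq.pullM0A φ))
    rw [hq.pushM0A_pullM0A]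
  · rintro ⟨m, hm, huniq, hcont⟩
    refine ⟨m ∘ₗ hq.pushM0A, hq.isLeftInvariantMean_comp_pushM0A hm, fun m' hm' => ?_,
      continuous_weakStar (fun x hx => hq.comp_pushM0A_mem_predual hx) hcont⟩
    -- Uniqueness on `G`: `m'` is determined by `m' ∘ pullM0A`, as it does not change under
    -- averaging.
    ext φ
    rw [hq.isLeftInvariantMean_apply_eq hm' φ,
      ← huniq _ (hq.isLeftInvariantMean_comp_pullM0A hm')]
    rfl

end Transport

/-- The projection modulo a compact subgroup is closed, and its fibres are the compact cosets `g K`;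
together these give properness. -/
theorem isCompactQuotient_mk {G : Type*} [Group G] [TopologicalSpace G] [IsTopologicalGroup G]
    {K : Subgroup G} [K.Normal] (hK : IsCompact (K : Set G)) :
    IsCompactQuotient (QuotientGroup.mk' K) where
  isOpenQuotientMap := QuotientGroup.isOpenQuotientMap_mk
  isProperMap := by
    refine isProperMap_iff_isClosedMap_and_compact_fibers.2
      ⟨continuous_quot_mk, QuotientGroup.isClosedMap_coe hK, fun y => ?_⟩
    obtain ⟨g, rfl⟩ := QuotientGroup.mk'_surjective K y
    have h : QuotientGroup.mk' K ⁻¹' {QuotientGroup.mk' K g} = (fun k => g * k) '' (K : Set G) := by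
      ext x
      constructor
      · intro hx
        exact ⟨g⁻¹ * x, QuotientGroup.eq.1 (Eq.symm hx), mul_inv_cancel_left g x⟩
      · rintro ⟨k, hk, rfl⟩
        exact QuotientGroup.mk_mul_of_mem g hk
    rw [h]
    exact hK.image (continuous_const_mul g)

end TStar

end

theorem mainTheorem10 {G : Type*} [Group G] [TopologicalSpace G] [IsTopologicalGroup G]
    [LocallyCompactSpace G] [T2Space G] (K : Subgroup G) [K.Normal]
    (hK : IsCompact (K : Set G)) :
    PropertyTStar G ↔ PropertyTStar (G ⧸ K) := by
  let _ : MeasurableSpace G := borel G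
  let _ : MeasurableSpace (G ⧸ K) := borel (G ⧸ K)
  have : BorelSpace G := ⟨rfl⟩
  have : BorelSpace (G ⧸ K) := ⟨rfl⟩
  exact (TStar.isCompactQuotient_mk hK).exists_weakStar_continuous_mean_iff
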